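/- **Definitions.** Let $\mathcal T$ be one of $\mathbb N$, $\mathbb Z$, $\mathbb Q_{\ge 0}$, $\mathbb Q$. An election system maps each finite set of candidates and each finite multiset of votes (strict linear orders of the candidates) to a set of winners. An $m$-candidate *scoring vector* $\alpha=(\alpha_1\ge\dots\ge\alpha_m)$ gives a candidate $\alpha_i$ points for each vote that ranks it in position $i$; the winners are the candidates with the highest total. Two vectors of length $m$ are *equivalent* if they have the same winner set in every $m$-candidate election. A *$\mathcal T$-generator* $f$ assigns to each $m\ge 1$ a scoring vector $\alpha^m=(\alpha^m_1\ge\dots\ge\alpha^m_m)$ with entries in $\mathcal T$; it generates the election system that uses $\alpha^m$ whenever there are $m$ candidates. It is *pure* if for each $m\ge2$ some component of $\alpha^m$ can be deleted so that exactly $\alpha^{m-1}$ remains, and *flexible* if for each $m\ge 2$ some component of $\alpha^m$ can be deleted so that a vector equivalent to $\alpha^{m-1}$ remains. It is *FP-uniform* if $0^m\mapsto\alpha^m$ is computable in time polynomial in $m$, where the entries are written as fractions of binary integers; in the *nonuniform* setting no computability is required. In either setting, $\mathcal T$-PSR (respectively $\mathcal T$-FPSR) denotes the class of all election systems generated by a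 pure (respectively flexible) $\mathcal T$-generator, which in the FP-uniform setting must be FP-uniform. **Theorem.** In the FP-uniform setting, and also in the nonuniform setting, $$\mathbb N\text{-FPSR}=\mathbb Q\text{-FPSR}=\mathbb Q_{\ge0}\text{-FPSR}=\mathbb Z\text{-FPSR}=\mathbb Q\text{-PSR}.$$ -/

import Mathlib

/-! ### Elections and scoring systems -/

/-- A vote over the candidate set `C` (with `m` candidates): a strict linear order, given by the
bijection that sends each candidate to its position; position `0` is the voter's favorite. -/
abbrev Vote (C : Finset ℕ) (m : ℕ) : Type := C ≃ Fin m

/-- An election system maps every finite set of candidates (candidates are named by naturals) and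
every multiset of votes over it to a set of winners. -/
abbrev ElectionSystem : Type :=
  ∀ C : Finset ℕ, Multiset (Vote C C.card) → Set C

/-- The number of points of candidate `c` when each voter gives `α i` points to the candidate in
position `i`. -/
def score {C : Finset ℕ} {m : ℕ} (α : Fin m → ℚ) (V : Multiset (Vote C m)) (c : C) : ℚ :=
  (V.map fun v => α (v c)).sum

/-- The winners of the scoring system given by `α`: all candidates with the highest score. -/
def winners {C : Finset ℕ} {m : ℕ} (α : Fin m → ℚ) (V : Multiset (Vote C m)) : Set C :=
  {c | ∀ d : C, score α V d ≤ score α V c}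

/-- Two vectors are equivalent: they have the same winner set on every `m`-candidate election. -/
def VectorEquivalent {m : ℕ} (α β : Fin m → ℚ) : Prop :=
  ∀ C : Finset ℕ, C.card = m → ∀ V : Multiset (Vote C m), winners α V = winners β V

/-! ### Generators -/

/-- A family of rational vectors, one per length. (At length `0` there is only one vector, the
empty one, so this component carries no information.) -/
abbrev VectorFamily : Type := ∀ m : ℕ, Fin m → ℚ

/-- `f` is a generator with coefficients in `T`: for each `m ≥ 1` its vector is a scoring vector,
that is, nonincreasing, and all its entries are in `T`. -/
def IsGenerator (T : Set ℚ) (f : VectorFamily) : Prop :=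
  ∀ m : ℕ, 1 ≤ m → Antitone (f m) ∧ ∀ i, f m i ∈ T

/-- The election system generated by `f`. -/
def generatedSystem (f : VectorFamily) : ElectionSystem :=
  fun C V => winners (f C.card) V

/-- The vector `α` with component `i` deleted. -/
def deleteEntry {m : ℕ} (α : Fin (m + 1) → ℚ) (i : Fin (m + 1)) : Fin m → ℚ :=
  fun j => α (i.succAbove j)

/-- Purity: from length `2` on, deleting some component leaves exactly the previous vector. -/
def IsPure (f : VectorFamily) : Prop :=
  ∀ m : ℕ, 1 ≤ m → ∃ i : Fin (m + 1), deleteEntry (f (m + 1)) i = f m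

/-- Flexible purity: from length `2` on, deleting some component leaves a vector that is
equivalent to the previous one. -/
def IsFlexible (f : VectorFamily) : Prop :=
  ∀ m : ℕ, 1 ≤ m → ∃ i : Fin (m + 1), VectorEquivalent (deleteEntry (f (m + 1)) i) (f m)

/-! ### Uniformity -/

/-- The output alphabet: binary digits, the minus sign, the fraction bar and an end marker. -/
inductive OutSymbol
  | bit (b : Bool)
  | minus
  | slash
  | comma
  deriving DecidableEq, Fintype

/-- The code of an integer: an optional minus sign, then the binary digits (least significant
first) of the absolute value. -/
def encodeInt (p : ℤ) : List OutSymbol :=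
  (if p < 0 then [OutSymbol.minus] else []) ++
    (Computability.encodeNat p.natAbs).map OutSymbol.bit

/-- The code of the fraction `p / q`, closed by an end marker. -/
def encodeFraction (x : ℤ × ℕ) : List OutSymbol :=
  encodeInt x.1 ++ OutSymbol.slash ::
    ((Computability.encodeNat x.2).map OutSymbol.bit ++ [OutSymbol.comma])

/-- The code of a vector of fractions. -/
def encodeFractions (l : List (ℤ × ℕ)) : List OutSymbol :=
  l.flatMap encodeFraction

/-- `f` is computable in polynomial time: some Turing machine, on the input `0 ^ m`, writes down
the components of `f m`, as fractions of binary integers with positive denominators, in time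
polynomial in `m`. -/
def FPComputable (f : VectorFamily) : Prop :=
  ∃ g : ℕ → List (ℤ × ℕ),
    Nonempty (Turing.TM2ComputableInPolyTime Computability.unaryEncodeNat encodeFractions g) ∧
    ∀ m : ℕ, (∀ x ∈ g m, 0 < x.2) ∧
      (g m).map (fun x => (x.1 : ℚ) / (x.2 : ℚ)) = List.ofFn (f m)

/-- The two uniformity conditions: polynomial-time computable generators, or no condition. -/
inductive Uniformity
  | fp
  | nonuniform

/-- The generator `f` satisfies the uniformity condition. -/
def Uniformity.Holds : Uniformity → VectorFamily → Prop
  | .fp, f => FPComputable f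
  | .nonuniform, _ => True

/-! ### Classes of election systems -/

/-- The pure scoring rules with coefficients in `T`. -/
def PSR (u : Uniformity) (T : Set ℚ) : Set ElectionSystem :=
  {E | ∃ f : VectorFamily, IsGenerator T f ∧ u.Holds f ∧ IsPure f ∧ E = generatedSystem f}

/-- The flexible pure scoring rules with coefficients in `T`. -/
def FPSR (u : Uniformity) (T : Set ℚ) : Set ElectionSystem :=
  {E | ∃ f : VectorFamily, IsGenerator T f ∧ u.Holds f ∧ IsFlexible f ∧ E = generatedSystem f}

/-- The naturals, as a set of rationals. -/
def natCoeffs : Set ℚ := Set.range (fun n : ℕ => (n : ℚ))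

/-- The integers, as a set of rationals. -/
def intCoeffs : Set ℚ := Set.range (fun z : ℤ => (z : ℚ))

/-- The nonnegative rationals. -/
def nonnegRatCoeffs : Set ℚ := {q | 0 ≤ q}

/-- All rationals. -/
def ratCoeffs : Set ℚ := Set.univ

/-! All four coefficient sets lie between the naturals and the rationals, and a pure generator is
flexible. So two inclusions remain: a flexible rational generator can be replaced, without changing
the election system or losing uniformity, by a flexible natural generator and by a pure rational
one.

A positive affine change of the entries leaves all winners unchanged (`winners_eq_of_affine`).
Subtracting the last entry and multiplying by a product of denominators therefore gives natural
vectors (`exists_natFamily`). The product has at most as many bits as its factors together, so the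
output stays polynomial.

For purity a converse is needed: equivalent nonincreasing vectors are positive affine images of each
other (`VectorEquivalent.affineRelated`). Suitably padded elections have candidate `0` among the
winners exactly if `b * (α 0 - α last) ≤ a * (α j - α last)`, and such inequalities determine the
ratios of these differences. Hence some deletion `d` of each natural vector is affinely related to
the preceding vector `e`, and a quotient `(n - w) / (u - v)` of differences of entries of `e` keeps
its value when the entries are replaced by their counterparts in `d`. This suggests normalizing the
vectors as follows. Constant vectors become zero, up to the first nonconstant one. There `u`, `v`
are the first and last entry and `w` is the common value of the chosen deletion, which thus becomes
zero. From then on `u`, `v`, `w` are carried over to their counterparts in the next vector. Deleting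
an entry of a normalized vector then leaves exactly the preceding normalized vector
(`Normalization.valid_next`), with the winners unchanged (`Normalization.winners_vec`).

For polynomial time, the point is that a normalization is stored as three entries of the current
vector, so its size does not accumulate over the recursion (`Normalization.treeSize_next_le`); the
right deletion is found by testing all of them. The rest is the proof that such programs run on
Turing machines. Fragments of stack machines are combined and called as subroutines. The predicate
`PT`, polynomial time on tree codes, is closed under composition, pairing, case distinction and
loops or folds with bounded intermediate values, so that `fun_prop` can prove most instances.
`PT.of_polyTime` and `PT.polyTime` translate between tree codes and the prescribed encodings. -/

open Turing Function

/-! ### Running machines for a bounded number of steps -/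

/-- `ReachIn f n a b`: iterating the partial step function `f` at most `n` times leads from `a`
to `b`. -/
inductive ReachIn {α : Type*} (f : α → Option α) : ℕ → α → α → Prop
  | refl (n : ℕ) (a : α) : ReachIn f n a a
  | head {n : ℕ} {a b c : α} : f a = some b → ReachIn f n b c → ReachIn f (n + 1) a c

namespace ReachIn

variable {α β : Type*} {f : α → Option α} {g : β → Option β} {m n : ℕ} {a b c : α}

theorem trans (h₁ : ReachIn f m a b) (h₂ : ReachIn f n b c) : ReachIn f (m + n) a c := by
  induction h₁ with
  | refl m a =>
    induction h₂ with
    | refl n a => exact .refl _ _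
    | head h _ ih => exact .head h ih
  | head h _ ih => rw [Nat.add_right_comm]; exact .head h (ih h₂)

theorem mono (h : ReachIn f m a b) (hmn : m ≤ n) : ReachIn f n a b := by
  obtain ⟨k, rfl⟩ := Nat.exists_eq_add_of_le hmn
  exact h.trans (.refl k b)

theorem single (h : f a = some b) : ReachIn f 1 a b := .head h (.refl 0 b)

/-- Runs are transported along a map that commutes with single steps. -/
theorem map (φ : α → β) (H : ∀ a b, f a = some b → g (φ a) = some (φ b))
    (h : ReachIn f n a b) : ReachIn g n (φ a) (φ b) := by
  induction h with
  | refl n a => exact .refl _ _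
  | head h _ ih => exact .head (H _ _ h) ih

theorem iff_evalsToInTime :
    ReachIn f n a b ↔ Nonempty (StateTransition.EvalsToInTime f a (some b) n) := by
  constructor
  · intro h
    induction h with
    | refl n a => exact ⟨⟨⟨0, rfl⟩, Nat.zero_le _⟩⟩
    | head h _ ih =>
      obtain ⟨⟨⟨k, hk⟩, hkn⟩⟩ := ih
      refine ⟨⟨⟨k + 1, ?_⟩, Nat.succ_le_succ hkn⟩⟩
      rw [Function.iterate_succ_apply, ← hk]
      exact congrArg _ h
  · rintro ⟨⟨⟨k, hk⟩, hkn⟩⟩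
    refine mono (m := k) ?_ hkn
    clear hkn
    induction k generalizing a with
    | zero =>
      obtain rfl : a = b := by simpa using hk
      exact .refl _ _
    | succ k ih =>
      rw [Function.iterate_succ_apply] at hk
      cases h : f a with
      | some c =>
        refine .head h (ih ?_)
        rw [← hk, ← h]; rfl
      | none =>
        exfalso
        -- A machine that has stopped stays at `none`, so it cannot produce `some b` later.
        have key : ∀ k : ℕ, (flip bind f)^[k] none = none := by
          intro k
          induction k with
          | zero => rfl
          | succ k ih => rw [Function.iterate_succ_apply]; exact ih
        have : flip bind f (some a) = none := h
        rw [this, key] at hk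
        cases hk

end ReachIn

/-! ### Program fragments -/

/-- A program for a stack machine with stacks `Γ` and internal states `σ`; reaching `halt` means
leaving the fragment. -/
structure Frag {K : Type} (Γ : K → Type) (σ : Type) where
  Λ : Type
  [fin : Fintype Λ]
  main : Λ
  m : Λ → TM2.Stmt Γ Λ σ

attribute [instance] Frag.fin

namespace Frag

/-- Rename the labels by `g` and replace `halt` by a jump to `h`. -/
def relabel {K : Type} {Γ : K → Type} {σ Λ Λ' : Type} (g : Λ → Λ') (h : Option Λ') :
    TM2.Stmt Γ Λ σ → TM2.Stmt Γ Λ' σ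
  | .push k f q => .push k f (relabel g h q)
  | .peek k f q => .peek k f (relabel g h q)
  | .pop k f q => .pop k f (relabel g h q)
  | .load a q => .load a (relabel g h q)
  | .branch p q₁ q₂ => .branch p (relabel g h q₁) (relabel g h q₂)
  | .goto f => .goto fun v => g (f v)
  | .halt => h.elim .halt fun l => .goto fun _ => l

section

variable {K : Type} [DecidableEq K] {Γ : K → Type} {σ : Type}

/-- The effect of `relabel` on configurations. -/
def relabelCfg {Λ Λ' : Type} (g : Λ → Λ') (h : Option Λ') (c : TM2.Cfg Γ Λ σ) :
    TM2.Cfg Γ Λ' σ :=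
  ⟨c.l.elim h fun l => some (g l), c.var, c.stk⟩

theorem stepAux_relabel {Λ Λ' : Type} (g : Λ → Λ') (h : Option Λ') (q : TM2.Stmt Γ Λ σ) (v : σ)
    (S : ∀ k, List (Γ k)) :
    TM2.stepAux (relabel g h q) v S = relabelCfg g h (TM2.stepAux q v S) := by
  induction q generalizing v S with
  | push k f q ih | peek k f q ih | pop k f q ih | load a q ih => exact ih _ _
  | branch p q₁ q₂ ih₁ ih₂ =>
    simp only [relabel, TM2.stepAux]
    cases p v
    · exact ih₂ _ _
    · exact ih₁ _ _
  | goto f => rfl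
  | halt => cases h <;> rfl

/-- A run of a program is also a run of any program that contains a relabelled copy. -/
theorem reachIn_relabel {Λ Λ' : Type} {g : Λ → Λ'} {h : Option Λ'} {m : Λ → TM2.Stmt Γ Λ σ}
    {m' : Λ' → TM2.Stmt Γ Λ' σ} (H : ∀ l, m' (g l) = relabel g h (m l)) {n : ℕ}
    {a b : TM2.Cfg Γ Λ σ} (hr : ReachIn (TM2.step m) n a b) :
    ReachIn (TM2.step m') n (relabelCfg g h a) (relabelCfg g h b) := by
  refine hr.map _ ?_
  rintro ⟨_ | l, v, S⟩ b hb
  · cases hb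
  · simp only [TM2.step, Option.some.injEq] at hb
    subst hb
    change some (TM2.stepAux (m' (g l)) v S) = _
    rw [H, stepAux_relabel]

/-- `F.Runs n (v, S) (v', S')`: the fragment `F`, started with internal state `v` and stacks `S`,
halts after at most `n` steps with `v'` and `S'`. -/
def Runs (F : Frag Γ σ) (n : ℕ) (s s' : σ × (∀ k, List (Γ k))) : Prop :=
  ReachIn (TM2.step F.m) n ⟨some F.main, s.1, s.2⟩ ⟨none, s'.1, s'.2⟩

theorem Runs.mono {F : Frag Γ σ} {m n : ℕ} {s s' : σ × (∀ k, List (Γ k))} (h : F.Runs m s s')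
    (hmn : m ≤ n) : F.Runs n s s' :=
  ReachIn.mono h hmn

/-- A single statement. -/
def block (q : TM2.Stmt Γ Unit σ) : Frag Γ σ where
  Λ := Unit
  main := ()
  m _ := q

theorem runs_block {q : TM2.Stmt Γ Unit σ} {s s' : σ × (∀ k, List (Γ k))}
    (h : TM2.stepAux q s.1 s.2 = ⟨none, s'.1, s'.2⟩) : (block q).Runs 1 s s' :=
  ReachIn.single (congrArg some h)

/-- `F`, then `G`. -/
def seq (F G : Frag Γ σ) : Frag Γ σ where
  Λ := F.Λ ⊕ G.Λ
  main := .inl F.main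
  m := Sum.elim (fun l => relabel .inl (some (.inr G.main)) (F.m l))
    (fun l => relabel .inr none (G.m l))

/-- The final configuration of the relabelled `F` is the initial configuration of the relabelled
`G`, because `halt` in `F` has become a jump to `G.main`. No extra step is spent. -/
theorem Runs.seq {F G : Frag Γ σ} {m n : ℕ} {s s' s'' : σ × (∀ k, List (Γ k))}
    (hF : F.Runs m s s') (hG : G.Runs n s' s'') : (F.seq G).Runs (m + n) s s'' :=
  ReachIn.trans (reachIn_relabel (m' := (F.seq G).m) (fun _ => rfl) hF)
    (reachIn_relabel (m' := (F.seq G).m) (fun _ => rfl) hG)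

/-- A conditional. -/
def ite (p : σ → Bool) (F G : Frag Γ σ) : Frag Γ σ where
  Λ := Option (F.Λ ⊕ G.Λ)
  main := none
  m l := l.elim
    (.branch p (.goto fun _ => some (.inl F.main)) (.goto fun _ => some (.inr G.main)))
    (Sum.elim (fun l => relabel (fun l => some (.inl l)) none (F.m l))
      (fun l => relabel (fun l => some (.inr l)) none (G.m l)))

theorem Runs.ite_true {p : σ → Bool} {F : Frag Γ σ} (G : Frag Γ σ) {n : ℕ}
    {s s' : σ × (∀ k, List (Γ k))} (hp : p s.1 = true) (hF : F.Runs n s s') :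
    (ite p F G).Runs (n + 1) s s' := by
  refine .head ?_ (reachIn_relabel (m' := (ite p F G).m) (g := fun l => some (.inl l)) (h := none)
    (fun _ => rfl) hF)
  simp [ite, TM2.step, TM2.stepAux, hp, relabelCfg]

theorem Runs.ite_false {p : σ → Bool} (F : Frag Γ σ) {G : Frag Γ σ} {n : ℕ}
    {s s' : σ × (∀ k, List (Γ k))} (hp : p s.1 = false) (hG : G.Runs n s s') :
    (ite p F G).Runs (n + 1) s s' := by
  refine .head ?_ (reachIn_relabel (m' := (ite p F G).m) (g := fun l => some (.inr l)) (h := none)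
    (fun _ => rfl) hG)
  simp [ite, TM2.step, TM2.stepAux, hp, relabelCfg]

/-- A loop. -/
def loop (p : σ → Bool) (F : Frag Γ σ) : Frag Γ σ where
  Λ := Option F.Λ
  main := none
  m l := l.elim (.branch p (.goto fun _ => some F.main) .halt)
    (fun l => relabel some (some none) (F.m l))

theorem runs_loop_false {p : σ → Bool} (F : Frag Γ σ) {s : σ × (∀ k, List (Γ k))}
    (hp : p s.1 = false) : (F.loop p).Runs 1 s s := by
  refine .single ?_
  simp [Frag.loop, TM2.step, TM2.stepAux, hp]

theorem Runs.loop_true {p : σ → Bool} {F : Frag Γ σ} {m n : ℕ}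
    {s s' s'' : σ × (∀ k, List (Γ k))} (hp : p s.1 = true) (hF : F.Runs m s s')
    (h : (F.loop p).Runs n s' s'') : (F.loop p).Runs (m + n + 1) s s'' := by
  refine .head ?_ (ReachIn.trans (reachIn_relabel (m' := (F.loop p).m) (g := some)
    (h := some none) (fun _ => rfl) hF) h)
  simp [Frag.loop, TM2.step, TM2.stepAux, hp, relabelCfg]

end

/-! ### Subroutines -/

section

variable {K K' : Type} {Γ : K' → Type} {σ σ' : Type}

/-- Let a program act on the stacks selected by `e` and on the part of the internal state that is
selected by `get` and `set`. -/
def liftStmt {Λ : Type} (e : K → K') (get : σ' → σ) (set : σ' → σ → σ') :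
    TM2.Stmt (fun k => Γ (e k)) Λ σ → TM2.Stmt Γ Λ σ'
  | .push k f q => .push (e k) (fun v => f (get v)) (liftStmt e get set q)
  | .peek k f q => .peek (e k) (fun v x => set v (f (get v) x)) (liftStmt e get set q)
  | .pop k f q => .pop (e k) (fun v x => set v (f (get v) x)) (liftStmt e get set q)
  | .load a q => .load (fun v => set v (a (get v))) (liftStmt e get set q)
  | .branch p q₁ q₂ =>
    .branch (fun v => p (get v)) (liftStmt e get set q₁) (liftStmt e get set q₂)
  | .goto f => .goto fun v => f (get v)
  | .halt => .halt

/-- A program as a subroutine of a larger machine. -/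
def lift (e : K → K') (get : σ' → σ) (set : σ' → σ → σ') (F : Frag (fun k => Γ (e k)) σ) :
    Frag Γ σ' where
  Λ := F.Λ
  main := F.main
  m l := liftStmt e get set (F.m l)

/-- The maps `v` and `S` complete the state and the stacks of the subroutine by a fixed content of
everything it does not touch. Since reading and updating commute with this completion, the host
mirrors each step of the subroutine by exactly one step. -/
theorem Runs.lift [DecidableEq K] [DecidableEq K'] {e : K → K'} {get : σ' → σ}
    {set : σ' → σ → σ'} {F : Frag (fun k => Γ (e k)) σ} (v : σ → σ')
    (S : (∀ k, List (Γ (e k))) → ∀ k, List (Γ k))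
    (hget : ∀ x, get (v x) = x) (hset : ∀ x y, set (v x) y = v y)
    (hS : ∀ T k, S T (e k) = T k) (hupd : ∀ T k l, S (update T k l) = update (S T) (e k) l)
    {n : ℕ} {s s' : σ × (∀ k, List (Γ (e k)))} (h : F.Runs n s s') :
    (F.lift e get set).Runs n (v s.1, S s.2) (v s'.1, S s'.2) := by
  have aux : ∀ (q : TM2.Stmt (fun k => Γ (e k)) F.Λ σ) x T,
      TM2.stepAux (liftStmt e get set q) (v x) (S T) =
        ⟨(TM2.stepAux q x T).l, v (TM2.stepAux q x T).var, S (TM2.stepAux q x T).stk⟩ := by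
    intro q
    induction q with
    | push k f q ih | peek k f q ih | pop k f q ih | load a q ih =>
      intro x T
      simp only [liftStmt, TM2.stepAux, hget, hset, hS, ← hupd]
      exact ih _ _
    | branch p q₁ q₂ ih₁ ih₂ =>
      intro x T
      simp only [liftStmt, TM2.stepAux, hget]
      cases p x
      · exact ih₂ _ _
      · exact ih₁ _ _
    | goto f => intro x T; simp only [liftStmt, TM2.stepAux, hget]
    | halt => intro x T; rfl
  refine ReachIn.map (f := TM2.step F.m) (g := TM2.step (F.lift e get set).m)
    (fun c => ⟨c.l, v c.var, S c.stk⟩) ?_ h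
  rintro ⟨_ | l, x, T⟩ b hb
  · cases hb
  · simp only [TM2.step, Option.some.injEq] at hb
    subst hb
    exact congrArg some (aux _ _ _)

end

/-! ### Moving stacks -/

section

variable {K : Type} [DecidableEq K] {Γ : K → Type} {σ : Type}

/-- Pop `k` until it is empty, keeping the popped symbol in the internal state and executing
`body` after each pop. -/
def popLoop (k : K) (put : σ → Option (Γ k) → σ) (test : σ → Bool)
    (body : TM2.Stmt Γ Unit σ → TM2.Stmt Γ Unit σ) : Frag Γ σ :=
  block (.pop k put (.branch test (body (.goto fun _ => ())) .halt))

/-- `T acc w` describes all stacks when the symbols in `acc` have been processed, latest first, and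
`w` is still on stack `k`. The hypothesis `hput` says that a new symbol overwrites the register, so
the value left by the previous round is irrelevant. -/
theorem runs_popLoop {k : K} {put : σ → Option (Γ k) → σ} {test : σ → Bool}
    {body : TM2.Stmt Γ Unit σ → TM2.Stmt Γ Unit σ} {v : σ}
    (w : List (Γ k)) (T : List (Γ k) → List (Γ k) → ∀ k, List (Γ k))
    (hnone : test v = false) (hv : put v none = v)
    (hsome : ∀ a, test (put v (some a)) = true) (hput : ∀ a o, put (put v (some a)) o = put v o)
    (hT : ∀ acc w, T acc w k = w)
    (hbody : ∀ acc a w, TM2.stepAux (body (.goto fun _ => ())) (put v (some a))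
      (update (T acc (a :: w)) k w) = ⟨some (), put v (some a), T (a :: acc) w⟩) :
    (popLoop k put test body).Runs (w.length + 1) (v, T [] w) (v, T w.reverse []) := by
  -- The induction must allow any state `u` that differs from `v` only in what the next pop
  -- overwrites.
  have key : ∀ (w acc : List (Γ k)) (u : σ), (∀ o, put u o = put v o) →
      (popLoop k put test body).Runs (w.length + 1) (u, T acc w) (v, T (w.reverse ++ acc) []) := by
    intro w
    induction w with
    | nil =>
      intro acc u hu
      refine .single ?_
      have : update (T acc []) k [] = T acc [] := by
        conv_rhs => rw [← update_eq_self k (T acc [])]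
        rw [hT]
      simp [popLoop, block, hT, hu, hnone, hv, this]
    | cons a w ih =>
      intro acc u hu
      rw [List.reverse_cons, List.append_assoc, List.singleton_append]
      refine .head ?_ (ih (a :: acc) (put v (some a)) (hput a))
      simp only [popLoop, block, TM2.step, TM2.stepAux, hT, hu, List.head?_cons, hsome,
        List.tail_cons, cond_true, hbody]
  simpa using key w [] v fun _ => rfl

variable {Δ ρ : Type}

/-- Move the contents of stack `k` to stack `k'`, through the register of type `Option Δ`. -/
def move [Inhabited Δ] {Γ : K → Type} (k k' : K) (φ : Γ k → Δ) (ψ : Δ → Γ k') :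
    Frag Γ (Option Δ × ρ) :=
  popLoop k (fun v o => (o.map φ, v.2)) (fun v => v.1.isSome)
    (.push k' fun v => ψ (v.1.getD default))

theorem runs_move [Inhabited Δ] {k k' : K} (hk : k ≠ k') (φ : Γ k → Δ) (ψ : Δ → Γ k') (x : ρ)
    (S : ∀ k, List (Γ k)) :
    (move k k' φ ψ).Runs ((S k).length + 1) ((none, x), S)
      ((none, x), update (update S k []) k' (((S k).map fun a => ψ (φ a)).reverse ++ S k')) := by
  have := runs_popLoop (put := fun (v : Option Δ × ρ) o => (o.map φ, v.2))
    (test := fun v => v.1.isSome) (body := .push k' fun v => ψ (v.1.getD default))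
    (v := (none, x)) (S k)
    (fun acc w => update (update S k w) k' ((acc.map fun a => ψ (φ a)) ++ S k'))
    rfl rfl (fun _ => rfl) (fun _ _ => rfl)
    (fun acc w => by rw [update_of_ne hk, update_self]) (fun acc a w => by
      simp only [TM2.stepAux, Option.map_some, Option.getD_some, List.map_cons, List.cons_append]
      rw [update_comm hk.symm, update_idem, update_self, update_idem])
  simpa [move] using this

/-- Move the contents of stack `k` to the stacks `k'` and `k''`. -/
def moveTwo [Inhabited Δ] {Γ : K → Type} (k k' k'' : K) (φ : Γ k → Δ) (ψ : Δ → Γ k')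
    (χ : Δ → Γ k'') : Frag Γ (Option Δ × ρ) :=
  popLoop k (fun v o => (o.map φ, v.2)) (fun v => v.1.isSome)
    fun q => .push k' (fun v => ψ (v.1.getD default)) (.push k'' (fun v => χ (v.1.getD default)) q)

theorem runs_moveTwo [Inhabited Δ] {k k' k'' : K} (hk : k ≠ k') (hk' : k ≠ k'') (hkk : k' ≠ k'')
    (φ : Γ k → Δ) (ψ : Δ → Γ k') (χ : Δ → Γ k'') (x : ρ) (S : ∀ k, List (Γ k)) :
    (moveTwo k k' k'' φ ψ χ).Runs ((S k).length + 1) ((none, x), S)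
      ((none, x), update (update (update S k []) k' (((S k).map fun a => ψ (φ a)).reverse ++ S k'))
        k'' (((S k).map fun a => χ (φ a)).reverse ++ S k'')) := by
  have := runs_popLoop (put := fun (v : Option Δ × ρ) o => (o.map φ, v.2))
    (test := fun v => v.1.isSome) (body := fun q => .push k' (fun v => ψ (v.1.getD default))
      (.push k'' (fun v => χ (v.1.getD default)) q))
    (v := (none, x)) (S k)
    (fun acc w => update (update (update S k w) k' ((acc.map fun a => ψ (φ a)) ++ S k'))
      k'' ((acc.map fun a => χ (φ a)) ++ S k''))
    rfl rfl (fun _ => rfl) (fun _ _ => rfl)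
    (fun acc w => by rw [update_of_ne hk', update_of_ne hk, update_self]) (fun acc a w => by
      simp only [TM2.stepAux, Option.map_some, Option.getD_some, List.map_cons, List.cons_append]
      rw [update_comm hk'.symm, update_comm hk.symm, update_idem, update_of_ne hkk,
        update_self, update_comm hkk.symm, update_idem, update_self, update_idem])
  simpa [moveTwo] using this

/-- Empty the stack `k`. -/
def drain (k : K) {Γ : K → Type} (φ : Γ k → Δ) : Frag Γ (Option Δ × ρ) :=
  popLoop k (fun v o => (o.map φ, v.2)) (fun v => v.1.isSome) id

theorem runs_drain {k : K} (φ : Γ k → Δ) (x : ρ) (S : ∀ k, List (Γ k)) :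
    (drain k φ).Runs ((S k).length + 1) ((none, x), S) ((none, x), update S k []) := by
  have := runs_popLoop (put := fun (v : Option Δ × ρ) o => (o.map φ, v.2))
    (test := fun v => v.1.isSome) (body := id) (v := (none, x)) (S k)
    (fun _ w => update S k w) rfl rfl (fun _ => rfl) (fun _ _ => rfl)
    (fun acc w => by rw [update_self]) (fun acc a w => by simp [TM2.stepAux])
  simpa [drain] using this

end

end Frag

/-! ### Polynomial-time computable functions -/

theorem Polynomial.eval_le_eval_nat (p : Polynomial ℕ) {m n : ℕ} (h : m ≤ n) :
    p.eval m ≤ p.eval n := by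
  rw [Polynomial.eval_eq_sum_range, Polynomial.eval_eq_sum_range]
  gcongr

/-- The program of a bundled machine. -/
def Turing.FinTM2.frag (M : FinTM2) : Frag M.Γ M.σ :=
  letI := M.ΛFin
  ⟨M.Λ, M.main, M.m⟩

/-- `f` is computable in polynomial time for the encodings `ea` and `eb`. -/
def PolyTime {α β Γ Γ' : Type} (ea : α → List Γ) (eb : β → List Γ') (f : α → β) : Prop :=
  Nonempty (TM2ComputableInPolyTime ea eb f)

theorem Turing.initList_eq (M : FinTM2) (s : List (M.Γ M.k₀)) :
    initList M s = ⟨some M.main, M.initialState, update (fun _ => []) M.k₀ s⟩ := by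
  unfold initList
  congr 1
  funext k
  by_cases h : k = M.k₀
  · subst h; simp
  · simp [h]

theorem Turing.haltList_eq (M : FinTM2) (s : List (M.Γ M.k₁)) :
    haltList M s = ⟨none, M.initialState, update (fun _ => []) M.k₁ s⟩ := by
  unfold haltList
  congr 1
  funext k
  by_cases h : k = M.k₁
  · subst h; simp
  · simp [h]

/-- The number of symbols that a statement can push. -/
def Turing.TM2.Stmt.pushes {K : Type} {Γ : K → Type} {Λ σ : Type} : TM2.Stmt Γ Λ σ → ℕ
  | .push _ _ q => pushes q + 1
  | .peek _ _ q => pushes q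
  | .pop _ _ q => pushes q
  | .load _ q => pushes q
  | .branch _ q₁ q₂ => max (pushes q₁) (pushes q₂)
  | .goto _ => 0
  | .halt => 0

theorem Turing.TM2.length_stepAux_le {K : Type} [DecidableEq K] {Γ : K → Type} {Λ σ : Type}
    (q : TM2.Stmt Γ Λ σ) (v : σ) (S : ∀ k, List (Γ k)) (L : ℕ) (hS : ∀ k, (S k).length ≤ L)
    (k : K) : ((TM2.stepAux q v S).stk k).length ≤ L + q.pushes := by
  induction q generalizing v S L with
  | push j f q ih =>
    simp only [TM2.stepAux, Stmt.pushes]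
    rw [Nat.add_comm q.pushes, ← Nat.add_assoc]
    refine ih _ _ (L + 1) fun i => ?_
    by_cases h : i = j
    · subst h; simpa using hS _
    · simpa [h] using Nat.le_succ_of_le (hS _)
  | peek j f q ih => exact ih _ _ _ hS
  | pop j f q ih =>
    refine ih _ _ _ fun i => ?_
    by_cases h : i = j
    · subst h; simpa using Nat.le_succ_of_le (hS _)
    · simpa [h] using hS _
  | load a q ih => exact ih _ _ _ hS
  | branch p q₁ q₂ ih₁ ih₂ =>
    simp only [TM2.stepAux, Stmt.pushes]
    cases p v
    · exact (ih₂ _ _ _ hS).trans (by simp)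
    · exact (ih₁ _ _ _ hS).trans (by simp)
  | goto f => exact Nat.le_add_right_of_le (hS k)
  | halt => exact Nat.le_add_right_of_le (hS k)

/-- Each step executes one statement and pushes at most `c` symbols, so a time bound is also a bound
on the output length. Composition needs this, as the second machine is timed by the length of its
own input. -/
theorem ReachIn.length_le {K : Type} [DecidableEq K] {Γ : K → Type} {Λ σ : Type}
    {m : Λ → TM2.Stmt Γ Λ σ} {c : ℕ} (hc : ∀ l, (m l).pushes ≤ c) {n : ℕ} {a b : TM2.Cfg Γ Λ σ}
    (h : ReachIn (TM2.step m) n a b) (L : ℕ) (hL : ∀ k, (a.stk k).length ≤ L) (k : K) :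
    (b.stk k).length ≤ L + n * c := by
  induction h generalizing L with
  | refl n a => exact (hL k).trans (Nat.le_add_right _ _)
  | @head n a b d h _ ih =>
    obtain ⟨_ | l, v, S⟩ := a
    · cases h
    · simp only [TM2.step, Option.some.injEq] at h
      subst h
      have := ih (L + c) fun k =>
        (TM2.length_stepAux_le _ _ _ L hL k).trans (Nat.add_le_add_left (hc l) L)
      rw [Nat.succ_mul]
      omega

namespace PolyTime

variable {α β γ Γ Γ' Γ'' : Type} {ea : α → List Γ} {eb : β → List Γ'} {ec : γ → List Γ''}

/-- A machine for `f`, with a polynomial that bounds both the running time and the length of the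
output. -/
theorem exists_machine {f : α → β} (h : PolyTime ea eb f) :
    ∃ (M : FinTM2) (i : M.Γ M.k₀ ≃ Γ) (o : M.Γ M.k₁ ≃ Γ') (p : Polynomial ℕ), ∀ a,
      M.frag.Runs (p.eval (ea a).length)
        (M.initialState, update (fun _ => []) M.k₀ ((ea a).map i.symm))
        (M.initialState, update (fun _ => []) M.k₁ ((eb (f a)).map o.symm)) ∧
      (eb (f a)).length ≤ p.eval (ea a).length := by
  obtain ⟨⟨⟨M, i, o⟩, p, H⟩⟩ := h
  let _ := M.ΛFin
  let c := Finset.univ.sup fun l => (M.m l).pushes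
  -- With `L` the input length, this evaluates to `L + p * c + p`, which dominates both the running
  -- time `p` and the output length `L + p * c`.
  refine ⟨M, i, o, Polynomial.X + p * Polynomial.C (c + 1), fun a => ?_⟩
  have hr : ReachIn (TM2.step M.m) (p.eval (ea a).length)
      ⟨some M.main, M.initialState, update (fun _ => []) M.k₀ ((ea a).map i.symm)⟩
      ⟨none, M.initialState, update (fun _ => []) M.k₁ ((eb (f a)).map o.symm)⟩ := by
    rw [← initList_eq, ← haltList_eq]
    exact ReachIn.iff_evalsToInTime.2 ⟨H a⟩
  have hp : p.eval (ea a).length * (c + 1) = p.eval (ea a).length * c + p.eval (ea a).length :=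
    Nat.mul_succ _ _
  constructor
  · refine hr.mono ?_
    simp only [Polynomial.eval_add, Polynomial.eval_X, Polynomial.eval_mul, Polynomial.eval_C]
    omega
  · have := hr.length_le (c := c) (fun l => Finset.le_sup (f := fun l => (M.m l).pushes)
      (Finset.mem_univ l)) (ea a).length (fun k => by
        by_cases h : k = M.k₀
        · subst h; simp
        · simp [h]) M.k₁
    simp only [update_self, List.length_map] at this
    simp only [Polynomial.eval_add, Polynomial.eval_X, Polynomial.eval_mul, Polynomial.eval_C]
    omega

theorem of_frag {K : Type} [DecidableEq K] [Fintype K] {G : K → Type} {σ : Type} [Fintype σ]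
    (F : Frag G σ) (v : σ) (k₀ k₁ : K) [Fintype (G k₀)] (i : G k₀ ≃ Γ) (o : G k₁ ≃ Γ')
    (p : Polynomial ℕ) {f : α → β}
    (H : ∀ a, F.Runs (p.eval (ea a).length) (v, update (fun _ => []) k₀ ((ea a).map i.symm))
      (v, update (fun _ => []) k₁ ((eb (f a)).map o.symm))) : PolyTime ea eb f := by
  let M : FinTM2 :=
    { K := K, k₀ := k₀, k₁ := k₁, Γ := G, Λ := F.Λ, main := F.main, σ := σ, initialState := v
      m := F.m }
  refine ⟨⟨⟨M, i, o⟩, p, fun a => Classical.choice (ReachIn.iff_evalsToInTime.1 ?_)⟩⟩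
  rw [initList_eq, haltList_eq]
  exact H a

theorem exists_length_le {f : α → β} (h : PolyTime ea eb f) :
    ∃ p : Polynomial ℕ, ∀ a, (eb (f a)).length ≤ p.eval (ea a).length := by
  obtain ⟨_, _, _, p, H⟩ := h.exists_machine
  exact ⟨p, fun a => (H a).2⟩

end PolyTime

/-! ### Machines with two subroutines -/

/-- The stacks of a machine with two subroutines `M`, `N` and two work stacks. -/
abbrev TwoSub (Δ : Type) (M N : FinTM2) : Bool ⊕ (M.K ⊕ N.K) → Type :=
  Sum.elim (fun _ => Δ) (Sum.elim M.Γ N.Γ)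

namespace TwoSub

variable {Δ : Type} {M N : FinTM2}

/-- Put together the contents of the work stacks and those of the subroutines. -/
def stk (a b : List Δ) (T : ∀ k, List (M.Γ k)) (U : ∀ k, List (N.Γ k)) :
    ∀ k, List (TwoSub Δ M N k)
  | .inl false => a
  | .inl true => b
  | .inr (.inl k) => T k
  | .inr (.inr k) => U k

variable (a b l : List Δ) (T : ∀ k, List (M.Γ k)) (U : ∀ k, List (N.Γ k))

@[simp] theorem stk_a : stk a b T U (.inl false) = a := rfl
@[simp] theorem stk_b : stk a b T U (.inl true) = b := rfl
@[simp] theorem stk_M (k : M.K) : stk a b T U (.inr (.inl k)) = T k := rfl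
@[simp] theorem stk_N (k : N.K) : stk a b T U (.inr (.inr k)) = U k := rfl

@[simp] theorem update_a : update (stk a b T U) (.inl false) l = stk l b T U :=
  update_eq_iff.2 ⟨rfl, by rintro ((_ | _) | _ | _) h <;> first | rfl | exact absurd rfl h⟩

@[simp] theorem update_b : update (stk a b T U) (.inl true) l = stk a l T U :=
  update_eq_iff.2 ⟨rfl, by rintro ((_ | _) | _ | _) h <;> first | rfl | exact absurd rfl h⟩

@[simp] theorem update_M (k : M.K) (l : List (M.Γ k)) :
    update (stk a b T U) (.inr (.inl k)) l = stk a b (update T k l) U :=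
  update_eq_iff.2 ⟨(update_self k l T).symm, by
    rintro ((_ | _) | j | _) h
    all_goals first
      | rfl
      | exact (update_of_ne (fun e : j = k => h (congrArg (fun j => Sum.inr (Sum.inl j)) e)) l T).symm⟩

@[simp] theorem update_N (k : N.K) (l : List (N.Γ k)) :
    update (stk a b T U) (.inr (.inr k)) l = stk a b T (update U k l) :=
  update_eq_iff.2 ⟨(update_self k l U).symm, by
    rintro ((_ | _) | _ | j) h
    all_goals first
      | rfl
      | exact (update_of_ne (fun e : j = k => h (congrArg (fun j => Sum.inr (Sum.inr j)) e)) l U).symm⟩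

theorem empty_eq : (fun _ => []) = stk (Δ := Δ) (M := M) (N := N) [] [] (fun _ => []) fun _ => [] := by
  funext k; obtain (_ | _) | _ | _ := k <;> rfl

variable (Δ M N) in
/-- The internal state. -/
abbrev State : Type := Option Δ × M.σ × N.σ

variable (Δ M N) in
/-- The initial internal state. -/
def init : State Δ M N := (none, M.initialState, N.initialState)

variable (Δ M N) in
/-- Run the first subroutine. -/
def callM : Frag (TwoSub Δ M N) (State Δ M N) :=
  Frag.lift (K := M.K) (fun k => .inr (.inl k)) (fun s => s.2.1) (fun s x => (s.1, x, s.2.2)) M.frag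

variable (Δ M N) in
/-- Run the second subroutine. -/
def callN : Frag (TwoSub Δ M N) (State Δ M N) :=
  Frag.lift (K := N.K) (fun k => .inr (.inr k)) (fun s => s.2.2) (fun s x => (s.1, s.2.1, x)) N.frag

variable {a b T U}

theorem runs_callM {n : ℕ} {T' : ∀ k, List (M.Γ k)}
    (h : M.frag.Runs n (M.initialState, T) (M.initialState, T')) :
    (callM Δ M N).Runs n (init Δ M N, stk a b T U) (init Δ M N, stk a b T' U) :=
  Frag.Runs.lift (K := M.K) (Γ := TwoSub Δ M N) (e := fun k => .inr (.inl k)) (F := M.frag)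
    (get := fun s : State Δ M N => s.2.1) (set := fun s x => (s.1, x, s.2.2))
    (fun x => (none, x, N.initialState)) (fun T => stk a b T U) (fun _ => rfl) (fun _ _ => rfl)
    (fun _ _ => rfl) (fun T k l => (update_M a b T U k l).symm) h

theorem runs_callN {n : ℕ} {U' : ∀ k, List (N.Γ k)}
    (h : N.frag.Runs n (N.initialState, U) (N.initialState, U')) :
    (callN Δ M N).Runs n (init Δ M N, stk a b T U) (init Δ M N, stk a b T U') :=
  Frag.Runs.lift (K := N.K) (Γ := TwoSub Δ M N) (e := fun k => .inr (.inr k)) (F := N.frag)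
    (get := fun s : State Δ M N => s.2.2) (set := fun s x => (s.1, s.2.1, x))
    (fun x => (none, M.initialState, x)) (fun U => stk a b T U) (fun _ => rfl) (fun _ _ => rfl)
    (fun _ _ => rfl) (fun U k l => (update_N a b T U k l).symm) h

end TwoSub

namespace TwoSub

variable {Δ : Type} [Inhabited Δ] {M N : FinTM2} {a b : List Δ} {T : ∀ k, List (M.Γ k)}
  {U : ∀ k, List (N.Γ k)}

variable (Δ M N) in
/-- Move the first work stack to the second one. -/
def moveAB : Frag (TwoSub Δ M N) (State Δ M N) :=
  .move (.inl false) (.inl true) (fun x : Δ => x) (fun x : Δ => x)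

theorem runs_moveAB : (moveAB Δ M N).Runs (a.length + 1) (init Δ M N, stk a b T U)
    (init Δ M N, stk [] (a.reverse ++ b) T U) := by
  have := Frag.runs_move (k := .inl false) (k' := .inl true) (by simp) (fun x : Δ => x)
    (fun x : Δ => x) (M.initialState, N.initialState) (stk a b T U)
  refine (congrArg (Frag.Runs _ _ _) (congrArg (Prod.mk _) ?_)).mp this
  exact ((congrArg (fun S => update S _ _) (update_a a b [] T U)).trans (update_b _ _ _ _ _)).trans
    (congrArg (fun l => stk [] (l.reverse ++ b) T U) (List.map_id' a))

variable (Δ M N) in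
/-- Move the second work stack to the first one. -/
def moveBA : Frag (TwoSub Δ M N) (State Δ M N) :=
  .move (.inl true) (.inl false) (fun x : Δ => x) (fun x : Δ => x)

theorem runs_moveBA : (moveBA Δ M N).Runs (b.length + 1) (init Δ M N, stk a b T U)
    (init Δ M N, stk (b.reverse ++ a) [] T U) := by
  have := Frag.runs_move (k := .inl true) (k' := .inl false) (by simp) (fun x : Δ => x)
    (fun x : Δ => x) (M.initialState, N.initialState) (stk a b T U)
  refine (congrArg (Frag.Runs _ _ _) (congrArg (Prod.mk _) ?_)).mp this
  exact ((congrArg (fun S => update S _ _) (update_b a b [] T U)).trans (update_a _ _ _ _ _)).trans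
    (congrArg (fun l => stk (l.reverse ++ a) [] T U) (List.map_id' b))

variable (N) in
/-- Move a stack of the first subroutine to the second work stack. -/
def moveMB (k : M.K) (φ : M.Γ k → Δ) : Frag (TwoSub Δ M N) (State Δ M N) :=
  .move (.inr (.inl k)) (.inl true) φ (fun x : Δ => x)

theorem runs_moveMB (k : M.K) (φ : M.Γ k → Δ) :
    (moveMB N k φ).Runs ((T k).length + 1) (init Δ M N, stk a b T U)
      (init Δ M N, stk a (((T k).map φ).reverse ++ b) (update T k []) U) := by
  have := Frag.runs_move (k := .inr (.inl k)) (k' := .inl true) (by simp) φ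
    (fun x : Δ => x) (M.initialState, N.initialState) (stk a b T U)
  refine (congrArg (Frag.Runs _ _ _) (congrArg (Prod.mk _) ?_)).mp this
  exact (congrArg (fun S => update S _ _) (update_M a b T U k [])).trans (update_b _ _ _ _ _)

variable (N) in
/-- Move the second work stack to a stack of the first subroutine. -/
def moveBM (k : M.K) (ψ : Δ → M.Γ k) : Frag (TwoSub Δ M N) (State Δ M N) :=
  .move (.inl true) (.inr (.inl k)) (fun x : Δ => x) ψ

theorem runs_moveBM (k : M.K) (ψ : Δ → M.Γ k) :
    (moveBM N k ψ).Runs (b.length + 1) (init Δ M N, stk a b T U)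
      (init Δ M N, stk a [] (update T k ((b.map ψ).reverse ++ T k)) U) := by
  have := Frag.runs_move (k := .inl true) (k' := .inr (.inl k)) (by simp) (fun x : Δ => x)
    ψ (M.initialState, N.initialState) (stk a b T U)
  refine (congrArg (Frag.Runs _ _ _) (congrArg (Prod.mk _) ?_)).mp this
  exact (congrArg (fun S => update S _ _) (update_b a b [] T U)).trans (update_M _ _ _ _ _ _)

variable (M) in
/-- Move a stack of the second subroutine to the second work stack. -/
def moveNB (k : N.K) (φ : N.Γ k → Δ) : Frag (TwoSub Δ M N) (State Δ M N) :=
  .move (.inr (.inr k)) (.inl true) φ (fun x : Δ => x)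

theorem runs_moveNB (k : N.K) (φ : N.Γ k → Δ) :
    (moveNB M k φ).Runs ((U k).length + 1) (init Δ M N, stk a b T U)
      (init Δ M N, stk a (((U k).map φ).reverse ++ b) T (update U k [])) := by
  have := Frag.runs_move (k := .inr (.inr k)) (k' := .inl true) (by simp) φ
    (fun x : Δ => x) (M.initialState, N.initialState) (stk a b T U)
  refine (congrArg (Frag.Runs _ _ _) (congrArg (Prod.mk _) ?_)).mp this
  exact (congrArg (fun S => update S _ _) (update_N a b T U k [])).trans (update_b _ _ _ _ _)

variable (M) in
/-- Move the second work stack to a stack of the second subroutine. -/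
def moveBN (k : N.K) (ψ : Δ → N.Γ k) : Frag (TwoSub Δ M N) (State Δ M N) :=
  .move (.inl true) (.inr (.inr k)) (fun x : Δ => x) ψ

theorem runs_moveBN (k : N.K) (ψ : Δ → N.Γ k) :
    (moveBN M k ψ).Runs (b.length + 1) (init Δ M N, stk a b T U)
      (init Δ M N, stk a [] T (update U k ((b.map ψ).reverse ++ U k))) := by
  have := Frag.runs_move (k := .inl true) (k' := .inr (.inr k)) (by simp) (fun x : Δ => x)
    ψ (M.initialState, N.initialState) (stk a b T U)
  refine (congrArg (Frag.Runs _ _ _) (congrArg (Prod.mk _) ?_)).mp this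
  exact (congrArg (fun S => update S _ _) (update_b a b [] T U)).trans (update_N _ _ _ _ _ _)

variable (N) in
/-- Move the second work stack to a stack of the first subroutine, keeping a copy on the first
work stack. -/
def copyBMA (k : M.K) (ψ : Δ → M.Γ k) : Frag (TwoSub Δ M N) (State Δ M N) :=
  .moveTwo (.inl true) (.inr (.inl k)) (.inl false) (fun x : Δ => x) ψ (fun x : Δ => x)

theorem runs_copyBMA (k : M.K) (ψ : Δ → M.Γ k) :
    (copyBMA N k ψ).Runs (b.length + 1) (init Δ M N, stk a b T U)
      (init Δ M N, stk (b.reverse ++ a) [] (update T k ((b.map ψ).reverse ++ T k)) U) := by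
  have := Frag.runs_moveTwo (k := .inl true) (k' := .inr (.inl k)) (k'' := .inl false) (by simp)
    (by simp) (by simp) (fun x : Δ => x) ψ (fun x : Δ => x) (M.initialState, N.initialState)
    (stk a b T U)
  refine (congrArg (Frag.Runs _ _ _) (congrArg (Prod.mk _) ?_)).mp this
  refine (congrArg (fun S => update (update S _ _) _ _) (update_b a b [] T U)).trans
    ((congrArg (fun S => update S _ _) (update_M _ _ _ _ _ _)).trans ?_)
  exact (update_a _ _ _ _ _).trans
    (congrArg (fun l => stk (l.reverse ++ a) [] _ U) (List.map_id' b))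

end TwoSub

/-! ### Composition of polynomial-time functions -/

namespace PolyTime

open TwoSub

variable {α β γ Γ Γ' Γ'' : Type} {ea : α → List Γ} {eb : β → List Γ'} {ec : γ → List Γ''}

/-- The output of `M` reaches the input stack of `N` by way of a work stack. Each move reverses the
word, so two moves restore its order. -/
theorem comp [Inhabited Γ'] {g : β → γ} {f : α → β} (hg : PolyTime eb ec g)
    (hf : PolyTime ea eb f) : PolyTime ea ec (fun a => g (f a)) := by
  obtain ⟨M, i, o, p, hM⟩ := hf.exists_machine
  obtain ⟨N, i', o', q, hN⟩ := hg.exists_machine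
  let _ := M.kFin; let _ := N.kFin; let _ := M.σFin; let _ := N.σFin
  let _ : Fintype Γ' := @Fintype.ofEquiv _ _ N.Γk₀Fin i'
  let F : Frag (TwoSub Γ' M N) (State Γ' M N) :=
    (callM Γ' M N).seq <| (moveMB N M.k₁ o).seq <| (moveBN M N.k₀ i'.symm).seq (callN Γ' M N)
  have key : ∀ a, F.Runs ((p + ((p + 1) + ((p + 1) + q.comp p))).eval (ea a).length)
      (init _ _ _, stk [] [] (update (fun _ => []) M.k₀ ((ea a).map i.symm)) fun _ => [])
      (init _ _ _,
        stk [] [] (fun _ => []) (update (fun _ => []) N.k₁ ((ec (g (f a))).map o'.symm))) := by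
    intro a
    obtain ⟨h1, h2⟩ := hM a
    obtain ⟨h3, -⟩ := hN (f a)
    refine Frag.Runs.mono ((runs_callM h1).seq <| (runs_moveMB _ _).seq <|
      (runs_moveBN _ _).seq (n := q.eval (eb (f a)).length) ?_) ?_
    · convert runs_callN (M := M) (Δ := Γ') (a := []) (b := []) (T := fun _ => []) h3 using 3
      · simp
      · simp [Function.comp_def]
    · have := q.eval_le_eval_nat h2
      simp only [Polynomial.eval_add, Polynomial.eval_one, Polynomial.eval_comp, update_self,
        List.length_map, List.length_reverse, List.append_nil]
      omega
  let _ : Fintype (TwoSub Γ' M N (.inr (.inl M.k₀))) := M.Γk₀Fin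
  refine of_frag F (init _ _ _) (.inr (.inl M.k₀)) (.inr (.inr N.k₁)) i o'
    (p + ((p + 1) + ((p + 1) + q.comp p))) fun a => ?_
  have := key a
  rw [← update_M, ← update_N, ← empty_eq] at this
  exact this

end PolyTime

/-! ### Data encoded by binary trees -/

/-- Binary trees, the universal data type of our programs. -/
inductive BinTree
  | leaf
  | node (s t : BinTree)

/-- Trees written in prefix notation. -/
def BinTree.word : BinTree → List Bool
  | .leaf => [false]
  | .node s t => true :: (s.word ++ t.word)

/-- Types whose elements are encoded by trees. -/
class TreeEnc (α : Type) where
  tree : α → BinTree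

/-- The word that encodes `a`. -/
def treeWord {α : Type} [TreeEnc α] (a : α) : List Bool := (TreeEnc.tree a).word

/-- The length of the code of `a`. -/
def treeSize {α : Type} [TreeEnc α] (a : α) : ℕ := (treeWord a).length

namespace TreeEnc

variable {α β : Type} [TreeEnc α] [TreeEnc β]

instance : TreeEnc Unit := ⟨fun _ => .leaf⟩

instance : TreeEnc Bool := ⟨fun b => cond b (.node .leaf .leaf) .leaf⟩

instance : TreeEnc (α × β) := ⟨fun x => .node (tree x.1) (tree x.2)⟩

instance : TreeEnc (α ⊕ β) :=
  ⟨Sum.elim (fun a => .node (tree false) (tree a)) (fun b => .node (tree true) (tree b))⟩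

/-- Lists are encoded as elements of `Unit ⊕ (α × List α)`. -/
def listTree : List α → BinTree
  | [] => .node (tree false) (tree ())
  | a :: l => .node (tree true) (.node (tree a) (listTree l))

instance : TreeEnc (List α) := ⟨listTree⟩

end TreeEnc

section

variable {α β : Type} [TreeEnc α] [TreeEnc β]

@[simp] theorem treeWord_unit : treeWord () = [false] := rfl
@[simp] theorem treeWord_false : treeWord false = [false] := rfl
@[simp] theorem treeWord_true : treeWord true = [true, false, false] := rfl
@[simp] theorem treeWord_prod (x : α × β) : treeWord x = true :: (treeWord x.1 ++ treeWord x.2) :=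
  rfl
@[simp] theorem treeWord_inl (a : α) :
    treeWord (Sum.inl a : α ⊕ β) = true :: false :: treeWord a := rfl
@[simp] theorem treeWord_inr (b : β) :
    treeWord (Sum.inr b : α ⊕ β) = true :: true :: false :: false :: treeWord b := rfl

@[simp] theorem treeWord_nil : treeWord ([] : List α) = [true, false, false] := rfl
@[simp] theorem treeWord_cons (a : α) (l : List α) :
    treeWord (a :: l) = true :: true :: false :: false :: true :: (treeWord a ++ treeWord l) := rfl

@[simp] theorem treeSize_unit : treeSize () = 1 := rfl
@[simp] theorem treeSize_false : treeSize false = 1 := rfl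
@[simp] theorem treeSize_true : treeSize true = 3 := rfl
@[simp] theorem treeSize_prod (x : α × β) : treeSize x = treeSize x.1 + treeSize x.2 + 1 := by
  simp [treeSize]
@[simp] theorem treeSize_inl (a : α) : treeSize (Sum.inl a : α ⊕ β) = treeSize a + 2 := by
  simp [treeSize]
@[simp] theorem treeSize_inr (b : β) : treeSize (Sum.inr b : α ⊕ β) = treeSize b + 4 := by
  simp [treeSize]
@[simp] theorem treeSize_nil : treeSize ([] : List α) = 3 := rfl
@[simp] theorem treeSize_cons (a : α) (l : List α) :
    treeSize (a :: l) = treeSize a + treeSize l + 5 := by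
  simp [treeSize]

theorem treeSize_pos (a : α) : 0 < treeSize a := by
  unfold treeSize treeWord
  cases TreeEnc.tree a <;> simp [BinTree.word]

end

/-- `f` is computable in polynomial time on the codes of its arguments. -/
def PT {α β : Type} [TreeEnc α] [TreeEnc β] (f : α → β) : Prop :=
  PolyTime (treeWord (α := α)) (treeWord (α := β)) f

/-! ### Fragments for tags, registers and subroutine calls -/

namespace TwoSub

theorem polyTime_of_frag {M N : FinTM2} {α β : Type} {ea : α → List Bool} {eb : β → List Bool}
    {f : α → β} (F : Frag (TwoSub Bool M N) (State Bool M N)) (p : Polynomial ℕ)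
    (H : ∀ a, F.Runs (p.eval (ea a).length)
      (init _ _ _, stk (ea a) [] (fun _ => []) fun _ => [])
      (init _ _ _, stk (eb (f a)) [] (fun _ => []) fun _ => [])) : PolyTime ea eb f := by
  let _ := M.kFin; let _ := N.kFin; let _ := M.σFin; let _ := N.σFin
  let _ : Fintype (TwoSub Bool M N (.inl false)) := inferInstanceAs (Fintype Bool)
  refine PolyTime.of_frag F (init _ _ _) (.inl false) (.inl false) (Equiv.refl Bool)
    (Equiv.refl Bool) p fun a => ?_
  have := H a
  rw [← update_a [] _ (ea a), ← update_a [] _ (eb (f a)), ← empty_eq] at this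
  convert this using 3
  · exact congrArg (update _ _) (List.map_id _)
  · exact congrArg (update _ _) (List.map_id _)

section

variable {M N : FinTM2} {a b : List Bool} {T : ∀ k, List (M.Γ k)} {U : ∀ k, List (N.Γ k)}

variable (M N) in
/-- Pop the code of a tag off the first work stack and remember it. -/
def popTag : Frag (TwoSub Bool M N) (State Bool M N) :=
  .block <| .pop (.inl false) (fun s _ => s) <| .pop (.inl false) (fun s x => (x, s.2)) <|
    .branch (fun s => s.1 = some true)
      (.pop (.inl false) (fun s _ => s) <| .pop (.inl false) (fun s _ => s) .halt) .halt

theorem runs_popTag_false {w : List Bool} (x : Option Bool) :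
    (popTag M N).Runs 1 ((x, (init Bool M N).2), stk (true :: false :: w) b T U)
      ((some false, (init Bool M N).2), stk w b T U) := by
  refine Frag.runs_block ?_
  simp [TM2.stepAux]

theorem runs_popTag_true {w : List Bool} (x : Option Bool) :
    (popTag M N).Runs 1
      ((x, (init Bool M N).2), stk (true :: true :: false :: false :: w) b T U)
      ((some true, (init Bool M N).2), stk w b T U) := by
  refine Frag.runs_block ?_
  simp [TM2.stepAux]

variable (M N) in
/-- Set the register. -/
def setReg (x : Option Bool) : Frag (TwoSub Bool M N) (State Bool M N) :=
  .block <| .load (fun s => (x, s.2)) .halt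

theorem runs_setReg (x y : Option Bool) {S : ∀ k, List (TwoSub Bool M N k)} :
    (setReg M N x).Runs 1 ((y, (init Bool M N).2), S) ((x, (init Bool M N).2), S) :=
  Frag.runs_block rfl

variable (M N) in
/-- Push `true` on the first work stack. -/
def pushTrue : Frag (TwoSub Bool M N) (State Bool M N) :=
  .block <| .push (.inl false) (fun _ => true) .halt

theorem runs_pushTrue :
    (pushTrue M N).Runs 1 (init _ _ _, stk a b T U) (init _ _ _, stk (true :: a) b T U) := by
  refine Frag.runs_block ?_
  simp [TM2.stepAux]

theorem runs_outM {Δ : Type} [Inhabited Δ] {a b : List Δ} (k : M.K) (o : M.Γ k ≃ Δ) (w : List Δ) :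
    (moveMB N k o).Runs (w.length + 1)
      (init _ _ _, stk a b (update (fun _ => []) k (w.map o.symm)) U)
      (init _ _ _, stk a (w.reverse ++ b) (fun _ => []) U) := by
  convert runs_moveMB (N := N) (a := a) (b := b) (U := U) (T := update (fun _ => []) k (w.map o.symm)) k o using 3 <;>
    simp [Function.comp_def]

theorem runs_inM {Δ : Type} [Inhabited Δ] {a : List Δ} (k : M.K) (i : M.Γ k ≃ Δ) (w : List Δ) :
    (moveBM N k i.symm).Runs (w.length + 1)
      (init _ _ _, stk a w.reverse (fun _ => []) U)
      (init _ _ _, stk a [] (update (fun _ => []) k (w.map i.symm)) U) := by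
  have h := runs_moveBM (N := N) (a := a) (b := w.reverse) (U := U) (T := (fun _ => [])) k i.symm
  simpa only [List.length_reverse, List.map_reverse, List.reverse_reverse, List.append_nil] using h

variable (N) in
/-- Apply the first subroutine to the first work stack. -/
def applyM (i : M.Γ M.k₀ ≃ Bool) (o : M.Γ M.k₁ ≃ Bool) : Frag (TwoSub Bool M N) (State Bool M N) :=
  (moveAB _ _ _).seq <| (moveBM _ M.k₀ i.symm).seq <| (callM _ _ _).seq <|
    (moveMB _ M.k₁ o).seq (moveBA _ _ _)

theorem runs_applyM (i : M.Γ M.k₀ ≃ Bool) (o : M.Γ M.k₁ ≃ Bool) {n L : ℕ} {w w' : List Bool}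
    (h : M.frag.Runs n (M.initialState, update (fun _ => []) M.k₀ (w.map i.symm))
      (M.initialState, update (fun _ => []) M.k₁ (w'.map o.symm)))
    (hw : w.length ≤ L) (hw' : w'.length ≤ n) :
    (applyM N i o).Runs (2 * L + 3 * n + 4) (init _ _ _, stk w [] (fun _ => []) U)
      (init _ _ _, stk w' [] (fun _ => []) U) := by
  have h1 := runs_moveAB (Δ := Bool) (M := M) (N := N) (a := w) (b := []) (T := fun _ => []) (U := U)
  have h2 := runs_moveBA (Δ := Bool) (M := M) (N := N) (a := []) (b := w'.reverse ++ []) (T := fun _ => []) (U := U)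
  simp only [List.append_nil, List.reverse_reverse] at h1 h2
  have h3 := runs_outM (U := U) (a := []) (b := []) M.k₁ o w'
  rw [List.append_nil] at h3
  refine Frag.Runs.mono (h1.seq <| (runs_inM M.k₀ i w).seq <| (runs_callM h).seq <| h3.seq h2) ?_
  rw [List.length_reverse]
  omega

theorem runs_outN {Δ : Type} [Inhabited Δ] {a b : List Δ} (k : N.K) (o : N.Γ k ≃ Δ) (w : List Δ) :
    (moveNB M k o).Runs (w.length + 1)
      (init _ _ _, stk a b T (update (fun _ => []) k (w.map o.symm)))
      (init _ _ _, stk a (w.reverse ++ b) T (fun _ => [])) := by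
  convert runs_moveNB (M := M) (a := a) (b := b) (T := T) (U := update (fun _ => []) k (w.map o.symm)) k o using 3 <;>
    simp [Function.comp_def]

theorem runs_inN {Δ : Type} [Inhabited Δ] {a : List Δ} (k : N.K) (i : N.Γ k ≃ Δ) (w : List Δ) :
    (moveBN M k i.symm).Runs (w.length + 1)
      (init _ _ _, stk a w.reverse T (fun _ => []))
      (init _ _ _, stk a [] T (update (fun _ => []) k (w.map i.symm))) := by
  have h := runs_moveBN (M := M) (a := a) (b := w.reverse) (T := T) (U := (fun _ => [])) k i.symm
  simpa only [List.length_reverse, List.map_reverse, List.reverse_reverse, List.append_nil] using h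

variable (M) in
/-- Apply the second subroutine to the first work stack. -/
def applyN (i : N.Γ N.k₀ ≃ Bool) (o : N.Γ N.k₁ ≃ Bool) : Frag (TwoSub Bool M N) (State Bool M N) :=
  (moveAB _ _ _).seq <| (moveBN _ N.k₀ i.symm).seq <| (callN _ _ _).seq <|
    (moveNB _ N.k₁ o).seq (moveBA _ _ _)

theorem runs_applyN (i : N.Γ N.k₀ ≃ Bool) (o : N.Γ N.k₁ ≃ Bool) {n L : ℕ} {w w' : List Bool}
    (h : N.frag.Runs n (N.initialState, update (fun _ => []) N.k₀ (w.map i.symm))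
      (N.initialState, update (fun _ => []) N.k₁ (w'.map o.symm)))
    (hw : w.length ≤ L) (hw' : w'.length ≤ n) :
    (applyN M i o).Runs (2 * L + 3 * n + 4) (init _ _ _, stk w [] T (fun _ => []))
      (init _ _ _, stk w' [] T (fun _ => [])) := by
  have h1 := runs_moveAB (Δ := Bool) (M := M) (N := N) (a := w) (b := []) (T := T) (U := fun _ => [])
  have h2 := runs_moveBA (Δ := Bool) (M := M) (N := N) (a := []) (b := w'.reverse ++ []) (T := T) (U := fun _ => [])
  simp only [List.append_nil, List.reverse_reverse] at h1 h2
  have h3 := runs_outN (T := T) (a := []) (b := []) N.k₁ o w'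
  rw [List.append_nil] at h3
  refine Frag.Runs.mono (h1.seq <| (runs_inN N.k₀ i w).seq <| (runs_callN h).seq <| h3.seq h2) ?_
  rw [List.length_reverse]
  omega

end

end TwoSub

/-- `LoopRun f L n a b`: starting with `a`, the loop that repeats `f` until its result is of the
form `inl _` returns `b` after at most `n` repetitions, on arguments of size at most `L`. -/
inductive LoopRun {α β : Type} [TreeEnc α] (f : α → β ⊕ α) (L : ℕ) : ℕ → α → β → Prop
  | done {n : ℕ} {a : α} {b : β} : treeSize a ≤ L → f a = .inl b → LoopRun f L n a b
  | next {n : ℕ} {a a' : α} {b : β} : treeSize a ≤ L → f a = .inr a' → LoopRun f L n a' b →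
      LoopRun f L (n + 1) a b

/-! ### Closure under pairing, case distinction and loops -/

namespace PT

open TwoSub

variable {α β γ : Type} [TreeEnc α] [TreeEnc β] [TreeEnc γ]

theorem comp {g : β → γ} {f : α → β} (hg : PT g) (hf : PT f) : PT (fun a => g (f a)) :=
  PolyTime.comp hg hf

/-- The input is copied, one copy goes to `M` and the other is overwritten by the output of `N`.
Putting the output of `M` on top of it, and one `true` on top of that, gives the prefix code of the
pair. -/
theorem pair {f : α → β} {g : α → γ} (hf : PT f) (hg : PT g) : PT (fun a => (f a, g a)) := by
  obtain ⟨M, i, o, p, hM⟩ := hf.exists_machine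
  obtain ⟨N, i', o', q, hN⟩ := hg.exists_machine
  let F : Frag (TwoSub Bool M N) (State Bool M N) :=
    (moveAB _ _ _).seq <| (copyBMA _ M.k₀ i.symm).seq <| (callM _ _ _).seq <|
    (applyN _ i' o').seq <| (moveMB _ M.k₁ o).seq <| (moveBA _ _ _).seq (pushTrue _ _)
  refine polyTime_of_frag F ((Polynomial.X + 1) + ((Polynomial.X + 1) + (p +
    ((2 * Polynomial.X + 3 * q + 4) + ((p + 1) + ((p + 1) + 1)))))) fun a => ?_
  obtain ⟨h1, h1'⟩ := hM a
  obtain ⟨h2, h2'⟩ := hN a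
  have h3 := runs_moveAB (Δ := Bool) (M := M) (N := N) (a := treeWord a) (b := [])
    (T := fun _ => []) (U := fun _ => [])
  have h4 := runs_copyBMA (Δ := Bool) (M := M) (N := N) (a := []) (b := (treeWord a).reverse)
    (T := fun _ => []) (U := fun _ => []) M.k₀ i.symm
  have h5 := runs_outM (N := N) (U := fun _ => []) (a := treeWord (g a)) (b := []) M.k₁ o
    (treeWord (f a))
  have h6 := runs_moveBA (Δ := Bool) (M := M) (N := N) (a := treeWord (g a))
    (b := (treeWord (f a)).reverse) (T := fun _ => []) (U := fun _ => [])
  simp only [List.append_nil, List.reverse_reverse, List.map_reverse] at h3 h4 h5 h6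
  refine Frag.Runs.mono (h3.seq <| h4.seq <| (runs_callM h1).seq <|
    (runs_applyN i' o' h2 le_rfl h2').seq <| h5.seq <| h6.seq runs_pushTrue) ?_
  simp
  omega

/-- The code of a sum begins with its tag, which is popped into the register and selects the
subroutine. The register is cleared before the call because calls expect the initial state. -/
theorem sumElim {f : α → γ} {g : β → γ} (hf : PT f) (hg : PT g) : PT (Sum.elim f g) := by
  obtain ⟨M, i, o, p, hM⟩ := hf.exists_machine
  obtain ⟨N, i', o', q, hN⟩ := hg.exists_machine
  let F : Frag (TwoSub Bool M N) (State Bool M N) :=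
    (popTag _ _).seq <| .ite (fun s => s.1 = some true)
      ((setReg _ _ none).seq (applyN _ i' o')) ((setReg _ _ none).seq (applyM _ i o))
  refine polyTime_of_frag F (1 + (1 + (2 * Polynomial.X + 3 * (p + q) + 4) + 1)) ?_
  rintro (a | b)
  · obtain ⟨h1, h2⟩ := hM a
    refine Frag.Runs.mono ((runs_popTag_false _).seq <| Frag.Runs.ite_false _ (by simp) <|
      (runs_setReg _ _).seq <| runs_applyM (L := (treeWord a).length) i o h1 le_rfl h2) ?_
    have := p.eval_le_eval_nat (m := (treeWord a).length)
      (n := (treeWord (Sum.inl a : α ⊕ β)).length) (by simp; omega)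
    simp only [treeWord_inl, List.length_cons, Polynomial.eval_add, Polynomial.eval_mul,
      Polynomial.eval_X, Polynomial.eval_ofNat, Polynomial.eval_one] at this ⊢
    omega
  · obtain ⟨h1, h2⟩ := hN b
    refine Frag.Runs.mono ((runs_popTag_true _).seq <| Frag.Runs.ite_true _ (by simp) <|
      (runs_setReg _ _).seq <| runs_applyN (L := (treeWord b).length) i' o' h1 le_rfl h2) ?_
    have := q.eval_le_eval_nat (m := (treeWord b).length)
      (n := (treeWord (Sum.inr b : α ⊕ β)).length) (by simp; omega)
    simp only [treeWord_inr, List.length_cons, Polynomial.eval_add, Polynomial.eval_mul,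
      Polynomial.eval_X, Polynomial.eval_ofNat, Polynomial.eval_one] at this ⊢
    omega

/-- Loops whose length and whose intermediate values are polynomially bounded, started at values of
the form `h x`. -/
theorem _root_.PolyTime.loop {f : α → β ⊕ α} (hf : PT f) {δ : Type} {h : δ → α} {g : δ → β}
    (q : Polynomial ℕ)
    (H : ∀ x, LoopRun f (q.eval (treeSize (h x))) (q.eval (treeSize (h x))) (h x) (g x)) :
    PolyTime (fun x => treeWord (h x)) treeWord g := by
  obtain ⟨M, i, o, p, hM⟩ := hf.exists_machine
  -- Only one subroutine is needed; `N` fills the second slot of the machine and is never called.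
  let N := idComputer Bool
  let F : Frag (TwoSub Bool M N) (State Bool M N) :=
    (setReg _ _ (some true)).seq <| Frag.seq (.loop (fun s => s.1 = some true)
      ((setReg _ _ none).seq <| (applyM _ i o).seq <| popTag _ _)) <| setReg _ _ none
  refine polyTime_of_frag F (1 + (((q + 1) * (2 * q + 3 * p.comp q + 8) + 1) + 1)) fun a => ?_
  -- The factor is `n + 1` because the final evaluation of `f`, with result `inl b`, also costs one
  -- round. The register holds the tag of the last result and thereby controls the loop.
  have key : ∀ (L n : ℕ) (a : α) (b : β), LoopRun f L n a b →
      (Frag.loop (fun s : State Bool M N => s.1 = some true)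
        ((setReg _ _ none).seq <| (applyM _ i o).seq <| popTag _ _)).Runs
      ((n + 1) * (2 * L + 3 * p.eval L + 8) + 1)
      ((some true, (init Bool M N).2), stk (treeWord a) [] (fun _ => []) fun _ => [])
      ((some false, (init Bool M N).2), stk (treeWord b) [] (fun _ => []) fun _ => []) := by
    intro L n a b h
    have step : ∀ a, treeSize a ≤ L →
        (applyM N i o).Runs (2 * L + 3 * p.eval L + 4)
          (init _ _ _, stk (treeWord a) [] (fun _ => []) fun _ => [])
          (init _ _ _, stk (treeWord (f a)) [] (fun _ => []) fun _ => []) := by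
      intro a ha
      have hp := p.eval_le_eval_nat ha
      exact runs_applyM i o ((hM a).1.mono hp) ha ((hM a).2.trans hp)
    induction h with
    | @done n a b ha hf =>
      have h1 := step a ha
      rw [hf] at h1
      refine Frag.Runs.mono (Frag.Runs.loop_true (by simp)
        ((runs_setReg _ _).seq <| h1.seq <| runs_popTag_false _)
        (Frag.runs_loop_false _ (by simp))) ?_
      rw [Nat.add_one_mul n (2 * L + 3 * p.eval L + 8)]
      omega
    | @next n a a' b ha hf _ ih =>
      have h1 := step a ha
      rw [hf] at h1
      refine Frag.Runs.mono (Frag.Runs.loop_true (by simp)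
        ((runs_setReg _ _).seq <| h1.seq <| runs_popTag_true _) ih) ?_
      rw [Nat.add_one_mul (n + 1) (2 * L + 3 * p.eval L + 8)]
      omega
  refine Frag.Runs.mono ((runs_setReg _ _).seq <| (key _ _ _ _ (H a)).seq <|
    runs_setReg _ (some false)) ?_
  simp [Polynomial.eval_comp, treeSize]

end PT

/-! ### Machines with three stacks -/

/-- One stack of bits and two stacks of symbols from `Γ`. -/
abbrev ThreeStk (Γ : Type) : Option Bool → Type
  | none => Bool
  | some _ => Γ

namespace ThreeStk

variable {Γ : Type}

/-- The three stacks. -/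
def stk (c : List Bool) (a b : List Γ) : ∀ k, List (ThreeStk Γ k)
  | none => c
  | some false => a
  | some true => b

variable (c l : List Bool) (a b w : List Γ)

@[simp] theorem stk_c : stk c a b none = c := rfl
@[simp] theorem stk_a : stk c a b (some false) = a := rfl
@[simp] theorem stk_b : stk c a b (some true) = b := rfl

@[simp] theorem update_c : update (stk c a b) none l = stk l a b :=
  update_eq_iff.2 ⟨rfl, by rintro (_ | _ | _) h <;> first | rfl | exact absurd rfl h⟩

@[simp] theorem update_a : update (stk c a b) (some false) w = stk c w b :=
  update_eq_iff.2 ⟨rfl, by rintro (_ | _ | _) h <;> first | rfl | exact absurd rfl h⟩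

@[simp] theorem update_b : update (stk c a b) (some true) w = stk c a w :=
  update_eq_iff.2 ⟨rfl, by rintro (_ | _ | _) h <;> first | rfl | exact absurd rfl h⟩

theorem empty_eq : (fun _ => []) = stk (Γ := Γ) [] [] [] := by
  funext k; obtain _ | _ | _ := k <;> rfl

variable {c a b} {ρ : Type} (x : ρ)

variable (Γ ρ) in
/-- Move the second symbol stack to the first one. -/
def moveBA [Inhabited Γ] : Frag (ThreeStk Γ) (Option Γ × ρ) :=
  .move (some true) (some false) (fun x : Γ => x) (fun x : Γ => x)

theorem runs_moveBA [Inhabited Γ] : (moveBA Γ ρ).Runs (b.length + 1) ((none, x), stk c a b)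
    ((none, x), stk c (b.reverse ++ a) []) := by
  have := Frag.runs_move (k := some true) (k' := some false) (by simp) (fun x : Γ => x)
    (fun x : Γ => x) x (stk c a b)
  refine (congrArg (Frag.Runs _ _ _) (congrArg (Prod.mk _) ?_)).mp this
  exact ((congrArg (fun S => update S _ _) (update_b c a b [])).trans (update_a _ _ _ _)).trans
    (congrArg (fun l => stk c (l.reverse ++ a) []) (List.map_id' b))

variable (Γ ρ) in
/-- Move the first symbol stack to the second one. -/
def moveAB [Inhabited Γ] : Frag (ThreeStk Γ) (Option Γ × ρ) :=
  .move (some false) (some true) (fun x : Γ => x) (fun x : Γ => x)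

theorem runs_moveAB [Inhabited Γ] : (moveAB Γ ρ).Runs (a.length + 1) ((none, x), stk c a b)
    ((none, x), stk c [] (a.reverse ++ b)) := by
  have := Frag.runs_move (k := some false) (k' := some true) (by simp) (fun x : Γ => x)
    (fun x : Γ => x) x (stk c a b)
  refine (congrArg (Frag.Runs _ _ _) (congrArg (Prod.mk _) ?_)).mp this
  exact ((congrArg (fun S => update S _ _) (update_a c a b [])).trans (update_b _ _ _ _)).trans
    (congrArg (fun l => stk c [] (l.reverse ++ b)) (List.map_id' a))

variable (Γ ρ) in
/-- Empty the first symbol stack. -/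
def drainA : Frag (ThreeStk Γ) (Option Γ × ρ) := .drain (some false) (fun x : Γ => x)

theorem runs_drainA : (drainA Γ ρ).Runs (a.length + 1) ((none, x), stk c a b)
    ((none, x), stk c [] b) := by
  have := Frag.runs_drain (k := some false) (fun x : Γ => x) x (stk c a b)
  rw [update_a] at this
  exact this

variable (Γ ρ) in
/-- Empty the second symbol stack. -/
def drainB : Frag (ThreeStk Γ) (Option Γ × ρ) := .drain (some true) (fun x : Γ => x)

theorem runs_drainB : (drainB Γ ρ).Runs (b.length + 1) ((none, x), stk c a b)
    ((none, x), stk c a []) := by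
  have := Frag.runs_drain (k := some true) (fun x : Γ => x) x (stk c a b)
  rw [update_b] at this
  exact this

/-! ### Components of pairs -/

/-- Move the code of a tree from the first symbol stack to the second one; the bit stack counts
the trees that are still to be read. -/
def splitLoop : Frag (ThreeStk Bool) (Option Bool × Unit) :=
  .block <| .pop none (fun s x => (x, s.2)) <| .branch (fun s => s.1.isSome)
    (.pop (some false) (fun s x => (x, s.2)) <| .branch (fun s => s.1 = some true)
      (.push (some true) (fun _ => true) <| .push none (fun _ => true) <|
        .push none (fun _ => true) <| .goto fun _ => ())
      (.push (some true) (fun _ => false) <| .goto fun _ => ())) .halt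

/-- A leaf completes one pending tree, whereas a node symbol replaces one pending tree by two. Each
step consumes one symbol, so the time is the length of the code. -/
theorem reachIn_splitLoop (t : BinTree) (w b c : List Bool) (r : Option Bool) :
    ReachIn (TM2.step splitLoop.m) t.word.length
      ⟨some (), (r, ()), stk (true :: c) (t.word ++ w) b⟩
      ⟨some (), (some false, ()), stk c w (t.word.reverse ++ b)⟩ := by
  induction t generalizing w b c r with
  | leaf =>
    refine .single ?_
    simp [splitLoop, Frag.block, BinTree.word]
  | node s t ihs iht =>
    have h := (ihs (t.word ++ w) (true :: b) (true :: c) (some true)).trans (iht w _ c _)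
    simp only [BinTree.word, List.length_cons, List.length_append, List.reverse_cons,
      List.reverse_append, List.append_assoc, List.cons_append] at h ⊢
    refine .head ?_ h
    simp [splitLoop, Frag.block]

/-- Separate the codes of the components of a pair. -/
def split : Frag (ThreeStk Bool) (Option Bool × Unit) :=
  .seq (.block <| .pop (some false) (fun s _ => s) <| .push none (fun _ => true) .halt) splitLoop

theorem runs_split (s t : BinTree) :
    split.Runs (s.word.length + 2) ((none, ()), stk [] (BinTree.node s t).word [])
      ((none, ()), stk [] t.word s.word.reverse) := by
  have h1 : (Frag.block (Γ := ThreeStk Bool) (σ := Option Bool × Unit) <|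
      .pop (some false) (fun s _ => s) <| .push none (fun _ => true) .halt).Runs 1
      ((none, ()), stk [] (BinTree.node s t).word [])
      ((none, ()), stk [true] (s.word ++ t.word) []) :=
    Frag.runs_block (by simp [BinTree.word])
  have h2 : splitLoop.Runs (s.word.length + 1) ((none, ()), stk [true] (s.word ++ t.word) [])
      ((none, ()), stk [] t.word s.word.reverse) := by
    have := reachIn_splitLoop s t.word [] [] none
    rw [List.append_nil] at this
    refine this.trans (.single ?_)
    simp [splitLoop, Frag.block]
  refine (h1.seq h2).mono ?_
  omega

theorem polyTime_of_frag [Fintype Γ] {ρ : Type} [Fintype ρ] {α β : Type} {ea : α → List Γ}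
    {eb : β → List Γ} {f : α → β} (F : Frag (ThreeStk Γ) (Option Γ × ρ)) (x : ρ) (p : Polynomial ℕ)
    (H : ∀ a, F.Runs (p.eval (ea a).length) ((none, x), stk [] (ea a) [])
      ((none, x), stk [] (eb (f a)) [])) : PolyTime ea eb f := by
  let _ : Fintype (ThreeStk Γ (some false)) := inferInstanceAs (Fintype Γ)
  refine PolyTime.of_frag F (none, x) (some false) (some false) (Equiv.refl Γ)
    (Equiv.refl Γ) p fun a => ?_
  have := H a
  rw [← update_a [] [] _ (ea a), ← update_a [] [] _ (eb (f a)), ← empty_eq] at this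
  convert this using 3
  · exact List.map_id _
  · exact List.map_id _

end ThreeStk

namespace PT

open ThreeStk

variable {α β γ : Type} [TreeEnc α] [TreeEnc β] [TreeEnc γ]

theorem fst' : PT (Prod.fst : α × β → α) := by
  refine polyTime_of_frag (split.seq ((drainA _ _).seq (moveBA _ _))) () (3 * Polynomial.X + 4)
    fun x => ?_
  have h := runs_moveBA (Γ := Bool) (c := []) (a := []) (b := (treeWord x.1).reverse) ()
  rw [List.append_nil, List.reverse_reverse] at h
  refine ((runs_split (TreeEnc.tree x.1) (TreeEnc.tree x.2)).seq ((runs_drainA _).seq h)).mono ?_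
  simp
  simp only [treeWord]
  omega

theorem snd' : PT (Prod.snd : α × β → β) := by
  refine polyTime_of_frag (split.seq (drainB _ _)) () (3 * Polynomial.X + 4) fun x => ?_
  refine ((runs_split (TreeEnc.tree x.1) (TreeEnc.tree x.2)).seq (runs_drainB _)).mono ?_
  simp
  simp only [treeWord]
  omega

theorem unit : PT (fun _ : α => ()) := by
  refine polyTime_of_frag ((drainA _ _).seq (.block <| .push (some false) (fun _ => false) .halt))
    () (Polynomial.X + 2) fun x => ?_
  refine ((runs_drainA _).seq (Frag.runs_block (s' := ((none, ()), stk [] (treeWord ()) []))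
    (by simp))).mono ?_
  simp

/-- The same machine serves both functions, since a machine sees only the codes of arguments and
values. -/
theorem _root_.PolyTime.congr {α β α' β' Γ Γ' : Type} {ea : α → List Γ} {eb : β → List Γ'}
    {ea' : α' → List Γ} {eb' : β' → List Γ'} {f : α → β} {g : α' → β'} (hf : PolyTime ea eb f)
    (φ : α' → α) (h : ∀ a, ea (φ a) = ea' a) (h' : ∀ a, eb (f (φ a)) = eb' (g a)) :
    PolyTime ea' eb' g := by
  obtain ⟨⟨⟨M, i, o⟩, p, H⟩⟩ := hf
  refine ⟨⟨⟨M, i, o⟩, p, fun a => ?_⟩⟩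
  rw [← h, ← h']
  exact H (φ a)

end PT

/-! ### Reading and writing lists of symbols -/

namespace ThreeStk

variable {Γ : Type}

/-- Push a word that depends on the internal state; `n` bounds its length. -/
def pushWord {K : Type} {G : K → Type} {Λ σ : Type} (k : K) [Inhabited (G k)]
    (f : σ → List (G k)) : ℕ → TM2.Stmt G Λ σ → TM2.Stmt G Λ σ
  | 0, q => q
  | n + 1, q => .branch (fun v => n < (f v).length)
      (.push k (fun v => (f v).getD n default) (pushWord k f n q)) (pushWord k f n q)

/-- The symbols are pushed in order of decreasing index, so the word can be read off the stack from
its beginning. -/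
theorem stepAux_pushWord {K : Type} [DecidableEq K] {G : K → Type} {Λ σ : Type} (k : K)
    [Inhabited (G k)] (f : σ → List (G k)) (n : ℕ) (q : TM2.Stmt G Λ σ) (v : σ)
    (S : ∀ k, List (G k)) :
    TM2.stepAux (pushWord k f n q) v S = TM2.stepAux q v (update S k ((f v).take n ++ S k)) := by
  induction n generalizing S with
  | zero => simp [pushWord]
  | succ n ih =>
    simp only [pushWord, TM2.stepAux]
    by_cases h : n < (f v).length
    · simp only [h, decide_true, cond_true, ih]
      rw [update_self, update_idem]
      congr 2
      rw [List.take_add_one, List.append_assoc]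
      simp [h]
    · simp only [h, decide_false, cond_false, ih]
      rw [List.take_of_length_le (by omega), List.take_of_length_le (by omega)]

variable [TreeEnc Γ]

/-- Write the code of the list on the second symbol stack. -/
def readLoop [Inhabited Γ] (L : ℕ) : Frag (ThreeStk Γ) (Option Γ × Unit) :=
  .popLoop (some true) (fun s x => (x, s.2)) (fun s => s.1.isSome) fun q =>
    pushWord (K := Option Bool) (G := ThreeStk Γ) none
      (fun s => true :: true :: false :: false :: true :: treeWord (s.1.getD default)) L q

/-- The list lies reversed on the second symbol stack. Popping it yields the last element first,
which is the order in which cons cells have to be put in front of the code of the empty list on the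
bit stack. -/
theorem runs_readLoop [Inhabited Γ] {L : ℕ} (hL : ∀ x : Γ, treeSize x + 5 ≤ L) (l : List Γ) :
    (readLoop L).Runs (l.length + 1) ((none, ()), stk (treeWord ([] : List Γ)) [] l.reverse)
      ((none, ()), stk (treeWord l) [] []) := by
  have := Frag.runs_popLoop (k := some true) (Γ := ThreeStk Γ)
    (put := fun (s : Option Γ × Unit) x => (x, s.2))
    (test := fun s => s.1.isSome) (v := (none, ()))
    (body := fun q => pushWord (K := Option Bool) (G := ThreeStk Γ) none
      (fun s => true :: true :: false :: false :: true :: treeWord (s.1.getD default)) L q)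
    l.reverse (fun acc w => stk (treeWord acc) [] w) rfl rfl (fun _ => rfl) (fun _ _ => rfl)
    (fun _ _ => rfl) (fun acc a w => by
      rw [stepAux_pushWord, update_b, update_c, List.take_of_length_le]
      · simp [TM2.stepAux]
      · exact hL a)
  rw [List.reverse_reverse, List.length_reverse] at this
  exact this

end ThreeStk

open ThreeStk in
-- This leads from words over an arbitrary finite alphabet to tree codes; `PolyTime.writeList` leads
-- back.
theorem PolyTime.readList {Γ : Type} [TreeEnc Γ] [Fintype Γ] [Inhabited Γ] :
    PolyTime (id : List Γ → List Γ) treeWord (id : List Γ → List Γ) := by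
  -- A bound for all words that one round pushes: the code of a symbol after the five symbols of the
  -- cons cell. It exists because the alphabet is finite.
  let L := Finset.univ.sup (fun x : Γ => treeSize x + 5)
  let F : Frag (ThreeStk Γ) (Option Γ × Unit) :=
    (moveAB _ _).seq <| Frag.seq (.block (.push none (fun _ => false) <|
      .push none (fun _ => false) <| .push none (fun _ => true) .halt)) (readLoop L)
  let _ : Fintype (ThreeStk Γ (some false)) := inferInstanceAs (Fintype Γ)
  refine PolyTime.of_frag F (none, ()) (some false) none (Equiv.refl Γ) (Equiv.refl Bool)
    (2 * Polynomial.X + 3) fun l => ?_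
  have h1 := runs_moveAB (c := []) (a := l) (b := []) ()
  have h2 : (Frag.block (Γ := ThreeStk Γ) (σ := Option Γ × Unit) (.push none (fun _ => false) <|
      .push none (fun _ => false) <| .push none (fun _ => true) .halt)).Runs 1
      ((none, ()), stk [] [] l.reverse) ((none, ()), stk (treeWord ([] : List Γ)) [] l.reverse) :=
    Frag.runs_block (by simp)
  have h3 := runs_readLoop (L := L)
    (fun x => Finset.le_sup (f := fun x : Γ => treeSize x + 5) (Finset.mem_univ x)) l
  rw [List.append_nil] at h1
  have h := (h1.seq (h2.seq h3)).mono (n := (2 * Polynomial.X + 3 : Polynomial ℕ).eval l.length)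
    (by simp; omega)
  rw [← update_a [] [] _ l, ← update_c [] (treeWord l), ← empty_eq] at h
  convert h using 3
  · rfl
  · exact List.map_id _
  · exact List.map_id _

namespace ThreeStk

variable {Γ : Type}

/-- The internal state of the machine that writes symbols: the register, a tag and three bits. -/
abbrev WriteState (Γ : Type) : Type := Option Γ × (Bool × Bool × Bool × Bool)

/-- Read the code of a bit from the bit stack. -/
def readBit (set : Bool → WriteState Γ → WriteState Γ) (get : WriteState Γ → Bool)
    (q : TM2.Stmt (ThreeStk Γ) Unit (WriteState Γ)) : TM2.Stmt (ThreeStk Γ) Unit (WriteState Γ) :=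
  .pop none (fun s x => set (x.getD false) s) <|
    .branch get (.pop none (fun s _ => s) <| .pop none (fun s _ => s) q) q

/-- The code of `false` is a single symbol and that of `true` has three, so after a `true` two more
symbols must be discarded. -/
theorem stepAux_readBit {set : Bool → WriteState Γ → WriteState Γ} {get : WriteState Γ → Bool}
    (h : ∀ x s, get (set x s) = x) (q : TM2.Stmt (ThreeStk Γ) Unit (WriteState Γ))
    (s : WriteState Γ) (x : Bool) (w : List Bool) (a b : List Γ) :
    TM2.stepAux (readBit set get q) s (stk (treeWord x ++ w) a b) =
      TM2.stepAux q (set x s) (stk w a b) := by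
  cases x <;> simp [readBit, h, treeWord_false, treeWord_true]

/-- Decode the list on the bit stack and push its elements on the second symbol stack. -/
def writeLoop (dec : Bool × Bool × Bool → Γ) : Frag (ThreeStk Γ) (WriteState Γ) :=
  .block <| .pop none (fun s _ => s) <| .pop none (fun s x => (s.1, x.getD false, s.2.2)) <|
    .branch (fun s => s.2.1)
      (.pop none (fun s _ => s) <| .pop none (fun s _ => s) <| .pop none (fun s _ => s) <|
        .pop none (fun s _ => s) <|
        readBit (fun x s => (s.1, s.2.1, x, s.2.2.2)) (fun s => s.2.2.1) <|
        .pop none (fun s _ => s) <|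
        readBit (fun x s => (s.1, s.2.1, s.2.2.1, x, s.2.2.2.2)) (fun s => s.2.2.2.1) <|
        readBit (fun x s => (s.1, s.2.1, s.2.2.1, s.2.2.2.1, x)) (fun s => s.2.2.2.2) <|
        .push (some true) (fun s => dec s.2.2) <| .goto fun _ => ())
      (.pop none (fun s _ => s) <| .load (fun _ => (none, false, false, false, false)) .halt)

theorem runs_writeLoop (dec : Bool × Bool × Bool → Γ) (l : List (Bool × Bool × Bool)) :
    (writeLoop dec).Runs (l.length + 1) ((none, false, false, false, false), stk (treeWord l) [] [])
      ((none, false, false, false, false), stk [] [] (l.map dec).reverse) := by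
  have key : ∀ (l : List (Bool × Bool × Bool)) (x : Bool × Bool × Bool × Bool) (b : List Γ),
      (writeLoop dec).Runs (l.length + 1) ((none, x), stk (treeWord l) [] b)
      ((none, false, false, false, false), stk [] [] ((l.map dec).reverse ++ b)) := by
    intro l
    induction l with
    | nil =>
      intro x b
      exact .single (by simp [writeLoop, Frag.block])
    | cons y l ih =>
      intro x b
      obtain ⟨y₁, y₂, y₃⟩ := y
      have := ih (true, y₁, y₂, y₃) (dec (y₁, y₂, y₃) :: b)
      rw [List.map_cons, List.reverse_cons, List.append_assoc]
      refine .head ?_ this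
      simp [writeLoop, Frag.block, stepAux_readBit]
  simpa using key l (false, false, false, false) []

end ThreeStk

open ThreeStk in
theorem PolyTime.writeList {Γ : Type} [Fintype Γ] [Inhabited Γ] (dec : Bool × Bool × Bool → Γ) :
    PolyTime treeWord id (List.map dec) := by
  let F : Frag (ThreeStk Γ) (WriteState Γ) := (writeLoop dec).seq (moveBA _ _)
  let _ : Fintype (ThreeStk Γ none) := inferInstanceAs (Fintype Bool)
  refine PolyTime.of_frag F (none, false, false, false, false) none (some false) (Equiv.refl Bool)
    (Equiv.refl Γ) (2 * Polynomial.X + 2) fun l => ?_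
  have h1 := runs_writeLoop dec l
  have h2 := runs_moveBA (c := []) (a := []) (b := (l.map dec).reverse)
    (false, false, false, false)
  rw [List.append_nil, List.reverse_reverse] at h2
  have hl : l.length ≤ (treeWord l).length := by
    clear h1 h2
    induction l with
    | nil => simp
    | cons x l ih => simp; omega
  have h := (h1.seq h2).mono (n := (2 * Polynomial.X + 2 : Polynomial ℕ).eval (treeWord l).length)
    (by simp; omega)
  rw [← update_c [] (treeWord l), ← update_a [] [] _ (l.map dec), ← empty_eq] at h
  convert h using 3
  · exact List.map_id _
  · exact List.map_id _

open Computability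

attribute [fun_prop] PT

/-! ### Programming with trees -/

instance : TreeEnc BinTree := ⟨id⟩

namespace PT

variable {α β γ δ α' β' : Type} [TreeEnc α] [TreeEnc β] [TreeEnc γ] [TreeEnc δ] [TreeEnc α']
  [TreeEnc β']

/-- Computability only depends on the codes of arguments and values. -/
theorem recode {f : α → β} (hf : PT f) {g : α' → β'} (φ : α' → α)
    (h : ∀ a, TreeEnc.tree (φ a) = TreeEnc.tree a)
    (h' : ∀ a, TreeEnc.tree (f (φ a)) = TreeEnc.tree (g a)) : PT g :=
  PolyTime.congr hf φ (fun a => congrArg _ (h a)) fun a => congrArg _ (h' a)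

@[fun_prop]
theorem id' : PT fun x : α => x :=
  ⟨idComputableInPolyTime _⟩

attribute [fun_prop] comp

-- By induction on the code of the constant: a leaf is the value of the unit function, a node is a
-- pair.
@[fun_prop]
theorem const (b : β) : PT fun _ : α => b := by
  suffices h : ∀ t : BinTree, PT fun _ : α => t from (h (TreeEnc.tree b)).recode id
    (fun _ => rfl) fun _ => rfl
  intro t
  induction t with
  | leaf => exact unit.recode id (fun _ => rfl) fun _ => rfl
  | node s t hs ht => exact (hs.pair ht).recode id (fun _ => rfl) fun _ => rfl

attribute [fun_prop] pair

@[fun_prop]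
theorem fst {f : α → β × γ} (hf : PT f) : PT fun x => (f x).1 :=
  fst'.comp hf

@[fun_prop]
theorem snd {f : α → β × γ} (hf : PT f) : PT fun x => (f x).2 :=
  snd'.comp hf

@[fun_prop]
theorem inl {f : α → β} (hf : PT f) : PT fun x => (Sum.inl (f x) : β ⊕ γ) :=
  ((const false).pair hf).recode id (fun _ => rfl) fun _ => rfl

@[fun_prop]
theorem inr {f : α → β} (hf : PT f) : PT fun x => (Sum.inr (f x) : γ ⊕ β) :=
  ((const true).pair hf).recode id (fun _ => rfl) fun _ => rfl

/-- Case distinction in a context. -/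
theorem sumCase {s : α → β ⊕ γ} {f : α × β → δ} {g : α × γ → δ} (hs : PT s) (hf : PT f)
    (hg : PT g) : PT fun x => Sum.elim (fun b => f (x, b)) (fun c => g (x, c)) (s x) := by
  -- On codes, distributing the product over the sum merely moves the tag from the second component
  -- to the front, so no case distinction is required.
  have h1 : PT fun p : α × (BinTree × BinTree) => (p.2.1, (p.1, p.2.2)) := by fun_prop
  have h2 : PT fun p : α × (β ⊕ γ) =>
      (Sum.elim (fun b => .inl (p.1, b)) (fun c => .inr (p.1, c)) p.2 : (α × β) ⊕ (α × γ)) := by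
    refine h1.recode (fun p => (p.1, p.2.elim (fun b => (.leaf, TreeEnc.tree b))
      (fun c => (.node .leaf .leaf, TreeEnc.tree c)))) ?_ ?_
    · rintro ⟨_, _ | _⟩ <;> rfl
    · rintro ⟨_, _ | _⟩ <;> rfl
  have h3 := (hf.sumElim hg).comp (h2.comp (id'.pair hs))
  convert h3 using 2 with x
  cases s x <;> rfl

@[fun_prop]
theorem cond {c : α → Bool} {f g : α → β} (hc : PT c) (hf : PT f) (hg : PT g) :
    PT fun x => bif c x then f x else g x := by
  have h1 : PT fun x => (bif c x then .inr () else .inl () : Unit ⊕ Unit) :=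
    (hc.pair (const ())).recode id (fun _ => rfl) fun x => by
      simp only [id_eq]
      cases c x <;> rfl
  have h2 := h1.sumCase (f := fun p => g p.1) (g := fun p => f p.1) (by fun_prop) (by fun_prop)
  convert h2 using 2 with x
  cases c x <;> rfl

@[fun_prop]
theorem ite {p : α → Prop} [DecidablePred p] {f g : α → β} (hp : PT fun x => decide (p x))
    (hf : PT f) (hg : PT g) : PT fun x => if p x then f x else g x := by
  convert hp.cond hf hg using 2 with x
  by_cases h : p x <;> simp [h]

@[fun_prop]
theorem not {c : α → Bool} (hc : PT c) : PT fun x => !(c x) := by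
  convert hc.cond (const false) (const true) using 2 with x
  cases c x <;> rfl

@[fun_prop]
theorem and {c d : α → Bool} (hc : PT c) (hd : PT d) : PT fun x => c x && d x := by
  convert hc.cond hd (const false) using 2 with x
  cases c x <;> rfl

@[fun_prop]
theorem or {c d : α → Bool} (hc : PT c) (hd : PT d) : PT fun x => c x || d x := by
  convert hc.cond (const true) hd using 2 with x
  cases c x <;> rfl

@[fun_prop]
theorem xor {c d : α → Bool} (hc : PT c) (hd : PT d) : PT fun x => Bool.xor (c x) (d x) := by
  convert hc.cond hd.not hd using 2 with x
  cases c x <;> simp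

end PT

/-! ### Lists -/

section

variable {α : Type} [TreeEnc α]

theorem length_le_treeSize (l : List α) : l.length ≤ treeSize l := by
  induction l with
  | nil => simp
  | cons a l ih => simp; omega

theorem treeSize_le_of_mem {a : α} {l : List α} (h : a ∈ l) : treeSize a ≤ treeSize l := by
  induction h with
  | head l => simp; omega
  | tail b _ ih => simp; omega

theorem treeSize_append (l l' : List α) : treeSize (l ++ l') + 3 = treeSize l + treeSize l' := by
  induction l with
  | nil => simp [Nat.add_comm]
  | cons a l ih => simp; omega

theorem treeSize_reverse (l : List α) : treeSize l.reverse = treeSize l := by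
  induction l with
  | nil => rfl
  | cons a l ih =>
    have := treeSize_append l.reverse [a]
    simp at this ⊢
    omega

theorem treeSize_list_le {l : List α} {n : ℕ} (h : ∀ a ∈ l, treeSize a ≤ n) :
    treeSize l ≤ l.length * (n + 5) + 3 := by
  induction l with
  | nil => simp
  | cons a l ih =>
    have h1 := ih fun b hb => h b (List.mem_cons_of_mem _ hb)
    have h2 := h a List.mem_cons_self
    rw [treeSize_cons, List.length_cons, Nat.succ_mul]
    omega

theorem three_le_treeSize (l : List α) : 3 ≤ treeSize l := by
  cases l with
  | nil => simp
  | cons a l => rw [treeSize_cons]; omega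

theorem treeSize_le_of_infix {l l' : List α} (h : l <:+: l') : treeSize l ≤ treeSize l' := by
  obtain ⟨s, t, rfl⟩ := h
  have h1 := treeSize_append (s ++ l) t
  have h2 := treeSize_append s l
  have h3 := three_le_treeSize s
  have h4 := three_le_treeSize t
  omega

end

namespace PT

variable {α β γ δ α' β' : Type} [TreeEnc α] [TreeEnc β] [TreeEnc γ] [TreeEnc δ] [TreeEnc α']
  [TreeEnc β']

@[fun_prop]
theorem cons {f : α → β} {l : α → List β} (hf : PT f) (hl : PT l) : PT fun x => f x :: l x :=
  (inr (γ := Unit) (hf.pair hl)).recode id (fun _ => rfl) fun _ => rfl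

/-- Case distinction on a list. -/
theorem listCase {l : α → List β} {f : α → δ} {g : α × (β × List β) → δ} (hl : PT l) (hf : PT f)
    (hg : PT g) {r : α → δ} (h0 : ∀ x, l x = [] → r x = f x)
    (h1 : ∀ x b t, l x = b :: t → r x = g (x, b, t)) : PT r := by
  have h : PT fun x => (match l x with
      | [] => .inl ()
      | b :: t => .inr (b, t) : Unit ⊕ (β × List β)) :=
    hl.recode id (fun _ => rfl) fun x => by
      simp only [id_eq]
      cases l x <;> rfl
  have h2 := h.sumCase (f := fun p => f p.1) (g := g) (by fun_prop) hg
  convert h2 using 2 with x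
  rcases hx : l x with _ | ⟨b, t⟩
  · exact h0 x hx
  · exact h1 x b t hx

@[fun_prop]
theorem tail {l : α → List β} (hl : PT l) : PT fun x => (l x).tail :=
  hl.listCase (f := fun _ => []) (g := fun p => p.2.2) (by fun_prop) (by fun_prop)
    (fun x h => by rw [h]; rfl) fun x b t h => by rw [h]; rfl

@[fun_prop]
theorem headD {l : α → List β} {f : α → β} (hl : PT l) (hf : PT f) :
    PT fun x => (l x).headD (f x) :=
  hl.listCase (f := f) (g := fun p => p.2.1) (by fun_prop) (by fun_prop)
    (fun x h => by rw [h]; rfl) fun x b t h => by rw [h]; rfl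

@[fun_prop]
theorem isEmpty {l : α → List β} (hl : PT l) : PT fun x => (l x).isEmpty :=
  hl.listCase (f := fun _ => true) (g := fun _ => false) (by fun_prop) (by fun_prop)
    (fun x h => by rw [h]; rfl) fun x b t h => by rw [h]; rfl

/-- Folds with polynomially bounded intermediate values. -/
theorem foldl {l : α → List β} {init : α → γ} {step : α → γ → β → γ} (hl : PT l) (hi : PT init)
    (hs : PT fun p : α × γ × β => step p.1 p.2.1 p.2.2) (q : Polynomial ℕ)
    (hq : ∀ x l₁ l₂, l x = l₁ ++ l₂ →
      treeSize (l₁.foldl (step x) (init x)) ≤ q.eval (treeSize x)) :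
    PT fun x => (l x).foldl (step x) (init x) := by
  -- One round of the loop; its state consists of the parameter, the accumulator and the unread part
  -- of the list.
  let f : α × γ × List β → γ ⊕ (α × γ × List β) := fun s =>
    match s.2.2 with
    | [] => .inl s.2.1
    | b :: t => .inr (s.1, step s.1 s.2.1 b, t)
  have hf : PT f := by
    refine listCase (l := fun s : α × γ × List β => s.2.2) (f := fun s => .inl s.2.1)
      (g := fun p => .inr (p.1.1, step p.1.1 p.1.2.1 p.2.1, p.2.2)) (by fun_prop) (by fun_prop)
      ?_ (fun s h => ?_) (fun s b t h => ?_)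
    · have : PT fun p : (α × γ × List β) × (β × List β) => step p.1.1 p.1.2.1 p.2.1 :=
        hs.comp (f := fun p : (α × γ × List β) × (β × List β) => (p.1.1, p.1.2.1, p.2.1))
          (by fun_prop)
      fun_prop
    · simp only [f, h]
    · simp only [f, h]
  have hh : PT fun x => (x, init x, l x) := by fun_prop
  have key : ∀ x L, treeSize x + q.eval (treeSize x) + treeSize (l x) + 2 ≤ L →
      ∀ l₂ l₁, l x = l₁ ++ l₂ → LoopRun f L l₂.length (x, l₁.foldl (step x) (init x), l₂)
        ((l x).foldl (step x) (init x)) := by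
    intro x L hL l₂
    induction l₂ with
    | nil =>
      intro l₁ h
      rw [List.append_nil] at h
      subst h
      refine .done ?_ rfl
      have := hq x (l x) [] (by simp)
      have := three_le_treeSize (l x)
      simp only [treeSize_prod, treeSize_nil]
      omega
    | cons b l₂ ih =>
      intro l₁ h
      refine .next ?_ rfl ?_
      · have h1 := hq x l₁ (b :: l₂) h
        have h2 := treeSize_le_of_infix (l := b :: l₂) (l' := l x) (h ▸ (List.suffix_append _ _).isInfix)
        simp only [treeSize_prod]
        omega
      · have := ih (l₁ ++ [b]) (by simpa using h)
        rwa [List.foldl_append] at this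
  have mono : ∀ {f : α × γ × List β → γ ⊕ (α × γ × List β)} {L m n : ℕ} {a b}, LoopRun f L m a b →
      m ≤ n → LoopRun f L n a b := by
    intro f L m n a b h
    induction h generalizing n with
    | done h1 h2 => exact fun _ => .done h1 h2
    | next h1 h2 _ ih =>
      intro hn
      obtain ⟨k, rfl⟩ := Nat.exists_eq_add_of_le hn
      rw [Nat.add_right_comm]
      exact .next h1 h2 (ih (Nat.le_add_right _ _))
  -- The loop is timed by the size of its initial state `(x, init x, l x)`. This size already covers
  -- `x` and the list, so `X + q` bounds every state and the number of rounds.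
  refine PolyTime.comp (eb := fun x => treeWord (x, init x, l x)) (f := fun x => x)
    (PolyTime.loop hf (g := fun x => (l x).foldl (step x) (init x)) (Polynomial.X + q) fun x => ?_)
    (PolyTime.congr hh id (fun _ => rfl) fun _ => rfl)
  have h1 := length_le_treeSize (l x)
  have h2 : treeSize (x, init x, l x) = treeSize x + (treeSize (init x) + treeSize (l x) + 1) + 1 :=
    by simp
  have h3 := q.eval_le_eval_nat (m := treeSize x) (n := treeSize (x, init x, l x)) (by omega)
  have h4 := treeSize_pos (init x)
  simp only [Polynomial.eval_add, Polynomial.eval_X]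
  exact mono (key x _ (by omega) (l x) [] rfl) (by omega)

end PT

namespace PT

variable {α β γ δ : Type} [TreeEnc α] [TreeEnc β] [TreeEnc γ] [TreeEnc δ]

theorem exists_size_le {f : α → β} (hf : PT f) :
    ∃ p : Polynomial ℕ, ∀ a, treeSize (f a) ≤ p.eval (treeSize a) :=
  PolyTime.exists_length_le hf

@[fun_prop]
theorem reverse {l : α → List β} (hl : PT l) : PT fun x => (l x).reverse := by
  have h : PT fun l : List β => l.foldl (fun acc b => b :: acc) [] := by
    refine foldl (l := fun l => l) (init := fun _ => []) (step := fun _ acc b => b :: acc)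
      (by fun_prop) (by fun_prop) (by fun_prop) Polynomial.X fun x l₁ l₂ h => ?_
    rw [List.foldl_flip_cons_eq_append', List.append_nil, treeSize_reverse, Polynomial.eval_X]
    exact treeSize_le_of_infix (h ▸ (List.prefix_append _ _).isInfix)
  convert h.comp hl using 2 with x
  rw [List.foldl_flip_cons_eq_append', List.append_nil]

/-- Right folds with polynomially bounded intermediate values. -/
theorem foldr {l : α → List β} {init : α → γ} {step : α → β → γ → γ} (hl : PT l) (hi : PT init)
    (hs : PT fun p : α × β × γ => step p.1 p.2.1 p.2.2) (q : Polynomial ℕ)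
    (hq : ∀ x l₂, l₂ <:+ l x → treeSize (l₂.foldr (step x) (init x)) ≤ q.eval (treeSize x)) :
    PT fun x => (l x).foldr (step x) (init x) := by
  have h := foldl (l := fun x => (l x).reverse) (init := init) (step := fun x c b => step x b c)
    (by fun_prop) hi
    (hs.comp (f := fun p : α × γ × β => (p.1, p.2.2, p.2.1)) (by fun_prop)) q
    fun x l₁ l₂ h => by
      rw [← List.foldr_reverse]
      refine hq x _ ?_
      rw [← List.reverse_reverse (l x), h, List.reverse_append]
      exact List.suffix_append _ _
  simpa only [List.foldl_reverse] using h

theorem map {l : α → List β} {f : α → β → γ} (hl : PT l) (hf : PT fun p : α × β => f p.1 p.2) :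
    PT fun x => (l x).map (f x) := by
  obtain ⟨p, hp⟩ := hl.exists_size_le
  obtain ⟨r, hr⟩ := hf.exists_size_le
  have h := foldr (l := l) (init := fun _ => ([] : List γ)) (step := fun x b acc => f x b :: acc)
    hl (by fun_prop) (by
      have : PT fun p : α × β × List γ => f p.1 p.2.1 :=
        hf.comp (f := fun p : α × β × List γ => (p.1, p.2.1)) (by fun_prop)
      fun_prop) (p * (r.comp (Polynomial.X + p + 1) + 5) + 3) fun x l₂ h => by
    rw [← List.map_eq_foldr]
    have h1 := treeSize_le_of_infix h.isInfix
    have h2 := length_le_treeSize l₂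
    have h3 := hp x
    refine (treeSize_list_le (n := r.eval (treeSize x + p.eval (treeSize x) + 1)) ?_).trans ?_
    · intro c hc
      obtain ⟨b, hb, rfl⟩ := List.mem_map.1 hc
      refine (hr (x, b)).trans (r.eval_le_eval_nat ?_)
      have := treeSize_le_of_mem hb
      simp only [treeSize_prod]
      omega
    · simp only [List.length_map, Polynomial.eval_add, Polynomial.eval_mul, Polynomial.eval_comp,
        Polynomial.eval_X, Polynomial.eval_one, Polynomial.eval_ofNat]
      gcongr
      omega
  simpa only [← List.map_eq_foldr] using h

@[fun_prop]
theorem append {l l' : α → List β} (hl : PT l) (hl' : PT l') : PT fun x => l x ++ l' x := by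
  have h : PT fun p : List β × List β => p.1.foldr List.cons p.2 := by
    refine foldr (l := fun p : List β × List β => p.1) (init := fun p => p.2)
      (step := fun _ => List.cons) (by fun_prop) (by fun_prop) (by fun_prop) Polynomial.X
      fun p l₂ h => ?_
    have h1 := treeSize_le_of_infix h.isInfix
    have h2 := treeSize_append l₂ p.2
    simp only [Polynomial.eval_X, treeSize_prod]
    simp at *
    omega
  convert h.comp (hl.pair hl') using 2 with x
  simp

/-- Left folds with values in `Bool`. -/
theorem foldlBool {l : α → List β} {init : α → Bool} {step : α → Bool → β → Bool} (hl : PT l)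
    (hi : PT init) (hs : PT fun p : α × Bool × β => step p.1 p.2.1 p.2.2) :
    PT fun x => (l x).foldl (step x) (init x) :=
  foldl hl hi hs 3 fun x l₁ _ _ => by
    cases l₁.foldl (step x) (init x) <;> simp

theorem all {l : α → List β} {p : α → β → Bool} (hl : PT l) (hp : PT fun x : α × β => p x.1 x.2) :
    PT fun x => (l x).all (p x) := by
  have h := foldlBool (l := l) (init := fun _ => true) (step := fun x c b => c && p x b) hl
    (by fun_prop) (by
      have : PT fun q : α × Bool × β => p q.1 q.2.2 :=
        hp.comp (f := fun q : α × Bool × β => (q.1, q.2.2)) (by fun_prop)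
      fun_prop)
  convert h using 2 with x
  suffices ∀ (l : List β) c, l.foldl (fun c b => c && p x b) c = (c && l.all (p x)) by
    rw [this, Bool.true_and]
  intro l
  induction l with
  | nil => simp
  | cons b l ih => intro c; rw [List.foldl_cons, ih, List.all_cons, Bool.and_assoc]

theorem treeSize_zip_le (l : List α) (l' : List β) :
    treeSize (l.zip l') ≤ treeSize l + treeSize l' := by
  induction l generalizing l' with
  | nil => simp
  | cons a l ih =>
    cases l' with
    | nil => simp
    | cons b l' =>
      have := ih l'
      simp
      omega

@[fun_prop]
theorem zip {l : α → List β} {l' : α → List γ} (hl : PT l) (hl' : PT l') :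
    PT fun x => (l x).zip (l' x) := by
  let step : List γ × List (β × γ) → β → List γ × List (β × γ) := fun s b =>
    match s.1 with
    | [] => s
    | c :: t => (t, (b, c) :: s.2)
  have hs : PT fun p : (List γ × List (β × γ)) × β => step p.1 p.2 :=
    listCase (l := fun p : (List γ × List (β × γ)) × β => p.1.1) (f := fun p => p.1)
      (g := fun q => (q.2.2, (q.1.2, q.2.1) :: q.1.1.2)) (by fun_prop) (by fun_prop) (by fun_prop)
      (fun p h => by simp only [step, h]) fun p b t h => by simp only [step, h]
  -- The fold over the first list carries the rest of the second list and the pairs formed so far,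
  -- in reverse order.
  have key : ∀ (l : List β) (l' : List γ) acc,
      l.foldl step (l', acc) = (l'.drop l.length, (l.zip l').reverse ++ acc) := by
    intro l
    induction l with
    | nil => simp
    | cons b l ih =>
      intro l' acc
      cases l' with
      | nil =>
        rw [List.foldl_cons]
        exact (ih [] acc).trans (by simp)
      | cons c l' =>
        rw [List.foldl_cons]
        exact (ih l' _).trans (by simp)
  have h : PT fun p : List β × List γ => p.1.foldl step (p.2, []) := by
    refine foldl (l := fun p : List β × List γ => p.1) (init := fun p => (p.2, []))
      (step := fun _ => step) (by fun_prop) (by fun_prop)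
      (hs.comp (f := fun q : (List β × List γ) × (List γ × List (β × γ)) × β => (q.2.1, q.2.2))
        (by fun_prop)) (2 * Polynomial.X + 1) fun p l₁ l₂ h => ?_
    have h1 := treeSize_zip_le l₁ p.2
    have h2 := treeSize_le_of_infix (List.drop_suffix l₁.length p.2).isInfix
    have h3 := treeSize_le_of_infix (l := l₁) (l' := p.1) (h ▸ (List.prefix_append _ _).isInfix)
    rw [key]
    simp only [List.append_nil, treeSize_prod, treeSize_reverse, Polynomial.eval_add,
      Polynomial.eval_mul, Polynomial.eval_ofNat, Polynomial.eval_X, Polynomial.eval_one]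
    omega
  have h' : PT fun x => ((l x).foldl step (l' x, [])).2.reverse := (h.comp (hl.pair hl')).snd.reverse
  convert h' using 2 with x
  rw [key]
  simp

@[fun_prop]
theorem getLastD {l : α → List β} {f : α → β} (hl : PT l) (hf : PT f) :
    PT fun x => (l x).getLastD (f x) := by
  convert hl.reverse.headD hf using 2 with x
  simp [List.getLastD_eq_getLast?, List.headD_eq_head?_getD]

end PT

/-! ### Binary arithmetic -/

/-- The side condition excludes a leading zero: zero itself is encoded by the empty list. -/
theorem Computability.encodeNat_bit {b : Bool} {n : ℕ} (h : n = 0 → b = true) :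
    encodeNat (Nat.bit b n) = b :: encodeNat n := by
  unfold encodeNat
  rw [← Num.ofNat'_eq, ← Num.ofNat'_eq, Num.ofNat'_bit]
  rcases hn : Num.ofNat' n with _ | p
  · have : n = 0 := by
      have := congrArg (fun m : Num => (m : ℕ)) hn
      simpa using this
    rw [h this]
    rfl
  · cases b <;> rfl

theorem Nat.bit_induction {P : ℕ → Prop} (zero : P 0)
    (bit : ∀ b n, (n = 0 → b = true) → P n → P (Nat.bit b n)) (n : ℕ) : P n := by
  induction n using Nat.binaryRec' with
  | zero => exact zero
  | bit b n h ih => exact bit b n h ih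

theorem foldr_encodeNat (n : ℕ) : (encodeNat n).foldr Nat.bit 0 = n := by
  induction n using Nat.bit_induction with
  | zero => rfl
  | bit b n h ih => rw [encodeNat_bit h, List.foldr_cons, ih]

theorem length_encodeNat (n : ℕ) : (encodeNat n).length = n.size := by
  induction n using Nat.bit_induction with
  | zero => rfl
  | bit b n h ih =>
    rw [encodeNat_bit h, List.length_cons, ih, Nat.size_bit]
    intro h0
    rw [Nat.bit_eq_zero_iff] at h0
    simp_all

instance : TreeEnc ℕ := ⟨fun n => TreeEnc.tree (encodeNat n)⟩

theorem treeSize_nat (n : ℕ) : treeSize n = treeSize (encodeNat n) := rfl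

theorem treeSize_bool_le (b : Bool) : treeSize b ≤ 3 := by cases b <;> simp

theorem treeSize_nat_le (n : ℕ) : treeSize n ≤ 8 * n.size + 3 := by
  rw [treeSize_nat, ← length_encodeNat, Nat.mul_comm]
  exact treeSize_list_le fun b _ => treeSize_bool_le b

theorem size_le_treeSize (n : ℕ) : n.size ≤ treeSize n := by
  rw [treeSize_nat, ← length_encodeNat]
  exact length_le_treeSize _

theorem treeSize_nat_mono {m n : ℕ} (h : m ≤ n) : treeSize m ≤ 8 * treeSize n + 3 := by
  have h1 := treeSize_nat_le m
  have h2 := Nat.size_le_size h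
  have h3 := size_le_treeSize n
  omega

namespace PT

variable {α β γ δ : Type} [TreeEnc α] [TreeEnc β] [TreeEnc γ] [TreeEnc δ]

@[fun_prop]
theorem encodeNat {f : α → ℕ} (hf : PT f) : PT fun x => encodeNat (f x) :=
  hf.recode id (fun _ => rfl) fun _ => rfl

@[fun_prop]
theorem eqZero {f : α → ℕ} (hf : PT f) : PT fun x => decide (f x = 0) := by
  convert hf.encodeNat.isEmpty using 2 with x
  generalize f x = n
  induction n using Nat.bit_induction with
  | zero => rfl
  | bit b n h _ =>
    rw [encodeNat_bit h, List.isEmpty_cons, decide_eq_false]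
    rw [Nat.bit_eq_zero_iff]
    simp_all

@[fun_prop]
theorem natBit {b : α → Bool} {f : α → ℕ} (hb : PT b) (hf : PT f) :
    PT fun x => Nat.bit (b x) (f x) := by
  have h : PT fun x => if f x = 0 then (bif b x then [true] else []) else
      b x :: Computability.encodeNat (f x) := by fun_prop
  refine h.recode id (fun _ => rfl) fun x => ?_
  change _ = TreeEnc.tree (Computability.encodeNat _)
  simp only [id_eq]
  congr 1
  by_cases h0 : f x = 0
  · rw [if_pos h0, h0]
    cases b x <;> rfl
  · rw [if_neg h0, encodeNat_bit fun h => absurd h h0]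

theorem _root_.foldl_bit_lt (l : List Bool) :
    l.foldl (fun n b => Nat.bit b n) 0 < 2 ^ l.length := by
  induction l using List.reverseRecOn with
  | nil => simp
  | append_singleton l b ih =>
    rw [List.foldl_append, List.length_append, List.length_singleton, pow_succ]
    simp only [List.foldl_cons, List.foldl_nil]
    generalize l.foldl (fun n b => Nat.bit b n) 0 = n at ih ⊢
    cases b <;> simp [Nat.bit] <;> omega

theorem _root_.foldl_bit_cons (b : Bool) (l : List Bool) :
    (b :: l).foldl (fun n b => Nat.bit b n) 0 =
      b.toNat * 2 ^ l.length + l.foldl (fun n b => Nat.bit b n) 0 := by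
  induction l using List.reverseRecOn with
  | nil => cases b <;> rfl
  | append_singleton l c ih =>
    rw [← List.cons_append, List.foldl_append, ih, List.foldl_append, List.length_append,
      List.length_singleton, pow_succ]
    cases c <;> simp [Nat.bit] <;> ring

@[fun_prop]
theorem ofDigits {l : α → List Bool} (hl : PT l) :
    PT fun x => (l x).foldl (fun n b => Nat.bit b n) 0 := by
  have h : PT fun l : List Bool => l.foldl (fun n b => Nat.bit b n) 0 := by
    refine foldl (l := fun l => l) (init := fun _ => 0) (step := fun _ n b => Nat.bit b n)
      (by fun_prop) (by fun_prop) (by fun_prop) (8 * Polynomial.X + 3) fun l l₁ l₂ h => ?_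
    have h1 := treeSize_nat_le (l₁.foldl (fun n b => Nat.bit b n) 0)
    have h2 := Nat.size_le.2 (foldl_bit_lt l₁)
    have h3 := length_le_treeSize l
    rw [h, List.length_append] at h3
    simp only [Polynomial.eval_add, Polynomial.eval_mul, Polynomial.eval_ofNat, Polynomial.eval_X]
    rw [h]
    omega
  exact h.comp hl

end PT

/-- One step of the subtraction of binary numbers; the state consists of the remaining digits of
the subtrahend, the borrow and the digits of the difference. -/
def subStep (s : List Bool × Bool × List Bool) (a : Bool) : List Bool × Bool × List Bool :=
  (s.1.tail, (bif a then s.1.headD false && s.2.1 else s.1.headD false || s.2.1),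
    Bool.xor a (Bool.xor (s.1.headD false) s.2.1) :: s.2.2)

theorem length_foldl_subStep (as bs : List Bool) (w : Bool) (out : List Bool) :
    (as.foldl subStep (bs, w, out)).2.2.length = as.length + out.length := by
  induction as generalizing bs w out with
  | nil => simp
  | cons a as ih =>
    rw [List.foldl_cons, subStep, ih, List.length_cons, List.length_cons, Nat.add_assoc,
      Nat.add_comm 1]

theorem foldl_subStep_fst (as bs : List Bool) (w : Bool) (out : List Bool) :
    (as.foldl subStep (bs, w, out)).1 = bs.drop as.length := by
  induction as generalizing bs w out with
  | nil => simp
  | cons a as ih =>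
    rw [List.foldl_cons, subStep, ih, List.length_cons, List.drop_tail]

/-- The loop invariant of subtraction by columns, written without subtraction. Each column satisfies
`a + 2 * borrow' = digit + b + borrow`. Produced digits are stored with the most significant one
first, and the final borrow, together with the unread digits of the subtrahend, counts at the
position after the last column. -/
theorem foldl_subStep (as bs : List Bool) (w : Bool) (out : List Bool) :
    2 ^ out.length * as.foldr Nat.bit 0 + out.foldl (fun n b => Nat.bit b n) 0 +
      2 ^ (as.length + out.length) * ((as.foldl subStep (bs, w, out)).2.1.toNat +
        (as.foldl subStep (bs, w, out)).1.foldr Nat.bit 0) =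
    (as.foldl subStep (bs, w, out)).2.2.foldl (fun n b => Nat.bit b n) 0 +
      2 ^ out.length * (bs.foldr Nat.bit 0 + w.toNat) := by
  induction as generalizing bs w out with
  | nil => simp; ring
  | cons a as ih =>
    have hbs : bs.foldr Nat.bit 0 =
        (bs.headD false).toNat + 2 * bs.tail.foldr Nat.bit 0 := by
      rcases bs with _ | ⟨_ | _, bs⟩
      · rfl
      · simp [Nat.bit]
      · simp [Nat.bit, Nat.add_comm]
    have := ih bs.tail (bif a then bs.headD false && w else bs.headD false || w)
      (Bool.xor a (Bool.xor (bs.headD false) w) :: out)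
    rw [List.foldl_cons]
    change _ = (as.foldl subStep (bs.tail, (bif a then bs.headD false && w else
      bs.headD false || w), Bool.xor a (Bool.xor (bs.headD false) w) :: out)).2.2.foldl _ 0 + _
    rw [subStep]
    simp only at this ⊢
    generalize as.foldl subStep (bs.tail, (bif a then bs.headD false && w else
      bs.headD false || w), Bool.xor a (Bool.xor (bs.headD false) w) :: out) = r at this ⊢
    rw [foldl_bit_cons, List.length_cons, ← Nat.add_assoc as.length] at this
    rw [hbs, List.foldr_cons, List.length_cons, Nat.add_right_comm as.length 1 out.length]
    generalize r.2.1.toNat + r.1.foldr Nat.bit 0 = y at this ⊢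
    generalize bs.headD false = b at this ⊢
    rw [pow_succ 2 out.length] at this
    cases a <;> cases b <;> cases w <;> simp [Nat.bit] at this ⊢ <;> linarith

theorem foldl_or (l : List Bool) (w : Bool) :
    l.foldl (fun c b => c || b) w = decide (w.toNat + l.foldr Nat.bit 0 ≠ 0) := by
  induction l generalizing w with
  | nil => cases w <;> rfl
  | cons b l ih =>
    rw [List.foldl_cons, ih, List.foldr_cons]
    cases b <;> cases w <;> simp [Nat.bit]

/-- The produced digits form a number less than `2 ^ length`. By the invariant, a remaining borrow
or a nonzero rest of the subtrahend therefore means `m < n`, where truncated subtraction gives `0`;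
otherwise the digits are the exact difference. -/
theorem sub_eq (m n : ℕ) : m - n =
    bif ((encodeNat m).foldl subStep (encodeNat n, false, [])).1.foldl (fun c b => c || b)
      ((encodeNat m).foldl subStep (encodeNat n, false, [])).2.1 then 0 else
    ((encodeNat m).foldl subStep (encodeNat n, false, [])).2.2.foldl (fun n b => Nat.bit b n) 0 := by
  have h := foldl_subStep (encodeNat m) (encodeNat n) false []
  have h1 := length_foldl_subStep (encodeNat m) (encodeNat n) false []
  rw [foldl_or]
  generalize (encodeNat m).foldl subStep (encodeNat n, false, []) = r at *
  have h2 := foldl_bit_lt r.2.2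
  rw [h1] at h2
  simp only [foldr_encodeNat, List.length_nil, pow_zero, one_mul, List.foldl_nil, Nat.add_zero,
    Bool.toNat_false] at h h2
  generalize r.2.1.toNat + r.1.foldr Nat.bit 0 = y at *
  rcases Nat.eq_zero_or_pos y with rfl | hy
  · simp at h ⊢
    omega
  · have : 2 ^ (Computability.encodeNat m).length ≤ 2 ^ (Computability.encodeNat m).length * y :=
      Nat.le_mul_of_pos_right _ hy
    have hy' : y ≠ 0 := by omega
    simp only [ne_eq, hy', not_false_eq_true, decide_true, cond_true]
    omega

namespace PT

variable {α β γ δ : Type} [TreeEnc α] [TreeEnc β] [TreeEnc γ] [TreeEnc δ]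

@[fun_prop]
theorem sub {f g : α → ℕ} (hf : PT f) (hg : PT g) : PT fun x => f x - g x := by
  have h : PT fun p : List Bool × List Bool => p.1.foldl subStep (p.2, false, []) := by
    refine foldl (l := fun p : List Bool × List Bool => p.1) (init := fun p => (p.2, false, []))
      (step := fun _ => subStep) (by fun_prop) (by fun_prop) (by unfold subStep; fun_prop)
      (9 * Polynomial.X + 8) fun p l₁ l₂ h => ?_
    have h1 := foldl_subStep_fst l₁ p.2 false []
    have h2 := length_foldl_subStep l₁ p.2 false []
    generalize l₁.foldl subStep (p.2, false, []) = r at *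
    have h3 := treeSize_le_of_infix (List.drop_suffix l₁.length p.2).isInfix
    have h4 := treeSize_bool_le r.2.1
    have h5 := treeSize_list_le (l := r.2.2) fun b _ => treeSize_bool_le b
    have h6 := length_le_treeSize p.1
    rw [h, List.length_append] at h6
    rw [← h1] at h3
    simp only [treeSize_prod, Polynomial.eval_add, Polynomial.eval_mul, Polynomial.eval_ofNat,
      Polynomial.eval_X, List.length_nil] at *
    rw [h]
    omega
  have h1 := h.comp (hf.encodeNat.pair hg.encodeNat)
  have h2 : PT fun x => ((Computability.encodeNat (f x)).foldl subStep
      (Computability.encodeNat (g x), false, [])).1.foldl (fun c b => c || b)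
      ((Computability.encodeNat (f x)).foldl subStep
        (Computability.encodeNat (g x), false, [])).2.1 :=
    foldlBool (step := fun _ c b => c || b) h1.fst h1.snd.fst (by fun_prop)
  simp only [sub_eq]
  exact h2.cond (const 0) h1.snd.snd.ofDigits

@[fun_prop]
theorem le {f g : α → ℕ} (hf : PT f) (hg : PT g) : PT fun x => decide (f x ≤ g x) := by
  have : PT fun x => decide (f x - g x = 0) := by fun_prop
  simpa only [Nat.sub_eq_zero_iff_le] using this

@[fun_prop]
theorem lt {f g : α → ℕ} (hf : PT f) (hg : PT g) : PT fun x => decide (f x < g x) := by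
  have : PT fun x => !decide (g x ≤ f x) := by fun_prop
  have e : (fun x => decide (f x < g x)) = fun x => !decide (g x ≤ f x) :=
    funext fun x => by rw [← decide_not, decide_eq_decide, Nat.not_le]
  rwa [e]

@[fun_prop]
theorem eq {f g : α → ℕ} (hf : PT f) (hg : PT g) : PT fun x => decide (f x = g x) := by
  have : PT fun x => decide (f x ≤ g x) && decide (g x ≤ f x) := by fun_prop
  convert this using 2 with x
  rw [← Bool.decide_and]
  exact decide_eq_decide.2 le_antisymm_iff

theorem shift {f : α → ℕ} {l : α → List Bool} (hf : PT f) (hl : PT l) :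
    PT fun x => f x * 2 ^ (l x).length := by
  have h0 : ∀ (l : List Bool) n, l.foldl (fun n _ => Nat.bit false n) n = n * 2 ^ l.length := by
    intro l
    induction l with
    | nil => simp
    | cons b l ih =>
      intro n
      rw [List.foldl_cons, ih, List.length_cons, pow_succ]
      simp [Nat.bit]
      ring
  have h : PT fun p : ℕ × List Bool => p.2.foldl (fun n _ => Nat.bit false n) p.1 := by
    refine foldl (l := fun p : ℕ × List Bool => p.2) (init := fun p => p.1)
      (step := fun _ n _ => Nat.bit false n) (by fun_prop) (by fun_prop) (by fun_prop)
      (8 * Polynomial.X + 3) fun p l₁ l₂ h => ?_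
    rw [h0]
    have h1 := treeSize_nat_le (p.1 * 2 ^ l₁.length)
    have h2 := size_le_treeSize p.1
    have h3 : (p.1 * 2 ^ l₁.length).size ≤ p.1.size + l₁.length := by
      rw [Nat.size_le, pow_add]
      exact Nat.mul_lt_mul_of_pos_right (Nat.lt_size_self _) (by positivity)
    have h4 := length_le_treeSize p.2
    rw [h, List.length_append] at h4
    simp only [treeSize_prod, Polynomial.eval_add, Polynomial.eval_mul, Polynomial.eval_ofNat,
      Polynomial.eval_X] at *
    rw [h]
    omega
  simpa only [h0] using h.comp (hf.pair hl)

-- Addition is reduced to subtraction: `K - ((K - f) - g) = f + g` as soon as `f + g ≤ K`, and a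
-- power of two of sufficient length is such a `K`.
@[fun_prop]
theorem add {f g : α → ℕ} (hf : PT f) (hg : PT g) : PT fun x => f x + g x := by
  have h : PT fun x => 2 * 2 ^ (Computability.encodeNat (f x)).length *
      2 ^ (Computability.encodeNat (g x)).length :=
    ((const 2).shift hf.encodeNat).shift hg.encodeNat
  have h' := h.sub ((h.sub hf).sub hg)
  convert h' using 2 with x
  rw [length_encodeNat, length_encodeNat]
  have h1 := Nat.lt_size_self (f x)
  have h2 := Nat.lt_size_self (g x)
  have h3 : 2 ^ (f x).size ≤ 2 ^ (f x).size * 2 ^ (g x).size :=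
    Nat.le_mul_of_pos_right _ (by positivity)
  have h4 : 2 ^ (g x).size ≤ 2 ^ (f x).size * 2 ^ (g x).size :=
    Nat.le_mul_of_pos_left _ (by positivity)
  rw [mul_assoc]
  omega

theorem treeSize_mul_le (m n : ℕ) : treeSize (m * n) ≤ 8 * (treeSize m + treeSize n) + 3 := by
  have h1 := treeSize_nat_le (m * n)
  have h2 := size_le_treeSize m
  have h3 := size_le_treeSize n
  have h4 : (m * n).size ≤ m.size + n.size := by
    rw [Nat.size_le, pow_add]
    exact Nat.mul_lt_mul'' (Nat.lt_size_self _) (Nat.lt_size_self _)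
  omega

@[fun_prop]
theorem mul {f g : α → ℕ} (hf : PT f) (hg : PT g) : PT fun x => f x * g x := by
  have h0 : ∀ (l : List Bool) n, l.foldr (fun b k => Nat.bit false k + bif b then n else 0) 0 =
      l.foldr Nat.bit 0 * n := by
    intro l n
    induction l with
    | nil => simp
    | cons b l ih =>
      rw [List.foldr_cons, ih, List.foldr_cons]
      cases b <;> simp [Nat.bit] <;> ring
  have h : PT fun p : ℕ × ℕ => (Computability.encodeNat p.1).foldr
      (fun b k => Nat.bit false k + bif b then p.2 else 0) 0 := by
    refine foldr (l := fun p : ℕ × ℕ => Computability.encodeNat p.1) (init := fun p => 0)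
      (step := fun p b k => Nat.bit false k + bif b then p.2 else 0) (by fun_prop) (by fun_prop)
      -- Intermediate values are at most the final product, so `treeSize_nat_mono` applied to the
      -- bound of `treeSize_mul_le` gives `8 * (8 * s + 3) + 3`.
      (by fun_prop) (64 * Polynomial.X + 27) fun p l₂ h => ?_
    rw [h0]
    have hle : l₂.foldr Nat.bit 0 ≤ p.1 := by
      obtain ⟨t, ht⟩ := h
      conv_rhs => rw [← foldr_encodeNat p.1, ← ht]
      clear ht
      induction t with
      | nil => simp
      | cons b t ih =>
        refine ih.trans ?_
        rw [List.cons_append, List.foldr_cons]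
        cases b <;> simp [Nat.bit] <;> omega
    have h1 := treeSize_nat_mono (Nat.mul_le_mul_right p.2 hle)
    have h2 := treeSize_mul_le p.1 p.2
    simp only [treeSize_prod, Polynomial.eval_add, Polynomial.eval_mul, Polynomial.eval_ofNat,
      Polynomial.eval_X] at *
    omega
  simpa only [h0, foldr_encodeNat] using h.comp (hf.pair hg)

end PT

/-! ### Equivalence of scoring vectors -/

section Voting

variable {n : ℕ}

/-- The entries of the two vectors, relative to the last entry, are proportional, with a positive
factor. -/
def AffineRelated (α β : Fin (n + 1) → ℚ) : Prop :=
  (∀ j, (α j - α (Fin.last n)) * (β 0 - β (Fin.last n)) =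
    (β j - β (Fin.last n)) * (α 0 - α (Fin.last n))) ∧
  (α 0 = α (Fin.last n) ↔ β 0 = β (Fin.last n))

/-- All scores undergo the same increasing affine map, with constant term `t` times the number of
votes. -/
theorem winners_eq_of_affine {C : Finset ℕ} {m : ℕ} {α β : Fin m → ℚ} {k t : ℚ} (hk : 0 < k)
    (h : ∀ j, β j = k * α j + t) (V : Multiset (Vote C m)) : winners α V = winners β V := by
  have hs : ∀ c : C, score β V c = k * score α V c + V.card * t := by
    intro c
    simp only [score, h, Multiset.sum_map_add, Multiset.sum_map_mul_left, Multiset.map_const',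
      Multiset.sum_replicate, nsmul_eq_mul]
  ext c
  simp only [winners, Set.mem_ofPred_eq, hs, add_le_add_iff_right, mul_le_mul_iff_right₀ hk]

theorem winners_eq_of_const {C : Finset ℕ} {m : ℕ} {α β : Fin m → ℚ} {s t : ℚ}
    (hα : ∀ j, α j = s) (hβ : ∀ j, β j = t) (V : Multiset (Vote C m)) :
    winners α V = winners β V := by
  ext c
  simp [winners, score, hα, hβ]

theorem Antitone.eq_last {α : Fin (n + 1) → ℚ} (hα : Antitone α) (h : α 0 = α (Fin.last n))
    (j : Fin (n + 1)) : α j = α (Fin.last n) :=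
  le_antisymm ((hα (Fin.zero_le j)).trans h.le) (hα (Fin.le_last j))

theorem Antitone.last_lt {α : Fin (n + 1) → ℚ} (hα : Antitone α) (h : α 0 ≠ α (Fin.last n)) :
    α (Fin.last n) < α 0 :=
  lt_of_le_of_ne (hα (Fin.zero_le _)) (Ne.symm h)

/-- Elections over the positions themselves, as candidates. -/
theorem VectorEquivalent.perm {m : ℕ} {α β : Fin m → ℚ} (h : VectorEquivalent α β)
    (S : Multiset (Equiv.Perm (Fin m))) (c : Fin m) :
    (∀ d, (S.map fun σ => α (σ d)).sum ≤ (S.map fun σ => α (σ c)).sum) ↔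
      ∀ d, (S.map fun σ => β (σ d)).sum ≤ (S.map fun σ => β (σ c)).sum := by
  let e : (Finset.range m : Finset ℕ) ≃ Fin m :=
    (Finset.range m).equivFin.trans (finCongr (Finset.card_range m))
  have hs : ∀ γ : Fin m → ℚ, e.symm c ∈ winners γ (S.map fun σ => e.trans σ) ↔
      ∀ d, (S.map fun σ => γ (σ d)).sum ≤ (S.map fun σ => γ (σ c)).sum := by
    intro γ
    rw [← e.forall_congr_right]
    simp only [winners, score, Set.mem_ofPred_eq, Multiset.map_map, Function.comp_def,
      Equiv.trans_apply, Equiv.apply_symm_apply]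
  have h1 := h (Finset.range m) (Finset.card_range m) (S.map fun σ => e.trans σ)
  rw [← hs, ← hs, h1]

theorem Equiv.Perm.exists_apply_eq_and {ι : Type*} [DecidableEq ι] {i j i' j' : ι} (h : i ≠ j)
    (h' : i' ≠ j') : ∃ σ : Equiv.Perm ι, σ i = i' ∧ σ j = j' := by
  refine ⟨Equiv.swap (Equiv.swap i i' j) j' * Equiv.swap i i', ?_, ?_⟩
  · rw [Equiv.Perm.mul_apply, Equiv.swap_apply_left]
    refine Equiv.swap_apply_of_ne_of_ne (fun he => h ?_) h'
    exact (Equiv.swap i i').injective ((Equiv.swap_apply_left i i').trans he)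
  · rw [Equiv.Perm.mul_apply, Equiv.swap_apply_left]

/-- Votes under which the first two candidates tie and every other candidate `x` is far behind. -/
def padVotes (n : ℕ) : Multiset (Equiv.Perm (Fin (n + 2))) :=
  (Finset.univ.filter fun e : Fin (n + 2) => e ≠ 0 ∧ e ≠ 1).val.map
      (fun e => Equiv.swap e (Fin.last (n + 1))) +
    (Finset.univ.filter fun e : Fin (n + 2) => e ≠ 0 ∧ e ≠ 1).val.map
      (fun e => Equiv.swap 0 1 * Equiv.swap e (Fin.last (n + 1)))

theorem sum_padVotes (α : Fin (n + 2) → ℚ) (x : Fin (n + 2)) :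
    ((padVotes n).map fun σ => α (σ x)).sum =
      ∑ e ∈ Finset.univ.filter fun e : Fin (n + 2) => e ≠ 0 ∧ e ≠ 1,
        (α (Equiv.swap e (Fin.last (n + 1)) x) +
          α (Equiv.swap 0 1 (Equiv.swap e (Fin.last (n + 1)) x))) := by
  rw [Finset.sum_add_distrib, padVotes, Multiset.map_add, Multiset.sum_add, Multiset.map_map,
    Multiset.map_map]
  rfl

theorem last_ne_of_ne {e : Fin (n + 2)} (h : e ≠ 0 ∧ e ≠ 1) :
    Fin.last (n + 1) ≠ 0 ∧ Fin.last (n + 1) ≠ 1 := by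
  rcases e with ⟨e, he⟩
  simp only [ne_eq, Fin.ext_iff, Fin.val_last, Fin.val_zero, Fin.val_one] at *
  omega

/-- The votes come in pairs that differ by exchanging the first two positions, and these are held by
candidates `0` and `1`. -/
theorem sum_padVotes_zero_one (α : Fin (n + 2) → ℚ) :
    ((padVotes n).map fun σ => α (σ 1)).sum = ((padVotes n).map fun σ => α (σ 0)).sum := by
  rw [sum_padVotes, sum_padVotes]
  refine Finset.sum_congr rfl fun e he => ?_
  have h := (Finset.mem_filter.1 he).2
  have h' := last_ne_of_ne h
  rw [Equiv.swap_apply_of_ne_of_ne h.1.symm h'.1.symm,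
    Equiv.swap_apply_of_ne_of_ne h.2.symm h'.2.symm, Equiv.swap_apply_left,
    Equiv.swap_apply_right, add_comm]

/-- In each pair of votes candidate `0` gets `α 0 + α 1`, whereas `x` stays in one position behind
these two and gets at most that much. In the pair with `e = x`, it is last twice, which alone costs
it the stated margin. -/
theorem sum_padVotes_add_le {α : Fin (n + 2) → ℚ} (hα : Antitone α) {x : Fin (n + 2)}
    (hx : x ≠ 0 ∧ x ≠ 1) :
    ((padVotes n).map fun σ => α (σ x)).sum + (α 0 - α (Fin.last (n + 1))) ≤
      ((padVotes n).map fun σ => α (σ 0)).sum := by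
  have hx' : x ∈ Finset.univ.filter fun e : Fin (n + 2) => e ≠ 0 ∧ e ≠ 1 := by simp [hx]
  have hl := last_ne_of_ne hx
  rw [sum_padVotes, sum_padVotes, ← Finset.add_sum_erase _ _ hx', ← Finset.add_sum_erase _ _ hx',
    add_right_comm]
  have h1 : ∀ e ∈ Finset.univ.filter fun e : Fin (n + 2) => e ≠ 0 ∧ e ≠ 1,
      α (Equiv.swap e (Fin.last (n + 1)) 0) +
          α (Equiv.swap 0 1 (Equiv.swap e (Fin.last (n + 1)) 0)) = α 0 + α 1 := by
    intro e he
    have h := (Finset.mem_filter.1 he).2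
    rw [Equiv.swap_apply_of_ne_of_ne h.1.symm hl.1.symm, Equiv.swap_apply_left]
  refine add_le_add ?_ (Finset.sum_le_sum fun e he => ?_)
  · rw [h1 x hx', Equiv.swap_apply_left, Equiv.swap_apply_of_ne_of_ne hl.1 hl.2]
    have := hα (Fin.le_last 1)
    linarith
  · have he' := Finset.mem_of_mem_erase he
    rw [h1 e he']
    have h := (Finset.mem_filter.1 he').2
    have hy : Equiv.swap e (Fin.last (n + 1)) x ≠ 0 ∧ Equiv.swap e (Fin.last (n + 1)) x ≠ 1 := by
      rw [Equiv.swap_apply_def]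
      split_ifs <;> assumption
    rw [Equiv.swap_apply_of_ne_of_ne hy.1 hy.2]
    refine add_le_add (hα (Fin.zero_le _)) (hα ?_)
    generalize Equiv.swap e (Fin.last (n + 1)) x = y at hy
    rw [Fin.le_def, Fin.val_one]
    have := hy.1
    rw [ne_eq, Fin.ext_iff, Fin.val_zero] at this
    omega

/-- The padding ties candidates `0` and `1`, so the remaining `a + b` votes decide between them, and
the inequality compares their points. Each of these votes favors a third candidate over `0` by at
most `α 0 - α last`, so `a + b` copies of the padding keep all third candidates from beating `0`
once the inequality holds. -/
theorem forall_sum_le_iff {α : Fin (n + 2) → ℚ} (hα : Antitone α) (a b : ℕ) {j : Fin (n + 2)}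
    {σ τ : Equiv.Perm (Fin (n + 2))} (hσ : σ 0 = j) (hσ' : σ 1 = Fin.last (n + 1))
    (hτ : τ 0 = Fin.last (n + 1)) (hτ' : τ 1 = 0) :
    (∀ d, (((a + b) • padVotes n + Multiset.replicate a σ + Multiset.replicate b τ).map
        fun ρ => α (ρ d)).sum ≤
      (((a + b) • padVotes n + Multiset.replicate a σ + Multiset.replicate b τ).map
        fun ρ => α (ρ 0)).sum) ↔
    b * (α 0 - α (Fin.last (n + 1))) ≤ a * (α j - α (Fin.last (n + 1))) := by
  simp only [Multiset.map_add, Multiset.sum_add, Multiset.map_nsmul, Multiset.sum_nsmul,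
    Multiset.map_replicate, Multiset.sum_replicate, nsmul_eq_mul, hσ, hτ]
  constructor
  · intro h
    have := h 1
    rw [sum_padVotes_zero_one, hσ', hτ'] at this
    linarith
  · intro h d
    by_cases h0 : d = 0
    · rw [h0, hσ, hτ]
    by_cases h1 : d = 1
    · rw [h1, sum_padVotes_zero_one, hσ', hτ']
      linarith
    have h2 := sum_padVotes_add_le hα ⟨h0, h1⟩
    have h3 := mul_le_mul_of_nonneg_left h2 (Nat.cast_nonneg (α := ℚ) (a + b))
    have h4 := mul_le_mul_of_nonneg_left (hα (Fin.zero_le (σ d))) (Nat.cast_nonneg (α := ℚ) a)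
    have h5 := mul_le_mul_of_nonneg_left (hα (Fin.zero_le (τ d))) (Nat.cast_nonneg (α := ℚ) b)
    have h6 := mul_le_mul_of_nonneg_left (hα (Fin.le_last j)) (Nat.cast_nonneg (α := ℚ) a)
    push_cast at h3 ⊢
    linarith

theorem VectorEquivalent.mul_le_mul_iff {α β : Fin (n + 2) → ℚ} (h : VectorEquivalent α β)
    (hα : Antitone α) (hβ : Antitone β) (a b : ℕ) {j : Fin (n + 2)} (hj : j ≠ Fin.last (n + 1)) :
    b * (α 0 - α (Fin.last (n + 1))) ≤ a * (α j - α (Fin.last (n + 1))) ↔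
      b * (β 0 - β (Fin.last (n + 1))) ≤ a * (β j - β (Fin.last (n + 1))) := by
  obtain ⟨σ, hσ, hσ'⟩ := Equiv.Perm.exists_apply_eq_and (Fin.zero_ne_one (n := n)) hj
  obtain ⟨τ, hτ, hτ'⟩ := Equiv.Perm.exists_apply_eq_and (Fin.zero_ne_one (n := n))
    (Fin.last_pos (n := n)).ne'
  rw [← forall_sum_le_iff hα a b hσ hσ' hτ hτ', ← forall_sum_le_iff hβ a b hσ hσ' hτ hτ', h.perm]

theorem VectorEquivalent.symm {m : ℕ} {α β : Fin m → ℚ} (h : VectorEquivalent α β) :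
    VectorEquivalent β α := fun C hC V => (h C hC V).symm

/-- In an election with a single vote, the candidate ranked last wins only if the first and last
entries agree. -/
theorem VectorEquivalent.zero_eq_last {α β : Fin (n + 1) → ℚ} (h : VectorEquivalent α β)
    (hβ : Antitone β) (hα : Antitone α) (h0 : α 0 = α (Fin.last n)) : β 0 = β (Fin.last n) := by
  have h1 := (h.perm {1} (Fin.last n)).1 (by simp [hα.eq_last h0])
  exact le_antisymm (by simpa using h1 0) (hβ (Fin.zero_le _))

/-- The elections above compare the ratio `(α j - α last) / (α 0 - α last)` with every fraction `b /
a`. The entries being rational, the ratio itself is such a fraction, and using it for both vectors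
gives the two inequalities between their ratios. -/
theorem VectorEquivalent.affineRelated {α β : Fin (n + 1) → ℚ} (h : VectorEquivalent α β)
    (hα : Antitone α) (hβ : Antitone β) : AffineRelated α β := by
  have hc : α 0 = α (Fin.last n) ↔ β 0 = β (Fin.last n) :=
    ⟨h.zero_eq_last hβ hα, h.symm.zero_eq_last hα hβ⟩
  refine ⟨fun j => ?_, hc⟩
  by_cases hj : j = Fin.last n
  · rw [hj]; ring
  by_cases h0 : α 0 = α (Fin.last n)
  · rw [h0, hc.1 h0]; ring
  rcases n with _ | n
  · exact absurd (Fin.eq_zero j) hj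
  have key : ∀ {α β : Fin (n + 2) → ℚ}, VectorEquivalent α β → Antitone α → Antitone β →
      α (Fin.last (n + 1)) < α 0 → (α j - α (Fin.last (n + 1))) * (β 0 - β (Fin.last (n + 1))) ≤
        (β j - β (Fin.last (n + 1))) * (α 0 - α (Fin.last (n + 1))) := by
    intro α β h hα hβ h1
    have hp : 0 < α 0 - α (Fin.last (n + 1)) := sub_pos.2 h1
    have hn : 0 ≤ α j - α (Fin.last (n + 1)) := sub_nonneg.2 (hα (Fin.le_last j))
    obtain ⟨x, hx⟩ : ∃ x, x = (α j - α (Fin.last (n + 1))) / (α 0 - α (Fin.last (n + 1))) :=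
      ⟨_, rfl⟩
    have hx0 : 0 ≤ x := hx ▸ div_nonneg hn hp.le
    have hxq : (x.num.toNat : ℚ) = x * x.den := by
      have h2 : ((x.num.toNat : ℤ) : ℚ) = x.num :=
        congrArg _ (Int.toNat_of_nonneg (Rat.num_nonneg.2 hx0))
      rw [← Rat.mul_den_eq_num] at h2
      exact_mod_cast h2
    have hd : (0 : ℚ) < x.den := Nat.cast_pos.2 x.den_pos
    -- With the denominator and numerator of the ratio of `α` as numbers of votes, the inequality
    -- for `α` is an equality; the one for `β` is the claim.
    have h3 := (h.mul_le_mul_iff hα hβ x.den x.num.toNat hj).1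
    rw [hxq, mul_comm x, mul_assoc, mul_assoc, mul_le_mul_iff_right₀ hd,
      mul_le_mul_iff_right₀ hd, hx] at h3
    have h4 := h3 (by rw [div_mul_cancel₀ _ hp.ne'])
    rwa [div_mul_eq_mul_div, div_le_iff₀ hp] at h4
  refine le_antisymm (key h hα hβ (hα.last_lt h0)) (key h.symm hβ hα (hβ.last_lt (mt hc.2 h0)))

end Voting

/-! ### Reading and writing vectors of fractions -/

instance : TreeEnc ℤ := ⟨fun z => TreeEnc.tree (decide (z < 0), z.natAbs)⟩

/-- The code of an output symbol by three bits. -/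
def OutSymbol.code : OutSymbol → Bool × Bool × Bool
  | .bit b => (false, b, false)
  | .minus => (true, false, false)
  | .slash => (true, true, false)
  | .comma => (true, true, true)

/-- The output symbol with the given code. -/
def OutSymbol.decode : Bool × Bool × Bool → OutSymbol
  | (false, b, _) => .bit b
  | (true, false, _) => .minus
  | (true, true, false) => .slash
  | (true, true, true) => .comma

theorem OutSymbol.decode_code (o : OutSymbol) : decode o.code = o := by cases o <;> rfl

instance : Inhabited OutSymbol := ⟨.minus⟩

instance : TreeEnc OutSymbol := ⟨fun o => TreeEnc.tree o.code⟩

theorem tree_map_eq {α β : Type} [TreeEnc α] [TreeEnc β] {f : α → β}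
    (h : ∀ a, TreeEnc.tree (f a) = TreeEnc.tree a) (l : List α) :
    TreeEnc.tree (l.map f) = TreeEnc.tree l := by
  induction l with
  | nil => rfl
  | cons a l ih =>
    rw [List.map_cons]
    exact congrArg _ (congrArg₂ BinTree.node (h a) ih)

theorem treeSize_bit_le (b : Bool) (n : ℕ) : treeSize (Nat.bit b n) ≤ treeSize n + 8 := by
  by_cases h : n = 0 → b = true
  · have := treeSize_bool_le b
    rw [treeSize_nat, encodeNat_bit h, treeSize_cons, treeSize_nat]
    omega
  · push Not at h
    obtain ⟨rfl, hb⟩ := h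
    have : b = false := by simpa using hb
    subst this
    exact Nat.le_add_right _ _

/-- The state of the parser: the fractions found so far, each with a sign, a numerator and a
denominator; the first of them is in progress. -/
abbrev ParseState : Type := List ((Bool × ℕ) × ℕ)

/-- One step of the parser, which reads from right to left. -/
def parseStep (o : OutSymbol) (s : ParseState) : ParseState :=
  match o with
  | .bit b => (((s.headD ((false, 0), 0)).1.1, Nat.bit b (s.headD ((false, 0), 0)).1.2),
      (s.headD ((false, 0), 0)).2) :: s.tail
  | .minus => ((true, (s.headD ((false, 0), 0)).1.2), (s.headD ((false, 0), 0)).2) :: s.tail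
  | .slash => (((s.headD ((false, 0), 0)).1.1, 0), (s.headD ((false, 0), 0)).1.2) :: s.tail
  | .comma => ((false, 0), 0) :: s

theorem treeSize_zero : treeSize 0 = 3 := rfl

/-- No step duplicates data: digits are extended or moved from numerator to denominator. Growth by a
constant per symbol makes the state linear in the input length. -/
theorem treeSize_parseStep_le (o : OutSymbol) (s : ParseState) :
    treeSize (parseStep o s) ≤ treeSize s + 30 := by
  rcases s with _ | ⟨⟨⟨c, n⟩, d⟩, s⟩
  · rcases o with b | _ | _ | _
    · have := treeSize_bit_le b 0
      simp [parseStep, treeSize_zero] at *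
      omega
    all_goals simp [parseStep, treeSize_zero]
  · have h1 := treeSize_bool_le c
    have h2 := treeSize_pos n
    have h3 := treeSize_pos d
    rcases o with b | _ | _ | _
    · have := treeSize_bit_le b n
      simp [parseStep] at *
      omega
    all_goals
      simp [parseStep, treeSize_zero]
      try omega

theorem treeSize_foldr_parseStep_le (l : List OutSymbol) :
    treeSize (l.foldr parseStep []) ≤ 30 * l.length + 3 := by
  induction l with
  | nil => simp
  | cons o l ih =>
    have := treeSize_parseStep_le o (l.foldr parseStep [])
    rw [List.foldr_cons, List.length_cons]
    omega

theorem foldr_parseStep_bits (l : List Bool) (c : Bool) (n d : ℕ) (s : ParseState) :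
    (l.map OutSymbol.bit).foldr parseStep (((c, n), d) :: s) =
      ((c, l.foldr Nat.bit n), d) :: s := by
  induction l with
  | nil => rfl
  | cons b l ih => rw [List.map_cons, List.foldr_cons, ih]; rfl

/-- From right to left, the end marker opens a fraction, the digits of the denominator are collected
in the place of the numerator, and the bar moves them to their final place. As codes put the least
significant digit first, each digit read is the new lowest one. -/
theorem foldr_parseStep_encodeFraction (x : ℤ × ℕ) (s : ParseState) :
    (encodeFraction x).foldr parseStep s = ((decide (x.1 < 0), x.1.natAbs), x.2) :: s := by
  rw [encodeFraction, encodeInt, List.append_assoc, List.foldr_append, List.foldr_append,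
    List.foldr_cons, List.foldr_append, List.foldr_cons, List.foldr_nil]
  change List.foldr parseStep (List.foldr parseStep (parseStep .slash (List.foldr parseStep
    (((false, 0), 0) :: s) _)) _) _ = _
  rw [foldr_parseStep_bits, foldr_encodeNat]
  change List.foldr parseStep (List.foldr parseStep (((false, 0), x.2) :: s) _) _ = _
  rw [foldr_parseStep_bits, foldr_encodeNat]
  split_ifs with h
  · rw [decide_eq_true h]
    rfl
  · rw [decide_eq_false h]
    rfl

theorem foldr_parseStep_encodeFractions (l : List (ℤ × ℕ)) :
    (encodeFractions l).foldr parseStep [] =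
      l.map fun x => ((decide (x.1 < 0), x.1.natAbs), x.2) := by
  induction l with
  | nil => rfl
  | cons x l ih =>
    rw [List.map_cons, ← ih, ← foldr_parseStep_encodeFraction, ← List.foldr_append]
    rfl

theorem foldr_append_eq_flatten {α : Type*} (l : List (List α)) :
    l.foldr (fun a t => a ++ t) [] = l.flatten := by
  induction l with
  | nil => rfl
  | cons a l ih => rw [List.foldr_cons, ih, List.flatten_cons]

theorem treeSize_flatten_le {α : Type} [TreeEnc α] (l : List (List α)) :
    treeSize l.flatten ≤ treeSize l := by
  induction l with
  | nil => simp
  | cons a l ih =>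
    have := treeSize_append a l.flatten
    rw [List.flatten_cons, treeSize_cons]
    omega

namespace PT

variable {α β γ δ : Type} [TreeEnc α] [TreeEnc β] [TreeEnc γ] [TreeEnc δ]

@[fun_prop]
theorem flatten {l : α → List (List β)} (hl : PT l) : PT fun x => (l x).flatten := by
  have h : PT fun l : List (List β) => l.foldr (fun a t => a ++ t) [] :=
    foldr (l := fun l : List (List β) => l) (init := fun _ => []) (step := fun _ a t => a ++ t)
      (by fun_prop) (by fun_prop) (by fun_prop) Polynomial.X fun l l₂ h => by
        rw [Polynomial.eval_X, foldr_append_eq_flatten]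
        exact (treeSize_flatten_le l₂).trans (treeSize_le_of_infix h.isInfix)
  simpa only [foldr_append_eq_flatten] using h.comp hl

@[fun_prop]
theorem isNeg {f : α → ℤ} (hf : PT f) : PT fun x => decide (f x < 0) :=
  PT.fst (f := fun x => (decide (f x < 0), (f x).natAbs)) (hf.recode id (fun _ => rfl) fun _ => rfl)

@[fun_prop]
theorem natAbs {f : α → ℤ} (hf : PT f) : PT fun x => (f x).natAbs :=
  PT.snd (f := fun x => (decide (f x < 0), (f x).natAbs)) (hf.recode id (fun _ => rfl) fun _ => rfl)

theorem parseStep : PT fun p : OutSymbol × ParseState => parseStep p.1 p.2 := by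
  have h : PT fun p : (Bool × Bool × Bool) × ParseState =>
      bif p.1.1 then (bif p.1.2.1 then (bif p.1.2.2 then ((false, 0), 0) :: p.2 else
        (((p.2.headD ((false, 0), 0)).1.1, 0), (p.2.headD ((false, 0), 0)).1.2) :: p.2.tail)
        else ((true, (p.2.headD ((false, 0), 0)).1.2), (p.2.headD ((false, 0), 0)).2) :: p.2.tail)
      else (((p.2.headD ((false, 0), 0)).1.1, Nat.bit p.1.2.1 (p.2.headD ((false, 0), 0)).1.2),
        (p.2.headD ((false, 0), 0)).2) :: p.2.tail := by fun_prop
  refine h.recode (fun p : OutSymbol × ParseState => (p.1.code, p.2)) (fun p => rfl) fun p => ?_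
  rcases p with ⟨_ | _ | _ | _, s⟩ <;> rfl

theorem parse {f : α → List OutSymbol} (hf : PT f) :
    PT fun x => (f x).foldr _root_.parseStep [] := by
  have h : PT fun l : List OutSymbol => l.foldr _root_.parseStep [] :=
    foldr (l := fun l => l) (init := fun _ => []) (step := fun _ => _root_.parseStep) (by fun_prop)
      (by fun_prop)
      (parseStep.comp (f := fun p : List OutSymbol × OutSymbol × ParseState => (p.2.1, p.2.2))
        (by fun_prop)) (30 * Polynomial.X + 3) fun l l₂ h => by
      have h1 := treeSize_foldr_parseStep_le l₂
      have h2 := h.length_le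
      have h3 := length_le_treeSize l
      simp only [Polynomial.eval_add, Polynomial.eval_mul, Polynomial.eval_ofNat,
        Polynomial.eval_X]
      omega
  exact h.comp hf

end PT

theorem unaryEncodeNat_eq (n : ℕ) : unaryEncodeNat n = List.replicate n true := by
  induction n with
  | zero => rfl
  | succ n ih => rw [unaryEncodeNat, ih, List.replicate_succ]

/-- Lists of units play the role of unary numbers. The given machine runs between a conversion of
its input and the parser of its output. -/
theorem PT.of_polyTime {g : ℕ → List (ℤ × ℕ)} (h : PolyTime unaryEncodeNat encodeFractions g) :
    PT fun l : List Unit => g l.length := by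
  have h1 : PT fun l : List Unit => l.map fun _ => (true, true, true) :=
    PT.map (f := fun _ _ => (true, true, true)) (by fun_prop) (by fun_prop)
  have h2 : PolyTime treeWord unaryEncodeNat (fun l : List Unit => l.length) :=
    ((PolyTime.writeList fun _ => true).comp h1).congr id (fun _ => rfl) fun l => by
      simp [unaryEncodeNat_eq]
  have h3 : PolyTime encodeFractions treeWord encodeFractions :=
    (PolyTime.readList (Γ := OutSymbol)).congr encodeFractions (fun _ => rfl) fun _ => rfl
  have h4 : PT fun l : List Unit => encodeFractions (g l.length) := h3.comp (h.comp h2)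
  refine PT.recode h4.parse id (fun _ => rfl) fun l => ?_
  rw [id_eq, foldr_parseStep_encodeFractions]
  exact tree_map_eq (f := fun x : ℤ × ℕ => ((decide (x.1 < 0), x.1.natAbs), x.2)) (fun _ => rfl) _

/-- The code of a fraction, with output symbols replaced by their codes. -/
def fractionCode (x : ℤ × ℕ) : List (Bool × Bool × Bool) :=
  (bif decide (x.1 < 0) then [OutSymbol.minus.code] else []) ++
    (encodeNat x.1.natAbs).map (fun b => (false, b, false)) ++
    OutSymbol.slash.code :: ((encodeNat x.2).map (fun b => (false, b, false)) ++
      [OutSymbol.comma.code])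

theorem map_decode_fractionCode (x : ℤ × ℕ) :
    (fractionCode x).map OutSymbol.decode = encodeFraction x := by
  have h : OutSymbol.decode ∘ (fun b => (false, b, false)) = OutSymbol.bit := rfl
  simp only [fractionCode, List.map_append, List.map_map, List.map_cons, List.map_nil,
    OutSymbol.decode_code, encodeFraction, encodeInt, h]
  by_cases h : x.1 < 0 <;> simp [h, OutSymbol.decode_code]

theorem PT.polyTime_encodeFractions {α : Type} [TreeEnc α] {f : α → List (ℤ × ℕ)} (hf : PT f) :
    PolyTime treeWord encodeFractions f := by
  have h1 : PT fractionCode := by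
    unfold fractionCode
    have h : ∀ {l : ℤ × ℕ → List Bool}, PT l → PT fun x => (l x).map fun b => (false, b, false) :=
      fun {l} hl => PT.map (l := l) (f := fun _ b => (false, b, false)) hl (by fun_prop)
    have h2 := h (l := fun x => Computability.encodeNat x.1.natAbs) (by fun_prop)
    have h3 := h (l := fun x => Computability.encodeNat x.2) (by fun_prop)
    fun_prop
  have h2 := (PT.map (f := fun _ => fractionCode) hf
    (h1.comp (f := fun p : α × ℤ × ℕ => p.2) (by fun_prop))).flatten
  refine ((PolyTime.writeList OutSymbol.decode).comp h2).congr id (fun _ => rfl) fun a => ?_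
  rw [id_eq, id_eq, List.map_flatten, List.map_map, encodeFractions, List.flatMap_def]
  exact congrArg (fun φ => ((f a).map φ).flatten) (funext map_decode_fractionCode)

theorem PT.polyTime {f : List Unit → List (ℤ × ℕ)} (hf : PT f) :
    PolyTime unaryEncodeNat encodeFractions fun n => f (List.replicate n ()) := by
  have h1 : PT fun l : List Bool => l.map fun _ => () :=
    PT.map (f := fun _ _ => ()) (by fun_prop) (by fun_prop)
  have h2 : PolyTime unaryEncodeNat treeWord unaryEncodeNat :=
    (PolyTime.readList (Γ := Bool)).congr unaryEncodeNat (fun _ => rfl) fun _ => rfl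
  refine (hf.polyTime_encodeFractions.comp (PolyTime.comp h1 h2)).congr id (fun _ => rfl) fun n => ?_
  simp [unaryEncodeNat_eq]

/-! ### Clearing denominators -/

/-- The numerator of the difference of two fractions over the product of their denominators, if
this difference is nonnegative. -/
def subNum (x y : ℤ × ℕ) : ℕ :=
  x.1.toNat * y.2 + (-y.1).toNat * x.2 - ((-x.1).toNat * y.2 + y.1.toNat * x.2)

/-- A common denominator of the given fractions, and their numerators over it. -/
def commonDen (l : List (ℕ × ℕ)) : List ℕ × ℕ :=
  l.foldr (fun x s => (x.1 * s.2 :: s.1.map fun n => x.2 * n, x.2 * s.2)) ([], 1)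

/-- A positive multiple, with natural components, of the given vector of fractions minus its last
component. -/
def scaleFractions (l : List (ℤ × ℕ)) : List ℕ :=
  (commonDen (l.map fun x => (subNum x (l.getLastD (0, 1)), x.2))).1

/-- Integers are split into positive and negative parts so that natural arithmetic suffices. The
hypothesis on the fractions ensures that the truncated subtraction is exact. -/
theorem cast_subNum {x y : ℤ × ℕ} (hx : 0 < x.2) (hy : 0 < y.2)
    (h : (y.1 : ℚ) / y.2 ≤ (x.1 : ℚ) / x.2) :
    (subNum x y : ℚ) = ((x.1 : ℚ) / x.2 - (y.1 : ℚ) / y.2) * (x.2 * y.2) := by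
  have hx' : (0 : ℚ) < x.2 := Nat.cast_pos.2 hx
  have hy' : (0 : ℚ) < y.2 := Nat.cast_pos.2 hy
  have e : ∀ z : ℤ, (z : ℚ) = (z.toNat : ℚ) - ((-z).toNat : ℚ) := fun z => by
    exact_mod_cast congrArg (Int.cast (R := ℚ)) (Int.toNat_sub_toNat_neg z).symm
  rw [div_le_div_iff₀ hy' hx', e x.1, e y.1] at h
  have h' : (-x.1).toNat * y.2 + y.1.toNat * x.2 ≤ x.1.toNat * y.2 + (-y.1).toNat * x.2 := by
    have : (((-x.1).toNat * y.2 + y.1.toNat * x.2 : ℕ) : ℚ) ≤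
        ((x.1.toNat * y.2 + (-y.1).toNat * x.2 : ℕ) : ℚ) := by
      push_cast
      linarith
    exact_mod_cast this
  rw [subNum, Nat.cast_sub h', e x.1, e y.1]
  push_cast
  field_simp
  ring

theorem commonDen_cons (x : ℕ × ℕ) (l : List (ℕ × ℕ)) : commonDen (x :: l) =
    (x.1 * (commonDen l).2 :: (commonDen l).1.map fun n => x.2 * n, x.2 * (commonDen l).2) := rfl

theorem commonDen_pos {l : List (ℕ × ℕ)} (h : ∀ x ∈ l, 0 < x.2) : 0 < (commonDen l).2 := by
  induction l with
  | nil => exact Nat.one_pos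
  | cons x l ih =>
    rw [List.forall_mem_cons] at h
    exact Nat.mul_pos h.1 (ih h.2)

theorem map_cast_commonDen {l : List (ℕ × ℕ)} (h : ∀ x ∈ l, 0 < x.2) :
    (commonDen l).1.map (Nat.cast (R := ℚ)) =
      l.map fun x => (x.1 : ℚ) / x.2 * (commonDen l).2 := by
  induction l with
  | nil => rfl
  | cons x l ih =>
    rw [List.forall_mem_cons] at h
    have hx : (x.2 : ℚ) ≠ 0 := Nat.cast_ne_zero.2 h.1.ne'
    rw [commonDen_cons, List.map_cons, List.map_cons, List.map_map]
    congr 1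
    · push_cast
      field_simp
    · have e : (Nat.cast (R := ℚ)) ∘ (fun n => x.2 * n) = (fun q => (x.2 : ℚ) * q) ∘ Nat.cast :=
        funext fun n => Nat.cast_mul _ _
      rw [e, ← List.map_map, ih h.2, List.map_map]
      refine List.map_congr_left fun y _ => ?_
      rw [comp_apply]
      push_cast
      ring

theorem map_cast_scaleFractions {l : List (ℤ × ℕ)} (h : ∀ x ∈ l, 0 < x.2)
    (h' : ∀ x ∈ l, ((l.getLastD (0, 1)).1 : ℚ) / (l.getLastD (0, 1)).2 ≤ (x.1 : ℚ) / x.2) :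
    ∃ c : ℚ, 0 < c ∧ (scaleFractions l).map (Nat.cast (R := ℚ)) =
      l.map fun x => c * ((x.1 : ℚ) / x.2 -
        ((l.getLastD (0, 1)).1 : ℚ) / (l.getLastD (0, 1)).2) := by
  have hy : 0 < (l.getLastD (0, 1)).2 := by
    rcases l.eq_nil_or_concat with rfl | ⟨t, a, rfl⟩
    · exact Nat.one_pos
    · rw [List.concat_eq_append, List.getLastD_concat]
      exact h a (by simp)
  have hp : ∀ x ∈ l.map fun x => (subNum x (l.getLastD (0, 1)), x.2), 0 < x.2 := by
    intro x hx
    obtain ⟨y, hy, rfl⟩ := List.mem_map.1 hx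
    exact h y hy
  -- One factor comes from forming the differences with the last fraction, the other is the common
  -- denominator of these differences.
  refine ⟨(l.getLastD (0, 1)).2 *
    (commonDen (l.map fun x => (subNum x (l.getLastD (0, 1)), x.2))).2,
    mul_pos (Nat.cast_pos.2 hy) (Nat.cast_pos.2 (commonDen_pos hp)), ?_⟩
  rw [scaleFractions, map_cast_commonDen hp, List.map_map]
  refine List.map_congr_left fun x hx => ?_
  have hx' : (x.2 : ℚ) ≠ 0 := Nat.cast_ne_zero.2 (h x hx).ne'
  rw [comp_apply, cast_subNum (h x hx) hy (h' x hx)]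
  field_simp

theorem size_mul_le (m n : ℕ) : (m * n).size ≤ m.size + n.size := by
  rw [Nat.size_le, pow_add]
  exact Nat.mul_lt_mul'' (Nat.lt_size_self _) (Nat.lt_size_self _)

theorem length_commonDen (l : List (ℕ × ℕ)) : (commonDen l).1.length = l.length := by
  induction l with
  | nil => rfl
  | cons x l ih => simp [commonDen_cons, ih]

theorem length_scaleFractions (l : List (ℤ × ℕ)) : (scaleFractions l).length = l.length := by
  rw [scaleFractions, length_commonDen, List.length_map]

/-- Bit lengths are subadditive under products, so even the plain product of all denominators, with
no cancellation, is no longer than the code of the list. -/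
theorem size_commonDen_le (l : List (ℕ × ℕ)) :
    (commonDen l).2.size ≤ treeSize l ∧ ∀ n ∈ (commonDen l).1, n.size ≤ treeSize l := by
  induction l with
  | nil => exact ⟨by simp [commonDen], by simp [commonDen]⟩
  | cons x l ih =>
    have h1 := size_le_treeSize x.1
    have h2 := size_le_treeSize x.2
    rw [commonDen_cons, treeSize_cons, treeSize_prod]
    refine ⟨(size_mul_le _ _).trans (by omega), fun n hn => ?_⟩
    rcases List.mem_cons.1 hn with rfl | hn
    · exact (size_mul_le _ _).trans (by omega)
    · obtain ⟨k, hk, rfl⟩ := List.mem_map.1 hn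
      have := ih.2 k hk
      exact (size_mul_le _ _).trans (by omega)

theorem treeSize_commonDen_le (l : List (ℕ × ℕ)) :
    treeSize (commonDen l) ≤ treeSize l * (8 * treeSize l + 8) + 8 * treeSize l + 8 := by
  have h := size_commonDen_le l
  have h1 := treeSize_nat_le (commonDen l).2
  have h2 : treeSize (commonDen l).1 ≤ _ := treeSize_list_le (n := 8 * treeSize l + 3) fun n hn =>
    (treeSize_nat_le n).trans (by have := h.2 n hn; omega)
  rw [length_commonDen] at h2
  have h3 := Nat.mul_le_mul_right (8 * treeSize l + 3 + 5) (length_le_treeSize l)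
  rw [treeSize_prod]
  rw [show 8 * treeSize l + 8 = 8 * treeSize l + 3 + 5 from rfl]
  omega

/-! ### Clearing denominators in polynomial time -/

namespace PT

variable {α β : Type} [TreeEnc α] [TreeEnc β]

@[fun_prop]
theorem toNat {f : α → ℤ} (hf : PT f) : PT fun x => (f x).toNat := by
  have h : PT fun x => bif decide (f x < 0) then 0 else (f x).natAbs := by fun_prop
  refine (congrArg PT (funext fun x => ?_)).mp h
  by_cases h : f x < 0 <;> simp [h] <;> omega

@[fun_prop]
theorem toNat_neg {f : α → ℤ} (hf : PT f) : PT fun x => (-f x).toNat := by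
  have h : PT fun x => bif decide (f x < 0) then (f x).natAbs else 0 := by fun_prop
  refine (congrArg PT (funext fun x => ?_)).mp h
  by_cases h : f x < 0 <;> simp [h] <;> omega

@[fun_prop]
theorem intSub {f g : α → ℕ} (hf : PT f) (hg : PT g) : PT fun x => (f x : ℤ) - g x := by
  have h : PT fun x => (decide (f x < g x), f x - g x + (g x - f x)) := by fun_prop
  refine h.recode id (fun _ => rfl) fun x => ?_
  change _ = TreeEnc.tree (decide _, Int.natAbs _)
  congr 2
  · exact decide_eq_decide.2 (by rw [id_eq]; omega)
  · rw [id_eq]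
    omega

theorem subNum {f g : α → ℤ × ℕ} (hf : PT f) (hg : PT g) :
    PT fun x => subNum (f x) (g x) := by
  unfold _root_.subNum
  fun_prop

theorem commonDen {f : α → List (ℕ × ℕ)} (hf : PT f) : PT fun x => commonDen (f x) := by
  have hm : PT fun p : List (ℕ × ℕ) × (ℕ × ℕ) × (List ℕ × ℕ) =>
      p.2.2.1.map fun n => p.2.1.2 * n :=
    map (f := fun (p : List (ℕ × ℕ) × (ℕ × ℕ) × (List ℕ × ℕ)) n => p.2.1.2 * n) (by fun_prop)
      (by fun_prop)
  have h : PT _root_.commonDen :=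
    foldr (l := fun l => l) (init := fun _ => ([], 1))
      (step := fun _ (x : ℕ × ℕ) (s : List ℕ × ℕ) =>
        (x.1 * s.2 :: s.1.map fun n => x.2 * n, x.2 * s.2))
      (by fun_prop) (by fun_prop) (by fun_prop)
      (Polynomial.X * (8 * Polynomial.X + 8) + 8 * Polynomial.X + 8) fun l l₂ h => by
        have h1 := treeSize_le_of_infix h.isInfix
        refine (treeSize_commonDen_le l₂).trans ?_
        simp only [Polynomial.eval_add, Polynomial.eval_mul, Polynomial.eval_ofNat,
          Polynomial.eval_X]
        gcongr
  exact h.comp hf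

@[fun_prop]
theorem scaleFractions {f : α → List (ℤ × ℕ)} (hf : PT f) :
    PT fun x => scaleFractions (f x) := by
  have h : PT fun p : List (ℤ × ℕ) × ℤ × ℕ => (_root_.subNum p.2 (p.1.getLastD (0, 1)), p.2.2) := by
    have := subNum (f := fun p : List (ℤ × ℕ) × ℤ × ℕ => p.2)
      (g := fun p => p.1.getLastD (0, 1)) (by fun_prop) (by fun_prop)
    fun_prop
  have h1 : PT fun l : List (ℤ × ℕ) =>
      l.map fun x => (_root_.subNum x (l.getLastD (0, 1)), x.2) :=
    map (f := fun (l : List (ℤ × ℕ)) x => (_root_.subNum x (l.getLastD (0, 1)), x.2)) id' h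
  exact h1.commonDen.fst.comp hf

end PT

/-! ### Normalizing a flexible sequence of vectors -/

/-- All lists that arise from the given one by deleting one entry. -/
def deletions (l : List ℕ) : List (List ℕ) :=
  (l.foldr (fun a s => (a :: s.1, s.1 :: s.2.map fun t => a :: t)) ([], [])).2

/-- Decides whether two nonincreasing vectors are affinely related. -/
def affineTest (e d : List ℕ) : Bool :=
  ((d.zip e).all fun x => decide ((x.1 - d.getLastD 0) * (e.headD 0 - e.getLastD 0) =
    (x.2 - e.getLastD 0) * (d.headD 0 - d.getLastD 0))) &&
  !Bool.xor (decide (d.headD 0 = d.getLastD 0)) (decide (e.headD 0 = e.getLastD 0))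

/-- A vector that is affinely related to `e` and arises from `l` by deleting one entry. -/
def pickDeletion (e l : List ℕ) : List ℕ :=
  ((deletions l).find? (affineTest e)).getD []

/-- The second component of the first pair whose first component is `u`. -/
def lookupNat (u : ℕ) (z : List (ℕ × ℕ)) : ℕ :=
  ((z.find? fun q => decide (q.1 = u)).getD (0, 0)).2

/-- The data of a normalization: `Sum.inl ()` turns a vector into the zero vector,
`Sum.inr (u, v, w)` turns the entries `n` into `(n - w) / (u - v)`. -/
abbrev Normalization : Type := Unit ⊕ ℕ × ℕ × ℕ

/-- The normalization of `l` that extends the given normalization of `e`. -/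
def Normalization.next (e l : List ℕ) (s : Normalization) : Normalization :=
  Sum.elim
    (fun _ => bif decide (l.headD 0 = l.getLastD 0) then .inl () else
      .inr (l.headD 0, l.getLastD 0, (pickDeletion e l).headD 0))
    (fun t => .inr (lookupNat t.1 (e.zip (pickDeletion e l)),
      lookupNat t.2.1 (e.zip (pickDeletion e l)), lookupNat t.2.2 (e.zip (pickDeletion e l)))) s

/-- The normalizations of a sequence of vectors. -/
def Normalization.seq (H : ℕ → List ℕ) : ℕ → Normalization
  | 0 => .inl ()
  | k + 1 => Normalization.next (H k) (H (k + 1)) (seq H k)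

/-- The normalized vector, in fractions. -/
def Normalization.apply (s : Normalization) (l : List ℕ) : List (ℤ × ℕ) :=
  Sum.elim (fun _ => l.map fun _ => (0, 1))
    (fun t => l.map fun n : ℕ => ((n : ℤ) - t.2.2, t.1 - t.2.1)) s

theorem foldr_deletions_fst (l : List ℕ) :
    (l.foldr (fun a s => (a :: s.1, s.1 :: s.2.map fun t => a :: t))
      (([], []) : List ℕ × List (List ℕ))).1 = l := by
  induction l with
  | nil => rfl
  | cons a l ih => rw [List.foldr_cons, ih]

theorem deletions_cons (a : ℕ) (l : List ℕ) :
    deletions (a :: l) = l :: (deletions l).map fun t => a :: t := by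
  rw [deletions, List.foldr_cons, foldr_deletions_fst]
  rfl

theorem length_deletions (l : List ℕ) : (deletions l).length = l.length := by
  induction l with
  | nil => rfl
  | cons a l ih => simp [deletions_cons, ih]

theorem treeSize_le_of_mem_deletions {d l : List ℕ} (h : d ∈ deletions l) :
    treeSize d ≤ treeSize l := by
  induction l generalizing d with
  | nil => cases h
  | cons a l ih =>
    rw [deletions_cons, List.mem_cons, List.mem_map] at h
    rw [treeSize_cons]
    rcases h with rfl | ⟨t, ht, rfl⟩
    · omega
    · have := ih ht
      rw [treeSize_cons]
      omega

theorem mem_deletions_ofFn {n : ℕ} {N : Fin (n + 1) → ℕ} {d : List ℕ} :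
    d ∈ deletions (List.ofFn N) ↔ ∃ i : Fin (n + 1), d = List.ofFn fun j => N (i.succAbove j) := by
  induction n generalizing d with
  | zero =>
    rw [List.ofFn_succ, deletions_cons]
    simp [deletions]
  | succ n ih =>
    rw [List.ofFn_succ, deletions_cons, List.mem_cons, List.mem_map, Fin.exists_fin_succ]
    refine or_congr (by simp) ?_
    constructor
    · rintro ⟨t, ht, rfl⟩
      obtain ⟨i, rfl⟩ := ih.1 ht
      exact ⟨i, by simp [List.ofFn_succ]⟩
    · rintro ⟨i, rfl⟩
      exact ⟨_, ih.2 ⟨i, rfl⟩, by simp [List.ofFn_succ]⟩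

theorem treeSize_pickDeletion_le (e l : List ℕ) : treeSize (pickDeletion e l) ≤ treeSize l := by
  rw [pickDeletion]
  cases h : (deletions l).find? (affineTest e) with
  | none => exact three_le_treeSize l
  | some d => exact treeSize_le_of_mem_deletions (List.mem_of_find?_eq_some h)

theorem lookupNat_eq_zero_or (u : ℕ) (z : List (ℕ × ℕ)) :
    lookupNat u z = 0 ∨ ∃ q ∈ z, q.1 = u ∧ lookupNat u z = q.2 := by
  rw [lookupNat]
  cases h : z.find? fun q => decide (q.1 = u) with
  | none => exact .inl rfl
  | some q => exact .inr ⟨q, List.mem_of_find?_eq_some h, by simpa using List.find?_some h, rfl⟩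

theorem treeSize_lookupNat_zip_le (u : ℕ) (e d : List ℕ) :
    treeSize (lookupNat u (e.zip d)) ≤ treeSize d := by
  rcases lookupNat_eq_zero_or u (e.zip d) with h | ⟨q, hq, -, h⟩
  · rw [h]
    exact three_le_treeSize d
  · rw [h]
    exact treeSize_le_of_mem (List.of_mem_zip hq).2

theorem treeSize_headD_le (l : List ℕ) : treeSize (l.headD 0) ≤ treeSize l := by
  cases l with
  | nil => exact le_rfl
  | cons a l => exact treeSize_le_of_mem (by simp)

theorem treeSize_getLastD_le (l : List ℕ) : treeSize (l.getLastD 0) ≤ treeSize l := by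
  rcases l.eq_nil_or_concat with rfl | ⟨t, a, rfl⟩
  · exact le_rfl
  · rw [List.concat_eq_append, List.getLastD_concat]
    exact treeSize_le_of_mem (by simp)

/-- Whatever the previous normalization was, the new one consists of values found in `l`, or the
default `0`. The bound does not involve `s`, so iterating causes no growth. -/
theorem Normalization.treeSize_next_le (e l : List ℕ) (s : Normalization) :
    treeSize (s.next e l) ≤ 3 * treeSize l + 7 := by
  have h1 := treeSize_headD_le l
  have h2 := treeSize_getLastD_le l
  have h3 := treeSize_pickDeletion_le e l
  have h4 := treeSize_headD_le (pickDeletion e l)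
  have h5 := fun u => treeSize_lookupNat_zip_le u e (pickDeletion e l)
  rcases s with s | t
  · by_cases h : l.headD 0 = l.getLastD 0
    · simp only [next, Sum.elim_inl, h, decide_true, cond_true, treeSize_inl]
      have : treeSize () = 1 := rfl
      omega
    · simp only [next, Sum.elim_inl, h, decide_false, cond_false, treeSize_inr, treeSize_prod]
      omega
  · have h6 := h5 t.1
    have h7 := h5 t.2.1
    have h8 := h5 t.2.2
    simp only [next, Sum.elim_inr, treeSize_inr, treeSize_prod]
    omega

/-! ### Computing the normalization in polynomial time -/

namespace PT

variable {α β γ : Type} [TreeEnc α] [TreeEnc β] [TreeEnc γ]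

theorem findGetD {l : α → List β} {p : α → β → Bool} {init : α → β} (hl : PT l)
    (hp : PT fun q : α × β => p q.1 q.2) (hi : PT init) :
    PT fun x => ((l x).find? (p x)).getD (init x) := by
  have key : ∀ x (l : List β), l.foldr (fun b c => bif p x b then b else c) (init x) =
      (l.find? (p x)).getD (init x) := by
    intro x l
    induction l with
    | nil => rfl
    | cons b l ih =>
      rw [List.foldr_cons, ih, List.find?_cons]
      cases p x b <;> rfl
  obtain ⟨r, hr⟩ := hl.exists_size_le
  obtain ⟨r', hr'⟩ := hi.exists_size_le
  have h := foldr (l := l) (init := init) (step := fun x b c => bif p x b then b else c) hl hi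
    (by
      have : PT fun q : α × β × β => p q.1 q.2.1 :=
        hp.comp (f := fun q : α × β × β => (q.1, q.2.1)) (by fun_prop)
      fun_prop) (r + r') fun x l₂ h => by
    rw [key, Polynomial.eval_add]
    have h1 := treeSize_le_of_infix h.isInfix
    have h2 := hr x
    have h3 := hr' x
    cases hf : l₂.find? (p x) with
    | none => exact h3.trans (Nat.le_add_left _ _)
    | some b =>
      have := treeSize_le_of_mem (List.mem_of_find?_eq_some hf)
      simp only [Option.getD_some]
      omega
  simpa only [key] using h

theorem deletions {l : α → List ℕ} (hl : PT l) : PT fun x => deletions (l x) := by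
  have hm : PT fun p : List ℕ × ℕ × (List ℕ × List (List ℕ)) => p.2.2.2.map fun t => p.2.1 :: t :=
    map (f := fun (p : List ℕ × ℕ × (List ℕ × List (List ℕ))) t => p.2.1 :: t) (by fun_prop)
      (by fun_prop)
  have h : PT fun l : List ℕ => l.foldr (fun a s => (a :: s.1, s.1 :: s.2.map fun t => a :: t))
      (([], []) : List ℕ × List (List ℕ)) :=
    foldr (l := fun l => l) (init := fun _ => ([], []))
      (step := fun _ (a : ℕ) (s : List ℕ × List (List ℕ)) =>
        (a :: s.1, s.1 :: s.2.map fun t => a :: t))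
      (by fun_prop) (by fun_prop) (by fun_prop)
      (Polynomial.X * (Polynomial.X + 5) + 3 + Polynomial.X + 1) fun l l₂ h => by
        have h1 := treeSize_le_of_infix h.isInfix
        have h2 : treeSize (_root_.deletions l₂) ≤ _ := treeSize_list_le fun d hd =>
          treeSize_le_of_mem_deletions hd
        rw [length_deletions] at h2
        have h3 : l₂.length * (treeSize l₂ + 5) ≤ treeSize l * (treeSize l + 5) :=
          Nat.mul_le_mul ((length_le_treeSize l₂).trans h1) (by omega)
        rw [treeSize_prod, foldr_deletions_fst]
        change _ + treeSize (_root_.deletions l₂) + 1 ≤ _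
        simp only [Polynomial.eval_add, Polynomial.eval_mul, Polynomial.eval_ofNat,
          Polynomial.eval_X, Polynomial.eval_one]
        omega
  exact h.snd.comp hl

theorem affineTest : PT fun p : List ℕ × List ℕ => affineTest p.1 p.2 := by
  have h : PT fun p : List ℕ × List ℕ => (p.2.zip p.1).all fun x =>
      decide ((x.1 - p.2.getLastD 0) * (p.1.headD 0 - p.1.getLastD 0) =
        (x.2 - p.1.getLastD 0) * (p.2.headD 0 - p.2.getLastD 0)) :=
    all (p := fun (p : List ℕ × List ℕ) (x : ℕ × ℕ) =>
      decide ((x.1 - p.2.getLastD 0) * (p.1.headD 0 - p.1.getLastD 0) =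
        (x.2 - p.1.getLastD 0) * (p.2.headD 0 - p.2.getLastD 0))) (by fun_prop) (by fun_prop)
  unfold _root_.affineTest
  fun_prop

@[fun_prop]
theorem pickDeletion {e l : α → List ℕ} (he : PT e) (hl : PT l) :
    PT fun x => pickDeletion (e x) (l x) :=
  findGetD (p := fun x => _root_.affineTest (e x)) hl.deletions
    (affineTest.comp (f := fun q : α × List ℕ => (e q.1, q.2)) (by fun_prop)) (by fun_prop)

@[fun_prop]
theorem lookupNat {u : α → ℕ} {z : α → List (ℕ × ℕ)} (hu : PT u) (hz : PT z) :
    PT fun x => lookupNat (u x) (z x) :=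
  (findGetD (p := fun x (q : ℕ × ℕ) => decide (q.1 = u x)) (init := fun _ => (0, 0)) hz
    (by fun_prop) (by fun_prop)).snd

theorem normalizationNext :
    PT fun p : (List ℕ × List ℕ) × Normalization => p.2.next p.1.1 p.1.2 := by
  have h := sumCase (s := fun p : (List ℕ × List ℕ) × Normalization => p.2)
    (f := fun q : ((List ℕ × List ℕ) × Normalization) × Unit =>
      bif decide (q.1.1.2.headD 0 = q.1.1.2.getLastD 0) then (.inl () : Normalization) else
      .inr (q.1.1.2.headD 0, q.1.1.2.getLastD 0,
        (_root_.pickDeletion q.1.1.1 q.1.1.2).headD 0))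
    (g := fun q : ((List ℕ × List ℕ) × Normalization) × ℕ × ℕ × ℕ =>
      (.inr (_root_.lookupNat q.2.1 (q.1.1.1.zip (_root_.pickDeletion q.1.1.1 q.1.1.2)),
        _root_.lookupNat q.2.2.1 (q.1.1.1.zip (_root_.pickDeletion q.1.1.1 q.1.1.2)),
        _root_.lookupNat q.2.2.2 (q.1.1.1.zip (_root_.pickDeletion q.1.1.1 q.1.1.2))) :
        Normalization)) (by fun_prop) (by fun_prop) (by fun_prop)
  exact h

theorem normalizationApply : PT fun p : Normalization × List ℕ => p.1.apply p.2 := by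
  have h1 : PT fun q : (Normalization × List ℕ) × Unit =>
      q.1.2.map fun _ => ((0 : ℤ), 1) :=
    map (f := fun _ _ => ((0 : ℤ), 1)) (by fun_prop) (by fun_prop)
  have h2 : PT fun q : (Normalization × List ℕ) × ℕ × ℕ × ℕ =>
      q.1.2.map fun n : ℕ => ((n : ℤ) - q.2.2.2, q.2.1 - q.2.2.1) :=
    map (f := fun (q : (Normalization × List ℕ) × ℕ × ℕ × ℕ) (n : ℕ) =>
      ((n : ℤ) - q.2.2.2, q.2.1 - q.2.2.1)) (by fun_prop) (by fun_prop)
  exact sumCase (s := fun p : Normalization × List ℕ => p.1) (by fun_prop) h1 h2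

theorem normalizationSeq {H : ℕ → List ℕ} (hH : PT fun l : List Unit => H l.length) :
    PT fun l : List Unit => Normalization.seq H l.length := by
  -- A list of units is determined by its length, so the counter of the fold can be extended in
  -- front while the input is consumed from the left.
  have hc : ∀ l : List Unit, l ++ [()] = () :: l := fun l => by
    rw [List.eq_replicate_of_mem (l := l) (a := ()) fun _ _ => rfl, ← List.replicate_succ,
      ← List.replicate_succ']
  have key : ∀ l : List Unit, l.foldl (fun (s : List Unit × Normalization) _ =>
      (() :: s.1, Normalization.next (H s.1.length) (H (() :: s.1).length) s.2)) ([], .inl ()) =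
      (l, Normalization.seq H l.length) := by
    intro l
    induction l using List.reverseRecOn with
    | nil => rfl
    | append_singleton l a ih =>
      rw [List.foldl_append, ih, hc]
      rfl
  obtain ⟨p, hp⟩ := hH.exists_size_le
  have h1 : PT fun q : List Unit × (List Unit × Normalization) × Unit =>
      q.2.1.2.next (H q.2.1.1.length) (H (() :: q.2.1.1).length) := by
    have h2 := hH.comp (f := fun q : List Unit × (List Unit × Normalization) × Unit => q.2.1.1)
      (by fun_prop)
    have h3 := hH.comp
      (f := fun q : List Unit × (List Unit × Normalization) × Unit => () :: q.2.1.1) (by fun_prop)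
    exact normalizationNext.comp ((h2.pair h3).pair (by fun_prop))
  have h := foldl (l := fun l : List Unit => l) (init := fun _ => ([], (.inl () : Normalization)))
    (step := fun _ s _ => (() :: s.1, Normalization.next (H s.1.length) (H (() :: s.1).length) s.2))
    (by fun_prop) (by fun_prop) (by fun_prop) (Polynomial.X + (3 * p + 7) + 1)
    fun l l₁ l₂ h => by
      have h2 : treeSize l₁ ≤ treeSize l :=
        treeSize_le_of_infix (h ▸ (List.prefix_append _ _).isInfix)
      have h3 : treeSize (Normalization.seq H l₁.length) ≤ 3 * p.eval (treeSize l) + 7 := by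
        rcases hn : l₁.length with _ | n
        · change 3 ≤ _
          omega
        · have h4 := (hp l₁).trans (p.eval_le_eval_nat h2)
          have h5 := (Normalization.seq H n).treeSize_next_le (H n) (H (n + 1))
          rw [hn] at h4
          exact h5.trans (by omega)
      rw [key, treeSize_prod]
      simp only [Polynomial.eval_add, Polynomial.eval_mul, Polynomial.eval_ofNat,
        Polynomial.eval_X, Polynomial.eval_one]
      omega
  simp only [key] at h
  exact h.snd

end PT

/-! ### Correctness of the normalization -/

section Lists

variable {n : ℕ}

theorem headD_ofFn {α : Type*} (f : Fin (n + 1) → α) (a : α) : (List.ofFn f).headD a = f 0 := by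
  rw [List.ofFn_succ]; rfl

theorem getLastD_ofFn {α : Type*} (f : Fin (n + 1) → α) (a : α) :
    (List.ofFn f).getLastD a = f (Fin.last n) := by
  rw [List.ofFn_succ', List.concat_eq_append, List.getLastD_concat]

theorem zip_ofFn {n : ℕ} {α β : Type*} (f : Fin n → α) (g : Fin n → β) :
    (List.ofFn f).zip (List.ofFn g) = List.ofFn fun i => (f i, g i) := by
  induction n with
  | zero => simp
  | succ n ih => rw [List.ofFn_succ, List.ofFn_succ, List.zip_cons_cons, ih, List.ofFn_succ]

/-- For nonincreasing vectors, all truncated differences in the test are exact. -/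
theorem affineTest_ofFn {e d : Fin (n + 1) → ℕ} (he : Antitone e) (hd : Antitone d) :
    affineTest (List.ofFn e) (List.ofFn d) = true ↔
      AffineRelated (fun j => (d j : ℚ)) (fun j => (e j : ℚ)) := by
  have hx : ∀ p q : Prop, ∀ [Decidable p] [Decidable q],
      (!Bool.xor (decide p) (decide q)) = true ↔ (p ↔ q) := by
    intro p q _ _
    by_cases p <;> by_cases q <;> simp [*]
  rw [affineTest, zip_ofFn, Bool.and_eq_true, hx, List.all_eq_true, headD_ofFn, headD_ofFn,
    getLastD_ofFn, getLastD_ofFn, AffineRelated, Nat.cast_inj, Nat.cast_inj]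
  refine and_congr_left fun _ => ?_
  rw [List.forall_mem_ofFn_iff]
  refine forall_congr' fun j => ?_
  rw [decide_eq_true_iff, ← Nat.cast_sub (hd (Fin.le_last j)), ← Nat.cast_sub (he (Fin.le_last j)),
    ← Nat.cast_sub (hd (Fin.zero_le _)), ← Nat.cast_sub (he (Fin.zero_le _)), ← Nat.cast_mul,
    ← Nat.cast_mul, Nat.cast_inj]

theorem pickDeletion_ofFn {e : Fin (n + 1) → ℕ} {N : Fin (n + 2) → ℕ} (he : Antitone e)
    (hN : Antitone N) (h : ∃ i : Fin (n + 2),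
      AffineRelated (fun j => (N (i.succAbove j) : ℚ)) (fun j => (e j : ℚ))) :
    ∃ i : Fin (n + 2), pickDeletion (List.ofFn e) (List.ofFn N) =
        List.ofFn (fun j => N (i.succAbove j)) ∧
      AffineRelated (fun j => (N (i.succAbove j) : ℚ)) (fun j => (e j : ℚ)) := by
  have ha : ∀ i : Fin (n + 2), Antitone fun j => N (i.succAbove j) := fun i =>
    hN.comp_monotone (Fin.strictMono_succAbove i).monotone
  rw [pickDeletion]
  cases hf : (deletions (List.ofFn N)).find? (affineTest (List.ofFn e)) with
  | none =>
    obtain ⟨i, hi⟩ := h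
    exact absurd ((affineTest_ofFn he (ha i)).2 hi)
      (List.find?_eq_none.1 hf _ (mem_deletions_ofFn.2 ⟨i, rfl⟩))
  | some d =>
    obtain ⟨i, rfl⟩ := mem_deletions_ofFn.1 (List.mem_of_find?_eq_some hf)
    exact ⟨i, rfl, (affineTest_ofFn he (ha i)).1 (List.find?_some hf)⟩

/-- If an entry of `e` is repeated, the index found may differ from `a`; this is harmless because
only the value of the entry is used. -/
theorem lookupNat_ofFn (e d : Fin n → ℕ) (a : Fin n) :
    ∃ j, e j = e a ∧ lookupNat (e a) ((List.ofFn e).zip (List.ofFn d)) = d j := by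
  rw [zip_ofFn, lookupNat]
  cases hf : (List.ofFn fun i => (e i, d i)).find? fun q => decide (q.1 = e a) with
  | none =>
    exact absurd (decide_eq_true (p := e a = e a) rfl)
      (List.find?_eq_none.1 hf (e a, d a) (List.mem_ofFn.2 ⟨a, rfl⟩))
  | some q =>
    obtain ⟨j, rfl⟩ := List.mem_ofFn.1 (List.mem_of_find?_eq_some hf)
    exact ⟨j, by simpa using List.find?_some hf, rfl⟩

end Lists

namespace Normalization

variable {n : ℕ}

/-- The normalized vector. -/
def vec (s : Normalization) (e : Fin n → ℕ) (j : Fin n) : ℚ :=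
  Sum.elim (fun _ => 0) (fun t => ((e j : ℚ) - t.2.2) / ((t.1 : ℚ) - t.2.1)) s

/-- The normalization fits the vector. -/
def Valid (s : Normalization) (e : Fin (n + 1) → ℕ) : Prop :=
  Sum.elim (fun _ => e 0 = e (Fin.last n))
    (fun t => (∃ a, t.1 = e a) ∧ (∃ b, t.2.1 = e b) ∧ (∃ c, t.2.2 = e c) ∧ t.2.1 < t.1) s

/-- Affinely related vectors have proportional differences, so a quotient of differences agrees on
`e` and on the chosen deletion of `N`. The proof treats separately the case that `e` is constant,
where a nonconstant `N` starts a new scale. -/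
theorem valid_next {e : Fin (n + 1) → ℕ} {N : Fin (n + 2) → ℕ} (he : Antitone e)
    (hN : Antitone N) {s : Normalization} (hs : Valid s e) (h : ∃ i : Fin (n + 2),
      AffineRelated (fun j => (N (i.succAbove j) : ℚ)) (fun j => (e j : ℚ))) :
    Valid (next (List.ofFn e) (List.ofFn N) s) N ∧ ∃ i : Fin (n + 2),
      deleteEntry (vec (next (List.ofFn e) (List.ofFn N) s) N) i = vec s e := by
  obtain ⟨i, hi, hA⟩ := pickDeletion_ofFn he hN h
  have hd : Antitone fun j => (N (i.succAbove j) : ℚ) :=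
    Nat.mono_cast.comp_antitone (hN.comp_monotone (Fin.strictMono_succAbove i).monotone)
  rcases s with s | ⟨u, v, w⟩
  · simp only [next, Sum.elim_inl, hi, headD_ofFn, getLastD_ofFn]
    by_cases h0 : N 0 = N (Fin.last (n + 1))
    · rw [decide_eq_true h0, cond_true]
      exact ⟨h0, i, rfl⟩
    · rw [decide_eq_false h0, cond_false]
      refine ⟨⟨⟨_, rfl⟩, ⟨_, rfl⟩, ⟨_, rfl⟩, lt_of_le_of_ne (hN (Fin.zero_le _)) (Ne.symm h0)⟩,
        i, funext fun j => ?_⟩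
      -- Since `e` is constant, so is the deletion. Its value was taken as `w`, hence the normalized
      -- deletion is zero, like the normalization of `e`.
      have h1 := hA.2.2 (congrArg (Nat.cast (R := ℚ)) hs)
      have h2 : (N (i.succAbove j) : ℚ) = N (i.succAbove 0) := (hd.eq_last h1 j).trans h1.symm
      simp [deleteEntry, vec, h2]
  · obtain ⟨⟨a, ha⟩, ⟨b, hb⟩, ⟨c, hc⟩, hlt⟩ := hs
    simp only at ha hb hc hlt
    subst ha hb hc
    obtain ⟨a', ha, ha'⟩ := lookupNat_ofFn e (fun j => N (i.succAbove j)) a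
    obtain ⟨b', hb, hb'⟩ := lookupNat_ofFn e (fun j => N (i.succAbove j)) b
    obtain ⟨c', hc, hc'⟩ := lookupNat_ofFn e (fun j => N (i.succAbove j)) c
    simp only [next, Sum.elim_inr, hi, ha', hb', hc']
    rw [← ha, ← hb] at hlt
    have he0 : (0 : ℚ) < (e 0 : ℚ) - e (Fin.last n) := by
      rw [sub_pos, Nat.cast_lt]
      exact (he (Fin.le_last b')).trans_lt (hlt.trans_le (he (Fin.zero_le a')))
    have hd0 : (0 : ℚ) < (N (i.succAbove 0) : ℚ) - N (i.succAbove (Fin.last n)) :=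
      sub_pos.2 (hd.last_lt (mt hA.2.1 (sub_pos.1 he0).ne'))
    -- The proportionality factor is the same for all pairs of entries and cancels in the quotient.
    have key : ∀ x y, ((N (i.succAbove x) : ℚ) - N (i.succAbove y)) =
        ((N (i.succAbove 0) : ℚ) - N (i.succAbove (Fin.last n))) /
          ((e 0 : ℚ) - e (Fin.last n)) * ((e x : ℚ) - e y) := by
      intro x y
      have h1 := hA.1 x
      have h2 := hA.1 y
      rw [div_mul_eq_mul_div, eq_div_iff he0.ne']
      linarith
    have hr := div_pos hd0 he0
    have hab : (0 : ℚ) < (e a' : ℚ) - e b' := sub_pos.2 (Nat.cast_lt.2 hlt)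
    refine ⟨⟨⟨_, rfl⟩, ⟨_, rfl⟩, ⟨_, rfl⟩, ?_⟩, i, funext fun j => ?_⟩
    · have := key a' b' ▸ mul_pos hr hab
      exact_mod_cast sub_pos.1 this
    · simp only [deleteEntry, vec, Sum.elim_inr]
      rw [key j c', key a' b', mul_div_mul_left _ _ hr.ne', ha, hb, hc]

/-- The recursion begins at length one, where every vector is constant. -/
theorem valid_seq {N : ∀ m, Fin m → ℕ} (hN : ∀ m, 1 ≤ m → Antitone (N m))
    (h : ∀ m, ∃ i : Fin (m + 2),
      AffineRelated (fun j => (N (m + 2) (i.succAbove j) : ℚ)) (fun j => (N (m + 1) j : ℚ)))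
    (m : ℕ) : Valid (seq (fun k => List.ofFn (N k)) (m + 1)) (N (m + 1)) := by
  induction m with
  | zero =>
    have : seq (fun k => List.ofFn (N k)) 1 = .inl () := by
      simp [seq, next, List.ofFn_succ]
    rw [this]
    exact rfl
  | succ m ih => exact (valid_next (hN _ (by omega)) (hN _ (by omega)) ih (h m)).1

theorem vec_antitone {s : Normalization} {e : Fin (n + 1) → ℕ} (hs : Valid s e)
    (he : Antitone e) : Antitone (vec s e) := by
  intro i j hij
  rcases s with s | ⟨u, v, w⟩
  · exact le_rfl
  · have h : (0 : ℚ) ≤ (u : ℚ) - v := sub_nonneg.2 (Nat.cast_le.2 hs.2.2.2.le)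
    have := he hij
    simp only [vec, Sum.elim_inr]
    gcongr

theorem winners_vec {s : Normalization} {e : Fin (n + 1) → ℕ} (hs : Valid s e)
    (he : Antitone e) {C : Finset ℕ} (V : Multiset (Vote C (n + 1))) :
    winners (fun j => (e j : ℚ)) V = winners (vec s e) V := by
  rcases s with s | ⟨u, v, w⟩
  · exact winners_eq_of_const
      ((Nat.mono_cast.comp_antitone he).eq_last (congrArg (Nat.cast (R := ℚ)) hs))
      (fun _ => rfl) V
  · have h : (0 : ℚ) < (u : ℚ) - v := sub_pos.2 (Nat.cast_lt.2 hs.2.2.2)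
    refine winners_eq_of_affine (k := ((u : ℚ) - v)⁻¹) (t := -w / ((u : ℚ) - v))
      (inv_pos.2 h) (fun j => ?_) V
    simp only [vec, Sum.elim_inr]
    field_simp
    ring

theorem map_apply_ofFn {s : Normalization} {e : Fin (n + 1) → ℕ} (hs : Valid s e) :
    (∀ x ∈ s.apply (List.ofFn e), 0 < x.2) ∧
      (s.apply (List.ofFn e)).map (fun x => (x.1 : ℚ) / (x.2 : ℚ)) = List.ofFn (vec s e) := by
  rcases s with s | ⟨u, v, w⟩
  · simp only [apply, Sum.elim_inl]
    constructor
    · intro x hx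
      obtain ⟨y, _, rfl⟩ := List.mem_map.1 hx
      exact Nat.one_pos
    · rw [List.map_map, List.map_ofFn]
      congr 1
      funext j
      simp [vec]
  · simp only [apply, Sum.elim_inr]
    constructor
    · intro x hx
      obtain ⟨y, _, rfl⟩ := List.mem_map.1 hx
      exact Nat.sub_pos_of_lt hs.2.2.2
    · rw [List.map_map, List.map_ofFn]
      congr 1
      funext j
      simp only [comp_apply, vec, Sum.elim_inr]
      rw [Nat.cast_sub (le_of_lt hs.2.2.2)]
      push_cast
      rfl

end Normalization

/-! ### The main theorem -/

/-- A generator has a natural-valued generator of affinely related vectors, which is computable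
in polynomial time if the given one is. -/
theorem exists_natFamily {T : Set ℚ} {u : Uniformity} {f : VectorFamily} (hf : IsGenerator T f)
    (hu : u.Holds f) : ∃ N : ∀ m, Fin m → ℕ,
      (u = .fp → PT fun l : List Unit => List.ofFn (N l.length)) ∧
      ∀ m, ∃ c t : ℚ, 0 < c ∧ ∀ i, (N m i : ℚ) = c * f m i + t := by
  obtain ⟨g, hg, hgf⟩ : ∃ g : ℕ → List (ℤ × ℕ),
      (u = .fp → PolyTime unaryEncodeNat encodeFractions g) ∧
      ∀ m : ℕ, (∀ x ∈ g m, 0 < x.2) ∧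
        (g m).map (fun x => (x.1 : ℚ) / (x.2 : ℚ)) = List.ofFn (f m) := by
    cases u with
    | fp =>
      obtain ⟨g, h1, h2⟩ := hu
      exact ⟨g, fun _ => h1, h2⟩
    | nonuniform =>
      -- Without uniformity, reduced fractions serve as representation, and both cases can be
      -- treated alike.
      refine ⟨fun m => List.ofFn fun i => ((f m i).num, (f m i).den), nofun, fun m => ⟨?_, ?_⟩⟩
      · intro x hx
        obtain ⟨i, rfl⟩ := List.mem_ofFn.1 hx
        exact (f m i).den_pos
      · rw [List.map_ofFn]
        congr 1
        exact funext fun i => (f m i).num_div_den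
  have hlen : ∀ m, (scaleFractions (g m)).length = m := fun m => by
    simpa [length_scaleFractions] using congrArg List.length (hgf m).2
  have hN : ∀ m, (List.ofFn fun i : Fin m => (scaleFractions (g m)).getD i 0) =
      scaleFractions (g m) := fun m => by
    refine List.ext_getElem (by rw [List.length_ofFn, hlen]) fun i h1 h2 => ?_
    rw [List.getElem_ofFn]
    exact (List.getElem_eq_getD _).symm
  refine ⟨fun m i => (scaleFractions (g m)).getD i 0, fun h => ?_, fun m => ?_⟩
  · simp only [hN]
    exact (PT.of_polyTime (hg h)).scaleFractions
  · rcases m with _ | m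
    · exact ⟨1, 0, one_pos, nofun⟩
    have hl : (((g (m + 1)).getLastD (0, 1)).1 : ℚ) / ((g (m + 1)).getLastD (0, 1)).2 =
        f (m + 1) (Fin.last m) := by
      rw [← getLastD_ofFn (f (m + 1)) (((0 : ℤ) : ℚ) / ((1 : ℕ) : ℚ)), ← (hgf (m + 1)).2]
      exact (List.getLastD_map (f := fun x : ℤ × ℕ => (x.1 : ℚ) / (x.2 : ℚ))).symm
    obtain ⟨c, hc, h⟩ := map_cast_scaleFractions (hgf (m + 1)).1 fun x hx => by
      have hx' := List.mem_map_of_mem (f := fun x : ℤ × ℕ => (x.1 : ℚ) / (x.2 : ℚ)) hx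
      rw [(hgf (m + 1)).2] at hx'
      obtain ⟨i, hi⟩ := List.mem_ofFn.1 hx'
      rw [hl, ← hi]
      exact (hf (m + 1) (by omega)).1 (Fin.le_last i)
    refine ⟨c, -(c * f (m + 1) (Fin.last m)), hc, fun i => ?_⟩
    rw [hl] at h
    have e : ((g (m + 1)).map fun x => c * ((x.1 : ℚ) / x.2 - f (m + 1) (Fin.last m))) =
        ((g (m + 1)).map fun x => (x.1 : ℚ) / x.2).map
          fun q => c * (q - f (m + 1) (Fin.last m)) := by
      rw [List.map_map]
      rfl
    rw [e, (hgf (m + 1)).2, ← hN, List.map_ofFn, List.map_ofFn] at h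
    have := congrFun (List.ofFn_injective h) i
    simp only [comp_apply] at this
    rw [this]
    ring

section

variable {f : VectorFamily} {N : ∀ m, Fin m → ℕ}

theorem natFamily_antitone {T : Set ℚ} (hf : IsGenerator T f)
    (hN : ∀ m, ∃ c t : ℚ, 0 < c ∧ ∀ i, (N m i : ℚ) = c * f m i + t) {m : ℕ} (hm : 1 ≤ m) :
    Antitone (N m) := by
  obtain ⟨c, t, hc, h⟩ := hN m
  intro i j hij
  have := (hf m hm).1 hij
  have h' : (N m j : ℚ) ≤ N m i := by
    rw [h, h]
    gcongr
  exact_mod_cast h'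

theorem winners_natFamily (hN : ∀ m, ∃ c t : ℚ, 0 < c ∧ ∀ i, (N m i : ℚ) = c * f m i + t)
    {C : Finset ℕ} {m : ℕ} (V : Multiset (Vote C m)) :
    winners (f m) V = winners (fun i => (N m i : ℚ)) V := by
  obtain ⟨c, t, hc, h⟩ := hN m
  exact winners_eq_of_affine hc h V

theorem natFamily_flexible (hf : IsFlexible f)
    (hN : ∀ m, ∃ c t : ℚ, 0 < c ∧ ∀ i, (N m i : ℚ) = c * f m i + t) :
    IsFlexible fun m i => (N m i : ℚ) := by
  intro m hm
  obtain ⟨i, hi⟩ := hf m hm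
  obtain ⟨c, t, hc, h⟩ := hN (m + 1)
  refine ⟨i, fun C hC V => ?_⟩
  rw [← winners_natFamily hN, ← hi C hC V]
  exact (winners_eq_of_affine hc (fun j => h _) V).symm

end

theorem FPComputable.of_pt {f : VectorFamily} {G : List Unit → List (ℤ × ℕ)} (hG : PT G)
    (h : ∀ m, (∀ x ∈ G (List.replicate m ()), 0 < x.2) ∧
      (G (List.replicate m ())).map (fun x => (x.1 : ℚ) / (x.2 : ℚ)) = List.ofFn (f m)) :
    FPComputable f :=
  ⟨_, hG.polyTime, h⟩

theorem FPSR_rat_subset_nat (u : Uniformity) : FPSR u ratCoeffs ⊆ FPSR u natCoeffs := by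
  rintro _ ⟨f, hf, hu, hflex, rfl⟩
  obtain ⟨N, hPT, hN⟩ := exists_natFamily hf hu
  refine ⟨fun m i => (N m i : ℚ), fun m hm => ⟨?_, fun i => ⟨_, rfl⟩⟩, ?_,
    natFamily_flexible hflex hN, funext fun C => funext fun V => winners_natFamily hN V⟩
  · exact Nat.mono_cast.comp_antitone (natFamily_antitone hf hN hm)
  · cases u with
    | nonuniform => trivial
    | fp =>
      have hG : PT fun l : List Unit =>
          -- A natural entry is written as a difference with `0` because integers are produced here
          -- as differences of naturals.
          (List.ofFn (N l.length)).map fun n : ℕ => ((n : ℤ) - (0 : ℕ), 1) :=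
        PT.map (f := fun _ (n : ℕ) => ((n : ℤ) - (0 : ℕ), 1)) (hPT rfl) (by fun_prop)
      refine FPComputable.of_pt hG fun m => ?_
      rw [List.length_replicate]
      constructor
      · intro x hx
        obtain ⟨n, _, rfl⟩ := List.mem_map.1 hx
        exact Nat.one_pos
      · rw [List.map_map, List.map_ofFn]
        congr 1
        funext i
        simp

theorem FPSR_rat_subset_PSR_rat (u : Uniformity) : FPSR u ratCoeffs ⊆ PSR u ratCoeffs := by
  rintro _ ⟨f, hf, hu, hflex, rfl⟩
  obtain ⟨N, hPT, hN⟩ := exists_natFamily hf hu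
  have ha : ∀ m, 1 ≤ m → Antitone (N m) := fun m hm => natFamily_antitone hf hN hm
  have hA : ∀ m, ∃ i : Fin (m + 2), AffineRelated
      (fun j => (N (m + 2) (i.succAbove j) : ℚ)) (fun j => (N (m + 1) j : ℚ)) := fun m => by
    obtain ⟨i, hi⟩ := natFamily_flexible hflex hN (m + 1) (by omega)
    exact ⟨i, hi.affineRelated
      (Nat.mono_cast.comp_antitone ((ha _ (by omega)).comp_monotone
        (Fin.strictMono_succAbove i).monotone))
      (Nat.mono_cast.comp_antitone (ha _ (by omega)))⟩
  have hv := Normalization.valid_seq ha hA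
  let s := Normalization.seq fun k => List.ofFn (N k)
  refine ⟨fun m => (s m).vec (N m), fun m hm => ⟨?_, fun _ => trivial⟩, ?_, fun m hm => ?_,
    funext fun C => funext fun V => ?_⟩
  · obtain ⟨m, rfl⟩ := Nat.exists_eq_add_of_le' hm
    exact Normalization.vec_antitone (hv m) (ha _ hm)
  · cases u with
    | nonuniform => trivial
    | fp =>
      have hG : PT fun l : List Unit => (s l.length).apply (List.ofFn (N l.length)) :=
        PT.normalizationApply.comp
          (f := fun l : List Unit => (s l.length, List.ofFn (N l.length)))
          ((PT.normalizationSeq (H := fun k => List.ofFn (N k)) (hPT rfl)).pair (hPT rfl))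
      refine FPComputable.of_pt hG fun m => ?_
      rw [List.length_replicate]
      rcases m with _ | m
      · have : (s 0).apply (List.ofFn (N 0)) = [] := rfl
        rw [this]
        exact ⟨nofun, rfl⟩
      · exact Normalization.map_apply_ofFn (hv m)
  · obtain ⟨m, rfl⟩ := Nat.exists_eq_add_of_le' hm
    exact (Normalization.valid_next (ha _ hm) (ha _ (by omega)) (hv m) (hA m)).2
  · change winners (f C.card) V = winners ((s C.card).vec (N C.card)) V
    rw [winners_natFamily hN]
    generalize hm : C.card = m at V
    rcases m with _ | m
    · rw [Finset.card_eq_zero] at hm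
      subst hm
      exact Set.ext fun c => absurd c.2 (Finset.notMem_empty _)
    · exact Normalization.winners_vec (hv m) (ha _ (by omega)) V

theorem FPSR_mono (u : Uniformity) {S T : Set ℚ} (h : S ⊆ T) : FPSR u S ⊆ FPSR u T := by
  rintro E ⟨f, hf, hu⟩
  exact ⟨f, fun m hm => ⟨(hf m hm).1, fun i => h ((hf m hm).2 i)⟩, hu⟩

theorem PSR_subset_FPSR (u : Uniformity) (T : Set ℚ) : PSR u T ⊆ FPSR u T := by
  rintro E ⟨f, hf, hu, hp, hE⟩
  refine ⟨f, hf, hu, fun m hm => ?_, hE⟩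
  obtain ⟨i, hi⟩ := hp m hm
  exact ⟨i, fun C _ V => by rw [hi]⟩

theorem mainTheorem4 (u : Uniformity) :
    FPSR u natCoeffs = FPSR u ratCoeffs ∧
    FPSR u ratCoeffs = FPSR u nonnegRatCoeffs ∧
    FPSR u nonnegRatCoeffs = FPSR u intCoeffs ∧
    FPSR u intCoeffs = PSR u ratCoeffs := by
  -- Any coefficient set containing the naturals is squeezed between them and the rationals.
  have h {S : Set ℚ} (hS : natCoeffs ⊆ S) : FPSR u S = FPSR u ratCoeffs :=
    (FPSR_mono u (Set.subset_univ S)).antisymm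
      ((FPSR_rat_subset_nat u).trans (FPSR_mono u hS))
  have hnonneg : natCoeffs ⊆ nonnegRatCoeffs := by
    rintro _ ⟨n, rfl⟩
    exact Nat.cast_nonneg (α := ℚ) n
  have hint : natCoeffs ⊆ intCoeffs := by
    rintro _ ⟨n, rfl⟩
    exact ⟨n, Int.cast_natCast n⟩
  refine ⟨h subset_rfl, (h hnonneg).symm, (h hnonneg).trans (h hint).symm, (h hint).trans ?_⟩
  exact (FPSR_rat_subset_PSR_rat u).antisymm (PSR_subset_FPSR u ratCoeffs)
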